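/- All graphs are finite. For a simple graph $H$, $\omega(H)$ is the size of a largest complete subgraph ($\omega=0$ for the empty graph). **Galled-trees.** A galled-tree $N$ on $X$ is a finite DAG such that either $V(N)=X=\{x\}$, or: there is a unique root $\rho_N$, of indegree $0$ and with outdegree $\ge 2$; $X$ is the set of vertices (leaves) of outdegree $0$ and indegree $1$; every other vertex has indegree $1$ and outdegree $\ge2$, or indegree $2$ and outdegree $\ge 1$ (hybrid-vertex); and each biconnected component contains at most one hybrid-vertex both of whose parents lie in that component. A rooted cycle $C$ in a DAG consists of two distinct directed paths (its sides $P^1,P^2$) with common start $\rho_C$ and common end $\eta_C$ and no other common vertex. $N$ is elementary if it consists of a rooted cycle $C$ of length $|X|+1$ with $\rho_C=\rho_N$ and edges attaching one leaf of $X$ to each vertex of $C$ other than $\rho_C$. $N$ is strong if no rooted cycle has a side without internal vertices and none has exactly one internal vertex on both sides. A labeling is a map $t:V(N)\to\{0,1,\odot\}$ with $t(v)=\odot$ iff $v\in X$; it is quasi-discriminating if $t(u)\ne t(v)$ for every edge $(u,v)$ with $v$ not a hybrid-vertex. $(N,t)$ explains the graph on $X$ in which distinct $x,y$ are adjacent iff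 $t(\mathrm{lca}_N(x,y))=1$. A graph is GaTEx if it is isomorphic to a graph explained by a labeled galled-tree. **Modular decomposition and pvr-networks.** Let $G=(V,E)$ be a graph with $V\neq\emptyset$. Its modular decomposition tree $\mathscr T_G$ has the non-empty strong modules of $G$ as vertices, the children of $M$ being the maximal strong modules properly contained in $M$. Its labels are $t_G(M)=\odot$ if $|M|=1$; otherwise $0$ if $G[M]$ is disconnected, $1$ if $G[M]$ is connected but $\overline G[M]$ is not, and *prime* if both are connected. A pvr-network $(N,t)$ of $G$ arises by choosing, for each prime $M$, a strong quasi-discriminating elementary labeled galled-tree $(N_M,t_M)$ that explains the quotient of $G[M]$ by its maximal strong modules $\neq M$, and replacing the edges from $M$ to its children in $\mathscr T_G$ by $N_M$, where the root of $N_M$ is identified with $M$ and each leaf with the corresponding child of $M$. Labels are $t_M$ on the non-leaf vertices of $N_M$ and $t_G$ on the non-prime vertices of $\mathscr T_G$. Leaves $\{x\}$ are identified with $x\in V$. $L(N(v))\subseteq V$ denotes the set of leaves reachable from $v$ in $N$. **Algorithm 2** on $G$ with pvr-network $(N,t)$. Initially $\omega(x):=1$ for all leaves $x$ and no vertex is active.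 Process the non-leaf vertices $v$ of $\mathscr T_G$ in postorder (arg max ties are broken arbitrarily): * $t_G(v)=0$: put $\omega(v):=\max\omega(w)$ over the children $w$ of $v$ in $\mathscr T_G$; activate exactly one child attaining the maximum. * $t_G(v)=1$: put $\omega(v):=\sum\omega(w)$ over the children of $v$ in $\mathscr T_G$; activate all of them. * $t_G(v)=$ prime: let $C$ be the cycle of $N$ with $\rho_C=v$, $\eta=\eta_C$. Put $\omega(\eta):=\omega(u)$ for the child $u$ of $\eta$, and $\omega_{\neg\eta}(\eta):=0$. For the internal vertices $w$ of the sides, bottom-up, let $u'$ be the child of $w$ in $C$ and $u''$ the one not in $C$; put $\omega(w):=\max\{\omega(u'),\omega(u'')\}$, $\omega_{\neg\eta}(w):=\max\{\omega_{\neg\eta}(u'),\omega(u'')\}$ if $t(w)=0$, and the same with sums in place of maxima if $t(w)=1$. Let $x,y$ be the two children of $\rho_C$. * If $t(\rho_C)=0$: put $\omega(v):=\max\{\omega(x),\omega(y)\}$, activate one $w\in\{x,y\}$ attaining it, and for each $w'\neq\rho_C$ on the side containing $w$ (including $\eta$) activate one child of $w'$ with maximum $\omega$ if $t(w')=0$,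 and all children of $w'$ if $t(w')=1$. * If $t(\rho_C)=1$: let $\alpha:=\omega(x)+\omega(y)-\omega(\eta)$, $\beta:=\omega_{\neg\eta}(x)+\omega_{\neg\eta}(y)$, $\omega(v):=\max\{\alpha,\beta\}$, and activate $x,y$. If $\alpha\le\beta$: activate the child other than $\eta$ of each of the two parents of $\eta$; for every other internal vertex $w'$ of the sides activate one of $u',u''$ attaining $\max\{\omega_{\neg\eta}(u'),\omega(u'')\}$ if $t(w')=0$, and both if $t(w')=1$. If $\alpha>\beta$: activate $\eta$, its child, all internal vertices $w$ of the sides, and, if $t(w)=1$, also the child of $w$ not in $C$. Finally $\Omega$ is the set of leaves $x$ for which there is a directed path from $\rho_N$ to $x$ all of whose vertices other than $\rho_N$ are active. The output is $G[\Omega]$ and $\omega(\rho_N)$. **Proposition.** Let $G$ be a GaTEx graph and $(N,t)$ a pvr-network of $G$. Algorithm 2 can be executed on $G$ with $(N,t)$, and after every such execution (whatever choices were made): 1. $\omega(\rho_N)=\omega(G)$; 2. $\omega(v)=\omega(G[L(N(v))])$ for all $v\in V(N)$; 3. $\omega_{\neg\eta}(v)=\omega(G[L(N(v))\setminus L(N(\eta_C))])$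 for every cycle $C$ of $N$ and every vertex $v\ne\rho_C$ of $C$; 4. $\Omega$ induces a maximum clique of $G$. -/

import Mathlib

universe u v

/-! ### Directed acyclic graphs, galled-trees -/

/-- Vertex labels `0`, `1`, `⊙` of a labeled galled-tree. -/
inductive NLabel
  | zero
  | one
  | leaf

namespace Gatex

section Networks

variable {W : Type v}

/-- The children of a vertex. -/
def children (N : Digraph W) (w : W) : Set W := {u | N.Adj w u}

/-- The parents of a vertex. -/
def parents (N : Digraph W) (w : W) : Set W := {u | N.Adj u w}

/-- `Anc N u w`: there is a directed path, possibly a single vertex, from `u` to `w`. -/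
def Anc (N : Digraph W) (u w : W) : Prop := Relation.ReflTransGen N.Adj u w

def IsAcyclic (N : Digraph W) : Prop := ∀ w, ¬ Relation.TransGen N.Adj w w

/-- The subgraph induced by `B` is biconnected: it is connected and no removal of a vertex
disconnects it. -/
def IsBiconnected (N : Digraph W) (B : Set W) : Prop :=
  (N.toSimpleGraphInclusive.induce B).Connected ∧
    ∀ w ∈ B, (N.toSimpleGraphInclusive.induce (B \ {w})).Preconnected

/-- The (vertex set of a) biconnected component; an inclusion-maximal biconnected subgraph is
always an induced subgraph. -/
def IsBiconnectedComponent (N : Digraph W) (B : Set W) : Prop :=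
  Maximal (IsBiconnected N) B

/-- In a galled-tree, the hybrid-vertices are the vertices of indegree 2. -/
def IsHybrid (N : Digraph W) (w : W) : Prop := (parents N w).ncard = 2

/-- `N` is a galled-tree on `X`. -/
structure IsGalledTree (N : Digraph W) (X : Set W) : Prop where
  finite : Finite W
  acyclic : IsAcyclic N
  shape :
    (∃ x, X = {x} ∧ (Set.univ : Set W) = {x}) ∨
    (∃ ρ : W,
      ((parents N ρ).ncard = 0 ∧ 2 ≤ (children N ρ).ncard ∧
        ∀ w, (parents N w).ncard = 0 → w = ρ) ∧
      (∀ x, x ∈ X ↔ (children N x).ncard = 0 ∧ (parents N x).ncard = 1) ∧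
      (∀ w, w ∉ X → w ≠ ρ →
        ((parents N w).ncard = 1 ∧ 2 ≤ (children N w).ncard) ∨
        ((parents N w).ncard = 2 ∧ 1 ≤ (children N w).ncard)) ∧
      (∀ B, IsBiconnectedComponent N B → ∀ h h' : W,
        h ∈ B → IsHybrid N h → parents N h ⊆ B →
        h' ∈ B → IsHybrid N h' → parents N h' ⊆ B → h = h'))

/-- A vertex labeling takes the value `⊙` precisely on the leaves. -/
def IsLabeling (X : Set W) (t : W → NLabel) : Prop := ∀ w, t w = NLabel.leaf ↔ w ∈ X

/-- `w` is a lowest common ancestor of `x` and `y`. -/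
def IsLCA (N : Digraph W) (x y w : W) : Prop :=
  (Anc N w x ∧ Anc N w y) ∧ ∀ z, Anc N z x → Anc N z y → Anc N w z → z = w

/-- The graph explained by `(N,t)`: its vertices are the leaves, and distinct leaves `x`, `y` are
adjacent iff `t(lca(x,y)) = 1`. (In a galled-tree, lowest common ancestors are unique.) -/
def explained (N : Digraph W) (X : Set W) (t : W → NLabel) : SimpleGraph X where
  Adj x y := x ≠ y ∧ ∃ w, IsLCA N x y w ∧ t w = NLabel.one
  symm := ⟨fun _ _ h => ⟨h.1.symm, h.2.imp fun _ hw =>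
    ⟨⟨⟨hw.1.1.2, hw.1.1.1⟩, fun z hx hy => hw.1.2 z hy hx⟩, hw.2⟩⟩⟩
  loopless := ⟨fun _ h => h.1 rfl⟩

/-- A rooted cycle: two directed paths with the same start-vertex `root` and the same end-vertex
`hybrid` that have no other vertex in common. `inner₁` and `inner₂` list the internal vertices of
the two sides from top to bottom. -/
structure RootedCycle (N : Digraph W) where
  root : W
  hybrid : W
  inner₁ : List W
  inner₂ : List W
  path₁ : List.IsChain N.Adj (root :: (inner₁ ++ [hybrid]))
  path₂ : List.IsChain N.Adj (root :: (inner₂ ++ [hybrid]))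
  nodup : (root :: hybrid :: (inner₁ ++ inner₂)).Nodup
  nontrivial : inner₁ ≠ [] ∨ inner₂ ≠ []

namespace RootedCycle

variable {N : Digraph W} (C : RootedCycle N)

/-- The vertices of the cycle, without repetition. -/
def vertexList : List W := C.root :: C.hybrid :: (C.inner₁ ++ C.inner₂)

def verts : Set W := {w | w ∈ C.vertexList}

def length : ℕ := C.vertexList.length

/-- `(a,b)` is an edge of one of the two sides. -/
def IsEdge (a b : W) : Prop :=
  [a, b] <:+: (C.root :: (C.inner₁ ++ [C.hybrid])) ∨
    [a, b] <:+: (C.root :: (C.inner₂ ++ [C.hybrid]))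

end RootedCycle

/-- A galled-tree on `X` is elementary if it consists of a rooted cycle of length `|X|+1` whose root
is the root of `N` and of edges that attach to each cycle vertex other than the root its own
leaf. -/
def IsElementary (N : Digraph W) (X : Set W) : Prop :=
  IsGalledTree N X ∧ ∃ C : RootedCycle N,
    C.length = X.ncard + 1 ∧
    parents N C.root = ∅ ∧
    (∀ w, w ∈ C.verts ∨ w ∈ X) ∧
    (∀ w ∈ C.verts, w ≠ C.root → ∃! x, x ∈ X ∧ N.Adj w x) ∧
    (∀ a b, N.Adj a b → C.IsEdge a b ∨ (a ∈ C.verts ∧ a ≠ C.root ∧ b ∈ X))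

/-- No cycle has a side without internal vertices, and no cycle has precisely one internal vertex
on both sides. -/
def IsStrongTree (N : Digraph W) : Prop :=
  ∀ C : RootedCycle N, ¬ (C.inner₁ = [] ∨ C.inner₂ = []) ∧
    ¬ (C.inner₁.length = 1 ∧ C.inner₂.length = 1)

def IsQuasiDiscriminating (N : Digraph W) (t : W → NLabel) : Prop :=
  ∀ a b, N.Adj a b → ¬ IsHybrid N b → t a ≠ t b

end Networks

/-- `G` is galled-tree explainable. -/
def IsGaTEx {V : Type u} (G : SimpleGraph V) : Prop :=
  ∃ (W : Type) (N : Digraph W) (X : Set W) (t : W → NLabel),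
    IsGalledTree N X ∧ IsLabeling X t ∧ Nonempty (G ≃g explained N X t)

/-! ### Modular decomposition -/

section Modules

variable {V : Type u}

/-- `M` is a non-empty module of the induced subgraph `G[S]`. -/
def IsModule (G : SimpleGraph V) (S M : Finset V) : Prop :=
  M.Nonempty ∧ M ⊆ S ∧ ∀ x ∈ M, ∀ y ∈ M, ∀ z ∈ S, z ∉ M → (G.Adj x z ↔ G.Adj y z)

/-- `M` is a strong module of `G[S]`: it overlaps with no module of `G[S]`. -/
def IsStrongModule (G : SimpleGraph V) (S M : Finset V) : Prop :=
  IsModule G S M ∧ ∀ M', IsModule G S M' → M ⊆ M' ∨ M' ⊆ M ∨ Disjoint M M'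

/-- `A` belongs to the partition of `S` into the inclusion-maximal strong modules of `G[S]` that are
different from `S`. -/
def IsMaxStrong (G : SimpleGraph V) (S A : Finset V) : Prop :=
  Maximal (fun B => IsStrongModule G S B ∧ B ≠ S) A

/-- The quotient of `G[S]` by its maximal strong modules. -/
def quotientGraph (G : SimpleGraph V) (S : Finset V) : SimpleGraph {A // IsMaxStrong G S A} where
  Adj A B := A ≠ B ∧ ∃ x ∈ A.1, ∃ y ∈ B.1, G.Adj x y
  symm := ⟨fun _ _ ⟨h, x, hx, y, hy, hxy⟩ => ⟨h.symm, y, hy, x, hx, hxy.symm⟩⟩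
  loopless := ⟨fun _ h => h.1 rfl⟩

variable [Fintype V]

/-- The vertices of the modular decomposition tree of `G`: the strong modules of `G`, ordered by
inclusion. The children of a vertex are the strong modules that it covers. -/
abbrev StrongMod (G : SimpleGraph V) : Type u := {M : Finset V // IsStrongModule G Finset.univ M}

theorem isStrongModule_singleton (G : SimpleGraph V) (x : V) :
    IsStrongModule G Finset.univ {x} := by
  refine ⟨⟨Finset.singleton_nonempty x, Finset.subset_univ _, ?_⟩, fun M' _ => ?_⟩
  · intro a ha b hb z _ _
    rw [Finset.mem_singleton.1 ha, Finset.mem_singleton.1 hb]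
  · by_cases h : x ∈ M'
    · exact Or.inl (Finset.singleton_subset_iff.2 h)
    · exact Or.inr (Or.inr (Finset.disjoint_singleton_left.2 h))

theorem isStrongModule_univ [Nonempty V] (G : SimpleGraph V) :
    IsStrongModule G Finset.univ (Finset.univ : Finset V) :=
  ⟨⟨Finset.univ_nonempty, Finset.Subset.refl _, fun _ _ _ _ z _ hz => absurd (Finset.mem_univ z) hz⟩,
    fun M' _ => Or.inr (Or.inl (Finset.subset_univ M'))⟩

/-- Strong modules of `G[S]` are strong modules of `G` if `S` is one. -/
theorem IsStrongModule.trans {G : SimpleGraph V} {S A : Finset V}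
    (hS : IsStrongModule G Finset.univ S) (hA : IsStrongModule G S A) :
    IsStrongModule G Finset.univ A := by
  obtain ⟨⟨hne, hAS, hmod⟩, hstr⟩ := hA
  refine ⟨⟨hne, Finset.subset_univ _, ?_⟩, ?_⟩
  · intro x hx y hy z _ hz
    by_cases hzS : z ∈ S
    · exact hmod x hx y hy z hzS hz
    · exact hS.1.2.2 x (hAS hx) y (hAS hy) z (Finset.mem_univ _) hzS
  · intro K hK
    rcases hS.2 K hK with h | h | h
    · exact Or.inl (hAS.trans h)
    · exact hstr K ⟨hK.1, h, fun x hx y hy z _ hz => hK.2.2 x hx y hy z (Finset.mem_univ _) hz⟩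
    · exact Or.inr (Or.inr (Finset.disjoint_of_subset_left hAS h))

/-- Vertex labels of the modular decomposition tree. -/
inductive MDLabel
  | zero
  | one
  | leaf
  | prime

open Classical in
/-- The label `t_G(M)`. -/
noncomputable def mdLabel (G : SimpleGraph V) (M : StrongMod G) : MDLabel :=
  if M.1.card = 1 then MDLabel.leaf
  else if ¬ (G.induce (M.1 : Set V)).Connected then MDLabel.zero
  else if ¬ (Gᶜ.induce (M.1 : Set V)).Connected then MDLabel.one
  else MDLabel.prime

/-- The prime vertices of the modular decomposition tree. -/
abbrev PrimeMod (G : SimpleGraph V) : Type u := {M : StrongMod G // mdLabel G M = MDLabel.prime}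

/-! ### Prime-vertex replacement networks -/

/-- The choices that determine a pvr-network of `G`: for each prime vertex `M` of the modular
decomposition tree a strong quasi-discriminating elementary galled-tree that explains the quotient
of `G[M]` by its maximal strong modules. -/
structure PvrNetwork (G : SimpleGraph V) where
  /-- vertices of the galled-tree for `M` -/
  W : PrimeMod G → Type v
  tree : ∀ M, Digraph (W M)
  leaves : ∀ M, Set (W M)
  treeLabel : ∀ M, W M → NLabel
  elementary : ∀ M, IsElementary (tree M) (leaves M)
  strong : ∀ M, IsStrongTree (tree M)
  labeling : ∀ M, IsLabeling (leaves M) (treeLabel M)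
  quasiDiscriminating : ∀ M, IsQuasiDiscriminating (tree M) (treeLabel M)
  /-- the root of the galled-tree for `M` -/
  treeRoot : ∀ M, W M
  treeRoot_spec : ∀ M, parents (tree M) (treeRoot M) = ∅
  explains : ∀ M, quotientGraph G M.1.1 ≃g explained (tree M) (leaves M) (treeLabel M)

namespace PvrNetwork

variable {G : SimpleGraph V} (D : PvrNetwork.{u, v} G)

/-- The vertices of the pvr-network: the vertices of the modular decomposition tree and, for each
prime vertex `M`, the vertices of its galled-tree that are neither leaves (these are identified with
the maximal strong modules of `G[M]`) nor the root (which is identified with `M`). -/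
abbrev Vert : Type (max u v) :=
  StrongMod G ⊕ (Σ M : PrimeMod G, {w : D.W M // w ∉ D.leaves M ∧ w ≠ D.treeRoot M})

open Classical in
/-- The identification of the vertices of the galled-tree for `M` with vertices of the network. -/
noncomputable def glue (M : PrimeMod G) (w : D.W M) : D.Vert :=
  if hl : w ∈ D.leaves M then
    Sum.inl ⟨((D.explains M).symm ⟨w, hl⟩).1,
      IsStrongModule.trans M.1.2 ((D.explains M).symm ⟨w, hl⟩).2.prop.1⟩
  else if hr : w = D.treeRoot M then Sum.inl M.1
  else Sum.inr ⟨M, w, hl, hr⟩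

/-- The pvr-network as a directed graph: edges below non-prime vertices come from the modular
decomposition tree, all other edges from the galled-trees. -/
def network : Digraph D.Vert where
  Adj a b :=
    (∃ A B : StrongMod G, mdLabel G A ≠ MDLabel.prime ∧ B ⋖ A ∧ a = Sum.inl A ∧ b = Sum.inl B) ∨
    (∃ (M : PrimeMod G) (w z : D.W M), (D.tree M).Adj w z ∧ a = D.glue M w ∧ b = D.glue M z)

open Classical in
/-- The labeling `t` of the pvr-network. -/
noncomputable def label : D.Vert → NLabel
  | Sum.inl A =>
    if h : mdLabel G A = MDLabel.prime then D.treeLabel ⟨A, h⟩ (D.treeRoot ⟨A, h⟩)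
    else if mdLabel G A = MDLabel.zero then NLabel.zero
    else if mdLabel G A = MDLabel.one then NLabel.one
    else NLabel.leaf
  | Sum.inr p => D.treeLabel p.1 p.2.1

/-- The leaf of the network that is identified with the vertex `x` of `G`. -/
def leafVert (x : V) : D.Vert := Sum.inl ⟨{x}, isStrongModule_singleton G x⟩

/-- The root of the network. -/
def root [Nonempty V] : D.Vert := Sum.inl ⟨Finset.univ, isStrongModule_univ G⟩

/-- The leaves `L(N(w))` below `w`, as vertices of `G`. -/
def leavesBelow (w : D.Vert) : Set V := {x | Anc D.network w (D.leafVert x)}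

/-- The children of a vertex of the network. -/
abbrev ch (w : D.Vert) : Set D.Vert := children D.network w

end PvrNetwork

end Modules

/-! ### The algorithm -/

/-- A for-loop that executes the (non-deterministic) body for the entries of a list in order. -/
inductive Loop {α : Type*} {S : Type*} (body : α → S → S → Prop) : List α → S → S → Prop
  | nil (s : S) : Loop body [] s s
  | cons {a : α} {l : List α} {s s' s'' : S} :
      body a s s' → Loop body l s' s'' → Loop body (a :: l) s s''

namespace PvrNetwork

variable {V : Type u} [Fintype V] {G : SimpleGraph V} (D : PvrNetwork.{u, v} G)

/-- The variables of the algorithm: `ω`, `ω_¬η` and the set of active vertices. -/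
structure State where
  omega : D.Vert → ℤ
  omegaNot : D.Vert → ℤ
  active : Set D.Vert

open Classical in
/-- The procedure `Activate`, which turns the set `a` of active vertices into `a'`. The sides in `Ps`
are given by their internal vertices from top to bottom. -/
def Activate (C : RootedCycle D.network) (Ps : List (List D.Vert)) (ω ωNot : D.Vert → ℤ)
    (α β : ℤ) (labelρ : NLabel) (a a' : Set D.Vert) : Prop :=
  if labelρ = NLabel.zero then
    Loop (fun w b b' =>
        if D.label w = NLabel.zero then
          ∃ x ∈ D.ch w, (∀ z ∈ D.ch w, ω z ≤ ω x) ∧ b' = b ∪ {x}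
        else b' = b ∪ D.ch w)
      (Ps.flatMap fun P => (P ++ [C.hybrid]).reverse) a a'
  else if α ≤ β then
    ∃ w₁ w₂, w₁ ≠ w₂ ∧ parents D.network C.hybrid = {w₁, w₂} ∧
      Loop (fun w b b' =>
          ∃ x y, D.ch w ∩ C.verts = {x} ∧ D.ch w \ C.verts = {y} ∧
            if D.label w = NLabel.zero then
              (ω y ≤ ωNot x ∧ b' = b ∪ {x}) ∨ (ωNot x ≤ ω y ∧ b' = b ∪ {y})
            else b' = b ∪ {x, y})
        ((Ps.flatMap List.reverse).filter fun w => w ≠ w₁ ∧ w ≠ w₂)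
        (a ∪ D.ch C.root ∪ (D.ch w₁ \ {C.hybrid}) ∪ (D.ch w₂ \ {C.hybrid})) a'
  else
    Loop (fun w b b' =>
        b' = b ∪ {w} ∪ (if D.label w = NLabel.one then D.ch w \ C.verts else ∅))
      (Ps.flatMap List.reverse) (a ∪ D.ch C.root ∪ {C.hybrid} ∪ D.ch C.hybrid) a'

open Classical in
/-- The computation of `ω(w)` and `ω_¬η(w)` for an internal vertex `w` of a side of `C`. -/
def InitInner (C : RootedCycle D.network) (w : D.Vert) (s s' : D.State) : Prop :=
  ∃ x y, D.ch w ∩ C.verts = {x} ∧ D.ch w \ C.verts = {y} ∧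
    if D.label w = NLabel.zero then
      s' = { s with
        omega := Function.update s.omega w (max (s.omega x) (s.omega y))
        omegaNot := Function.update s.omegaNot w (max (s.omegaNot x) (s.omega y)) }
    else
      s' = { s with
        omega := Function.update s.omega w (s.omega x + s.omega y)
        omegaNot := Function.update s.omegaNot w (s.omegaNot x + s.omega y) }

open Classical in
/-- The processing of a prime vertex `M`. -/
def VisitPrime (M : StrongMod G) (s s' : D.State) : Prop :=
  ∃ C : RootedCycle D.network, C.root = Sum.inl M ∧
  ∃ (c : D.Vert) (s₁ s₂ : D.State),
    D.ch C.hybrid = {c} ∧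
    s₁ = { s with
      omega := Function.update s.omega C.hybrid (s.omega c)
      omegaNot := Function.update s.omegaNot C.hybrid 0 } ∧
    Loop (D.InitInner C) (C.inner₁.reverse ++ C.inner₂.reverse) s₁ s₂ ∧
    ∃ x y, x ≠ y ∧ D.ch C.root = {x, y} ∧
      if D.label C.root = NLabel.zero then
        ∃ w P a, (w = x ∨ w = y) ∧ s₂.omega w = max (s₂.omega x) (s₂.omega y) ∧
          (P = C.inner₁ ∨ P = C.inner₂) ∧ w ∈ P ++ [C.hybrid] ∧
          D.Activate C [P] s₂.omega s₂.omegaNot 0 0 NLabel.zero (s₂.active ∪ {w}) a ∧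
          s' = { s₂ with
            omega := Function.update s₂.omega C.root (max (s₂.omega x) (s₂.omega y))
            active := a }
      else
        ∃ α β a, α = s₂.omega x + s₂.omega y - s₂.omega C.hybrid ∧
          β = s₂.omegaNot x + s₂.omegaNot y ∧
          D.Activate C [C.inner₁, C.inner₂] s₂.omega s₂.omegaNot α β NLabel.one s₂.active a ∧
          s' = { s₂ with
            omega := Function.update s₂.omega C.root (max α β)
            active := a }

open Classical in
/-- The body of the main loop, executed for an inner vertex `M` of the modular decomposition
tree. -/
def VisitVertex (M : StrongMod G) (s s' : D.State) : Prop :=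
  match mdLabel G M with
  | MDLabel.leaf => False
  | MDLabel.zero =>
    ∃ B : StrongMod G, B ⋖ M ∧ (∀ B' : StrongMod G, B' ⋖ M →
        s.omega (Sum.inl B') ≤ s.omega (Sum.inl B)) ∧
      s' = { s with
        omega := Function.update s.omega (Sum.inl M) (s.omega (Sum.inl B))
        active := s.active ∪ {Sum.inl B} }
  | MDLabel.one =>
      s' = { s with
        omega := Function.update s.omega (Sum.inl M)
          (∑ B : StrongMod G with B ⋖ M, s.omega (Sum.inl B))
        active := s.active ∪ {b | ∃ B : StrongMod G, B ⋖ M ∧ b = Sum.inl B} }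
  | MDLabel.prime => D.VisitPrime M s s'

/-- `s` is the final state of an execution of the algorithm with the pvr-network `D`. The inner
vertices of the modular decomposition tree are visited in an arbitrary order in which every vertex
comes after all its descendants, as it does in every postorder. The values of `ω` and `ω_¬η` that
the algorithm does not initialize are arbitrary at the start. -/
def IsResult (s : D.State) : Prop :=
  ∃ (l : List (StrongMod G)) (s₀ : D.State),
    l.Nodup ∧ (∀ M, M ∈ l ↔ mdLabel G M ≠ MDLabel.leaf) ∧ l.Pairwise (fun A B => ¬ B < A) ∧
    (∀ x, s₀.omega (D.leafVert x) = 1) ∧ s₀.active = ∅ ∧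
    Loop D.VisitVertex l s₀ s

open Classical in
/-- The set `Ω` of all leaves that are reached from the root by a directed path on which all vertices
other than the root are active. -/
noncomputable def Omega [Nonempty V] (s : D.State) : Finset V :=
  Finset.univ.filter fun x =>
    Relation.ReflTransGen (fun a b => D.network.Adj a b ∧ b ∈ s.active) D.root (D.leafVert x)

end PvrNetwork

end Gatex

/-! The adjacency of $G$ can be read off the network. Below a vertex of the modular decomposition
tree with label 0 (label 1), distinct children are pairwise non-adjacent (completely adjacent).
Clique numbers then combine by maximum (by sum), and a maximum clique comes from one best child
(from all children).

For a prime module $M$ with cycle $C$, let $B(v)$ be the child of $M$ attached to the cycle vertex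
$v\ne\rho_C$. If $w$ lies above $u$ on one side, where $u=\eta$ is allowed, then the lca of the two
attached leaves is $w$, so $t(w)$ decides between a join and no edges for $B(w),B(u)$. For internal
vertices of different sides the lca is $\rho_C$. Hence each side is assembled bottom-up by disjoint
unions and joins, with or without $B(\eta)$; this yields $\omega$ and $\omega_{\neg\eta}$ on the
sides (`IsCycleAt.init_side`).

At the root of the cycle, let $s_i$ be the clique number of side $i$ without $B(\eta)$, $o_i\le s_i$
that of its modules at vertices labeled 1, and $h=\omega(\eta)$. A clique that meets $B(\eta)$
contains, besides $B(\eta)$, only vertices of modules at label 1, so $\omega$ of the side with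
$B(\eta)$ is $\max(s_i,o_i+h)$. If $t(\rho_C)=0$, no clique meets the modules of both sides. If
$t(\rho_C)=1$, the clique number is $\max(s_1+s_2,\,o_1+o_2+h)$ (`cliqueNum_root_one`). This equals
$\max\{\alpha,\beta\}$: $\beta=s_1+s_2$, and $\alpha=\max(s_1,o_1+h)+\max(s_2,o_2+h)-h$ exceeds
$\beta$ only if both maxima are attained by $o_i+h$. The comparison of $\alpha$ and $\beta$ thus
also tells which kind of clique has to be activated.

The algorithm is local. A visit of $M$ writes only values on the zone of $M$ and activates only
vertices in `actZone M`, and these sets are disjoint for different modules. Therefore the final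
state looks at $M$ as it did right after the visit of $M$, and an induction over strong modules
gives all values and shows that the leaves reached from $M$ through active vertices form a maximum
clique of $G[M]$ (`IsVisit`, `isMaxCliqueIn_of_isResult`).

The statement about $\omega_{\neg\eta}$ and the visit of a prime vertex refer to arbitrary rooted
cycles of the network. By `exists_isCycleAt_of_rootedCycle` each of them is the cycle of a prime
module, because vertices other than the hybrid-vertices have at most one parent. -/

namespace Gatex

/-! ### Clique numbers of unions of vertex sets that are joined or separated -/

section CliqueNumber

variable {V : Type u} {G : SimpleGraph V} {S T R Q : Set V}

/-- `R` is a maximum clique of `G[S]`. -/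
def IsMaxCliqueIn (G : SimpleGraph V) (S R : Set V) : Prop :=
  R ⊆ S ∧ G.IsClique R ∧ R.ncard = (G.induce S).cliqueNum

theorem exists_isMaxCliqueIn (G : SimpleGraph V) (S : Set V) : ∃ K, IsMaxCliqueIn G S K := by
  classical
  obtain ⟨s, hs⟩ := (G.induce S).exists_isNClique_cliqueNum
  refine ⟨Subtype.val '' (s : Set S), by simp, ?_, ?_⟩
  · rintro _ ⟨a, ha, rfl⟩ _ ⟨b, hb, rfl⟩ hab
    exact hs.isClique ha hb (fun h => hab (congrArg _ h))
  · rw [Set.ncard_image_of_injective _ Subtype.val_injective, Set.ncard_coe_finset, hs.card_eq]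

theorem cliqueNum_induce_le_of_forall {n : ℕ}
    (h : ∀ K : Set V, K ⊆ S → G.IsClique K → K.ncard ≤ n) : (G.induce S).cliqueNum ≤ n := by
  obtain ⟨K, hKS, hK, hc⟩ := exists_isMaxCliqueIn G S
  exact hc ▸ h K hKS hK

theorem cliqueNum_induce_empty : (G.induce (∅ : Set V)).cliqueNum = 0 := by
  apply Nat.le_zero.1
  apply cliqueNum_induce_le_of_forall
  intro K hK _
  simp [Set.subset_empty_iff.1 hK]

theorem isMaxCliqueIn_empty : IsMaxCliqueIn G ∅ ∅ :=
  ⟨subset_rfl, by simp, by simp [cliqueNum_induce_empty]⟩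

variable [Finite V]

theorem ncard_le_cliqueNum_induce {K : Set V} (hKS : K ⊆ S) (hK : G.IsClique K) :
    K.ncard ≤ (G.induce S).cliqueNum := by
  classical
  have := Fintype.ofFinite V
  have h1 : (G.induce S).IsClique (Subtype.val ⁻¹' K : Set S) := by
    intro a ha b hb hab
    exact hK ha hb (fun h => hab (Subtype.ext h))
  have h2 := SimpleGraph.IsClique.card_le_cliqueNum (G := G.induce S)
    (t := (Subtype.val ⁻¹' K : Set S).toFinset) (tc := by simpa using h1)
  rw [← Set.ncard_eq_toFinset_card'] at h2
  rwa [Set.ncard_preimage_of_injective_subset_range Subtype.val_injective (by simpa using hKS)]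
    at h2

theorem cliqueNum_induce_mono (h : S ⊆ T) :
    (G.induce S).cliqueNum ≤ (G.induce T).cliqueNum :=
  cliqueNum_induce_le_of_forall fun _ hK hc => ncard_le_cliqueNum_induce (hK.trans h) hc

theorem cliqueNum_induce_univ : (G.induce Set.univ).cliqueNum = G.cliqueNum := by
  classical
  have := Fintype.ofFinite V
  apply le_antisymm (G.cliqueNum_induce_le _)
  obtain ⟨s, hs⟩ := G.exists_isNClique_cliqueNum
  rw [← hs.card_eq, ← Set.ncard_coe_finset]
  exact ncard_le_cliqueNum_induce (Set.subset_univ _) hs.isClique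

theorem isMaxCliqueIn_singleton (x : V) : IsMaxCliqueIn G {x} {x} := by
  refine ⟨subset_rfl, by simp, le_antisymm (ncard_le_cliqueNum_induce subset_rfl (by simp)) ?_⟩
  exact cliqueNum_induce_le_of_forall fun K hK _ => Set.ncard_le_ncard hK

theorem cliqueNum_induce_singleton (x : V) : (G.induce ({x} : Set V)).cliqueNum = 1 := by
  rw [← (isMaxCliqueIn_singleton (G := G) x).2.2, Set.ncard_singleton]

theorem cliqueNum_induce_join (h : ∀ a ∈ S, ∀ b ∈ T, G.Adj a b) :
    (G.induce (S ∪ T)).cliqueNum = (G.induce S).cliqueNum + (G.induce T).cliqueNum := by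
  have hd : Disjoint S T := Set.disjoint_left.2 fun a ha hb => (h a ha a hb).ne rfl
  apply le_antisymm
  · apply cliqueNum_induce_le_of_forall
    intro K hK hc
    have : K = (K ∩ S) ∪ (K ∩ T) := by
      rw [← Set.inter_union_distrib_left, Set.inter_eq_left.2 hK]
    rw [this]
    exact (Set.ncard_union_le _ _).trans (Nat.add_le_add
      (ncard_le_cliqueNum_induce Set.inter_subset_right (hc.subset Set.inter_subset_left))
      (ncard_le_cliqueNum_induce Set.inter_subset_right (hc.subset Set.inter_subset_left)))
  · obtain ⟨K, hKS, hK, hc⟩ := exists_isMaxCliqueIn G S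
    obtain ⟨L, hLT, hL, hc'⟩ := exists_isMaxCliqueIn G T
    rw [← hc, ← hc', ← Set.ncard_union_eq (hd.mono hKS hLT)]
    apply ncard_le_cliqueNum_induce (Set.union_subset_union hKS hLT)
    rintro a (ha | ha) b (hb | hb) hab
    · exact hK ha hb hab
    · exact h a (hKS ha) b (hLT hb)
    · exact (h b (hKS hb) a (hLT ha)).symm
    · exact hL ha hb hab

theorem IsMaxCliqueIn.join (hR : IsMaxCliqueIn G S R) (hQ : IsMaxCliqueIn G T Q)
    (h : ∀ a ∈ S, ∀ b ∈ T, G.Adj a b) : IsMaxCliqueIn G (S ∪ T) (R ∪ Q) := by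
  have hd : Disjoint S T := Set.disjoint_left.2 fun a ha hb => (h a ha a hb).ne rfl
  refine ⟨Set.union_subset_union hR.1 hQ.1, ?_, ?_⟩
  · rintro a (ha | ha) b (hb | hb) hab
    · exact hR.2.1 ha hb hab
    · exact h a (hR.1 ha) b (hQ.1 hb)
    · exact (h b (hR.1 hb) a (hQ.1 ha)).symm
    · exact hQ.2.1 ha hb hab
  · rw [cliqueNum_induce_join h, ← hR.2.2, ← hQ.2.2, Set.ncard_union_eq (hd.mono hR.1 hQ.1)]

theorem cliqueNum_induce_sep (h : ∀ a ∈ S, ∀ b ∈ T, ¬ G.Adj a b) :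
    (G.induce (S ∪ T)).cliqueNum = max (G.induce S).cliqueNum (G.induce T).cliqueNum := by
  apply le_antisymm
  · apply cliqueNum_induce_le_of_forall
    intro K hK hc
    by_cases hKT : K ⊆ T
    · exact (ncard_le_cliqueNum_induce hKT hc).trans (le_max_right _ _)
    -- A vertex of `K` outside `T` lies in `S` and is adjacent to the rest of `K`, so no vertex of
    -- `K` can lie in `T`.
    · obtain ⟨a, haK, haT⟩ := Set.not_subset.1 hKT
      have haS : a ∈ S := (hK haK).resolve_right haT
      refine (ncard_le_cliqueNum_induce (fun b hb => ?_) hc).trans (le_max_left _ _)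
      refine (hK hb).resolve_right fun hbT => ?_
      by_cases hab : a = b
      · exact haT (hab ▸ hbT)
      · exact h a haS b hbT (hc haK hb hab)
  · exact max_le (cliqueNum_induce_mono Set.subset_union_left)
      (cliqueNum_induce_mono Set.subset_union_right)

/-- Serves every step that takes a maximum: the clique of the better part stays maximum in the whole
as soon as the whole has no larger clique number. -/
theorem IsMaxCliqueIn.mono (hR : IsMaxCliqueIn G S R) (hST : S ⊆ T)
    (hle : (G.induce T).cliqueNum ≤ (G.induce S).cliqueNum) : IsMaxCliqueIn G T R :=
  ⟨hR.1.trans hST, hR.2.1, hR.2.2.trans (le_antisymm (cliqueNum_induce_mono hST) hle)⟩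

theorem cliqueNum_biUnion_join {ι : Type*} (F : Finset ι) (S : ι → Set V)
    (h : ∀ i ∈ F, ∀ j ∈ F, i ≠ j → ∀ a ∈ S i, ∀ b ∈ S j, G.Adj a b) :
    (G.induce (⋃ i ∈ F, S i)).cliqueNum = ∑ i ∈ F, (G.induce (S i)).cliqueNum := by
  classical
  induction F using Finset.induction_on with
  | empty =>
    have : (⋃ i ∈ (∅ : Finset ι), S i) = ∅ := by simp
    rw [this, cliqueNum_induce_empty, Finset.sum_empty]
  | insert i F hi ih =>
    rw [Finset.set_biUnion_insert, cliqueNum_induce_join, Finset.sum_insert hi, ih]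
    · intro j hj k hk
      exact h j (Finset.mem_insert_of_mem hj) k (Finset.mem_insert_of_mem hk)
    · intro a ha b hb
      obtain ⟨j, hj, hbj⟩ := Set.mem_iUnion₂.1 hb
      exact h i (Finset.mem_insert_self _ _) j (Finset.mem_insert_of_mem hj)
        (fun e => hi (e ▸ hj)) a ha b hbj

theorem isMaxCliqueIn_biUnion_join {ι : Type*} (F : Finset ι) (S R : ι → Set V)
    (hR : ∀ i ∈ F, IsMaxCliqueIn G (S i) (R i))
    (h : ∀ i ∈ F, ∀ j ∈ F, i ≠ j → ∀ a ∈ S i, ∀ b ∈ S j, G.Adj a b) :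
    IsMaxCliqueIn G (⋃ i ∈ F, S i) (⋃ i ∈ F, R i) := by
  classical
  induction F using Finset.induction_on with
  | empty => simpa using isMaxCliqueIn_empty
  | insert i F hi ih =>
    rw [Finset.set_biUnion_insert, Finset.set_biUnion_insert]
    apply (hR i (Finset.mem_insert_self _ _)).join
    · apply ih
      · exact fun j hj => hR j (Finset.mem_insert_of_mem hj)
      · intro j hj k hk
        exact h j (Finset.mem_insert_of_mem hj) k (Finset.mem_insert_of_mem hk)
    · intro a ha b hb
      obtain ⟨j, hj, hbj⟩ := Set.mem_iUnion₂.1 hb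
      exact h i (Finset.mem_insert_self _ _) j (Finset.mem_insert_of_mem hj)
        (fun e => hi (e ▸ hj)) a ha b hbj

end CliqueNumber

end Gatex

/-! ### Strong modules and the modular decomposition tree -/

namespace Gatex

section ModularDecomposition

variable {V : Type u} {G : SimpleGraph V}

/-- A graph and its complement have the same modules; this reduces label 1 to label 0 below. -/
theorem isModule_compl_iff {S M : Finset V} : IsModule Gᶜ S M ↔ IsModule G S M := by
  have key : ∀ H : SimpleGraph V, IsModule H S M → IsModule Hᶜ S M := by
    intro H h
    refine ⟨h.1, h.2.1, fun x hx y hy z hz hzM => ?_⟩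
    have hxz : x ≠ z := fun e => hzM (e ▸ hx)
    have hyz : y ≠ z := fun e => hzM (e ▸ hy)
    simp [SimpleGraph.compl_adj, hxz, hyz, h.2.2 x hx y hy z hz hzM]
  refine ⟨fun h => ?_, key G⟩
  simpa using key _ h

theorem isStrongModule_compl_iff {S M : Finset V} :
    IsStrongModule Gᶜ S M ↔ IsStrongModule G S M := by
  simp only [IsStrongModule, isModule_compl_iff]

variable [Fintype V]

theorem IsModule.lift {M A : Finset V} (hM : IsModule G Finset.univ M) (hA : IsModule G M A) :
    IsModule G Finset.univ A := by
  refine ⟨hA.1, Finset.subset_univ _, fun x hx y hy z _ hz => ?_⟩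
  by_cases hzM : z ∈ M
  · exact hA.2.2 x hx y hy z hzM hz
  · exact hM.2.2 x (hA.2.1 hx) y (hA.2.1 hy) z (Finset.mem_univ _) hzM

theorem IsStrongModule.restrict {M A : Finset V} (hM : IsModule G Finset.univ M)
    (hA : IsStrongModule G Finset.univ A) (hAM : A ⊆ M) : IsStrongModule G M A :=
  ⟨⟨hA.1.1, hAM, fun x hx y hy z _ hz => hA.1.2.2 x hx y hy z (Finset.mem_univ _) hz⟩,
    fun _ hK => hA.2 _ (hM.lift hK)⟩

theorem StrongMod.nonempty (A : StrongMod G) : A.1.Nonempty := A.2.1.1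

/-- Strong modules overlap with no module, so they form a laminar family. This makes the cover
relation a tree with disjoint siblings and unique parents. -/
theorem StrongMod.le_or_le_of_mem {A B : StrongMod G} {x : V} (hA : x ∈ A.1) (hB : x ∈ B.1) :
    A ≤ B ∨ B ≤ A := by
  rcases A.2.2 _ B.2.1 with h | h | h
  · exact Or.inl h
  · exact Or.inr h
  · exact absurd hB (Finset.disjoint_left.1 h hA)

theorem StrongMod.eq_of_covBy_of_mem {A B M : StrongMod G} {x : V} (hA : A ⋖ M) (hB : B ⋖ M)
    (hxA : x ∈ A.1) (hxB : x ∈ B.1) : A = B := by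
  rcases StrongMod.le_or_le_of_mem hxA hxB with h | h
  · exact (hA.eq_or_eq h hB.le).elim Eq.symm fun e => absurd e hB.lt.ne
  · exact (hB.eq_or_eq h hA.le).elim id fun e => absurd e hA.lt.ne

theorem StrongMod.eq_of_covBy {A M M' : StrongMod G} (h : A ⋖ M) (h' : A ⋖ M') : M = M' := by
  obtain ⟨x, hx⟩ := A.nonempty
  rcases StrongMod.le_or_le_of_mem (h.le hx) (h'.le hx) with hl | hl
  · exact (h'.eq_or_eq h.le hl).resolve_left h.lt.ne'
  · exact ((h.eq_or_eq h'.le hl).resolve_left h'.lt.ne').symm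

theorem StrongMod.exists_covBy_mem {M : StrongMod G} (hM : M.1.card ≠ 1) {x : V}
    (hx : x ∈ M.1) : ∃ B : StrongMod G, B ⋖ M ∧ x ∈ B.1 := by
  have hlt : (⟨{x}, isStrongModule_singleton G x⟩ : StrongMod G) < M := by
    refine lt_of_le_of_ne (Finset.singleton_subset_iff.2 hx) fun e => hM ?_
    rw [← e]
    exact Finset.card_singleton x
  obtain ⟨B, hB, hBM⟩ := exists_le_covBy_of_lt hlt
  exact ⟨B, hBM, hB (Finset.mem_singleton_self x)⟩

theorem StrongMod.iUnion_covBy {M : StrongMod G} (hM : M.1.card ≠ 1) :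
    (M.1 : Set V) = ⋃ B ∈ {B : StrongMod G | B ⋖ M}, (B.1 : Set V) := by
  ext x
  simp only [Set.mem_iUnion, Finset.mem_coe, Set.mem_ofPred_eq, exists_prop]
  exact ⟨fun hx => StrongMod.exists_covBy_mem hM hx, fun ⟨B, hB, hx⟩ => hB.le hx⟩

/-- Distinct children of a strong module inducing a disconnected subgraph are non-adjacent. -/
theorem not_adj_of_not_connected {M A B : StrongMod G}
    (hM : ¬ (G.induce (M.1 : Set V)).Connected) (hA : A ⋖ M) (hB : B ⋖ M) (hAB : A ≠ B) {a b : V}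
    (ha : a ∈ A.1) (hb : b ∈ B.1) : ¬ G.Adj a b := by
  classical
  intro hadj
  have haM : a ∈ (M.1 : Set V) := hA.le ha
  have hbM : b ∈ (M.1 : Set V) := hB.le hb
  -- `K` is the connected component of `a` in `G[M]`. The plan is to show that it is a strong module
  -- and hence comparable with the child `A`.
  let K : Finset V := M.1.filter fun x => ∃ hx : x ∈ (M.1 : Set V),
    (G.induce (M.1 : Set V)).Reachable ⟨a, haM⟩ ⟨x, hx⟩
  have hclosed : ∀ x ∈ K, ∀ y ∈ M.1, G.Adj x y → y ∈ K := by
    intro x hx y hy hxy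
    obtain ⟨_, hx', hr⟩ := Finset.mem_filter.1 hx
    refine Finset.mem_filter.2 ⟨hy, hy, hr.trans (SimpleGraph.Adj.reachable ?_)⟩
    exact hxy
  have haK : a ∈ K := Finset.mem_filter.2 ⟨haM, haM, SimpleGraph.Reachable.refl _⟩
  have hbK : b ∈ K := hclosed a haK b hbM hadj
  have hKM : K ⊆ M.1 := Finset.filter_subset _ _
  have hmod : IsModule G M.1 K := ⟨⟨a, haK⟩, hKM, fun x hx y hy z hz hzK =>
    ⟨fun h => absurd (hclosed x hx z hz h) hzK, fun h => absurd (hclosed y hy z hz h) hzK⟩⟩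
  have hne : K ≠ M.1 := by
    intro e
    refine hM ((SimpleGraph.connected_iff_exists_forall_reachable _).2 ⟨⟨a, haM⟩, ?_⟩)
    rintro ⟨x, hx⟩
    have hxK : x ∈ K := by rw [e]; exact hx
    exact (Finset.mem_filter.1 hxK).2.2
  -- A module `M'` overlapping `K` contains some `d` outside the component. If `x ∈ M'` had a
  -- neighbour `y ∈ K` outside `M'`, then `y` would be adjacent to `d` as well and `d` would lie in
  -- `K`. So `M'` absorbs all of `K` along walks that start in a common vertex.
  have hstrong : IsStrongModule G M.1 K := by
    refine ⟨hmod, fun M' hM' => ?_⟩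
    by_contra hcon
    simp only [not_or] at hcon
    obtain ⟨h1, h2, h3⟩ := hcon
    obtain ⟨d, hdM', hdK⟩ := Finset.not_subset.1 h2
    obtain ⟨c, hcK, hcM'⟩ := Finset.not_disjoint_iff.1 h3
    have step : ∀ x ∈ M', ∀ y ∈ K, G.Adj x y → y ∈ M' := by
      intro x hx y hy hxy
      by_contra hyM'
      exact hdK (hclosed y hy d (hM'.2.1 hdM')
        ((hM'.2.2 x hx d hdM' y (hKM hy) hyM').1 hxy).symm)
    obtain ⟨hcM, hcM2, hcr⟩ := Finset.mem_filter.1 hcK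
    apply h1
    intro x hx
    obtain ⟨hxM, hxM2, hxr⟩ := Finset.mem_filter.1 hx
    obtain ⟨p⟩ := hcr.symm.trans hxr
    have walk : ∀ {u v : (M.1 : Set V)}, (G.induce (M.1 : Set V)).Walk u v →
        u.1 ∈ K → u.1 ∈ M' → v.1 ∈ M' := by
      intro u v p
      induction p with
      | nil => exact fun _ h => h
      | @cons u v w h p ih =>
        intro huK huM'
        have hvK := hclosed u.1 huK v.1 v.2 h
        exact ih hvK (step u.1 huM' v.1 hvK h)
    exact walk p hcK hcM'
  let K' : StrongMod G := ⟨K, M.2.trans hstrong⟩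
  have hK'M : K' < M := lt_of_le_of_ne hKM fun e => hne (congrArg Subtype.val e)
  -- `K` is a strong module properly inside `M`, and `A` is a maximal one meeting it, so `K ⊆ A`.
  -- Then `b ∈ K` lies in both children `A` and `B`.
  rcases StrongMod.le_or_le_of_mem (A := A) (B := K') ha haK with h | h
  · rcases (hA.eq_or_eq h hK'M.le) with e | e
    · exact hAB (StrongMod.eq_of_covBy_of_mem hA hB (show b ∈ A.1 from e ▸ hbK) hb)
    · exact hK'M.ne e
  · exact hAB (StrongMod.eq_of_covBy_of_mem hA hB (h hbK) hb)

/-- Distinct children of a strong module inducing a subgraph with disconnected complement are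
completely adjacent. -/
theorem adj_of_not_connected_compl {M A B : StrongMod G}
    (hM : ¬ (Gᶜ.induce (M.1 : Set V)).Connected) (hA : A ⋖ M) (hB : B ⋖ M) (hAB : A ≠ B)
    {a b : V} (ha : a ∈ A.1) (hb : b ∈ B.1) : G.Adj a b := by
  -- The complement has the same tree of strong modules, so the disconnected case applies to it.
  let e : StrongMod G ≃o StrongMod Gᶜ :=
    { toFun := fun X => ⟨X.1, isStrongModule_compl_iff.2 X.2⟩
      invFun := fun X => ⟨X.1, isStrongModule_compl_iff.1 X.2⟩
      left_inv := fun _ => rfl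
      right_inv := fun _ => rfl
      map_rel_iff' := Iff.rfl }
  have h := not_adj_of_not_connected (G := Gᶜ) (M := e M) (A := e A) (B := e B) hM
    ((apply_covBy_apply_iff e).2 hA) ((apply_covBy_apply_iff e).2 hB)
    (fun h => hAB (e.injective h)) (a := a) (b := b) ha hb
  have hne : a ≠ b := by
    rintro rfl
    exact hAB (StrongMod.eq_of_covBy_of_mem hA hB ha hb)
  by_contra hn
  exact h ((SimpleGraph.compl_adj _ _ _).2 ⟨hne, hn⟩)

/-- Links the two descriptions in use: vertices of the quotient of `G[M]` and children of `M` in the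
tree. -/
theorem isMaxStrong_iff_covBy {M A : StrongMod G} : IsMaxStrong G M.1 A.1 ↔ A ⋖ M := by
  constructor
  · intro h
    have hAM : A < M := lt_of_le_of_ne h.prop.1.1.2.1 fun e => h.prop.2 (congrArg Subtype.val e)
    refine ⟨hAM, fun B hAB hBM => ?_⟩
    have := h.le_of_ge (y := B.1)
      ⟨B.2.restrict M.2.1 hBM.le, fun e => hBM.ne (Subtype.ext e)⟩ hAB.le
    exact hAB.not_ge this
  · intro h
    refine ⟨⟨A.2.restrict M.2.1 h.le, fun e => h.lt.ne (Subtype.ext e)⟩, fun B hB hAB => ?_⟩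
    let B' : StrongMod G := ⟨B, M.2.trans hB.1⟩
    rcases h.eq_or_eq (c := B') hAB hB.1.1.2.1 with e | e
    · exact (congrArg Subtype.val e).le
    · exact absurd (congrArg Subtype.val e) hB.2

theorem mdLabel_eq_leaf_iff {M : StrongMod G} : mdLabel G M = MDLabel.leaf ↔ M.1.card = 1 := by
  unfold mdLabel
  split_ifs <;> simp_all

theorem card_ne_one_of_covBy {A M : StrongMod G} (h : A ⋖ M) : M.1.card ≠ 1 := by
  have h1 : A.1.card < M.1.card := Finset.card_lt_card h.lt
  have h2 := A.nonempty.card_pos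
  omega

theorem not_connected_of_mdLabel_zero {M : StrongMod G} (h : mdLabel G M = MDLabel.zero) :
    ¬ (G.induce (M.1 : Set V)).Connected := by
  unfold mdLabel at h
  split_ifs at h
  assumption

theorem not_connected_of_mdLabel_one {M : StrongMod G} (h : mdLabel G M = MDLabel.one) :
    ¬ (Gᶜ.induce (M.1 : Set V)).Connected := by
  unfold mdLabel at h
  split_ifs at h
  assumption

/-- Two disjoint modules are completely adjacent or not adjacent at all, so any pair of
representatives decides. -/
theorem quotientGraph_adj_iff {M : StrongMod G} {A B : {A // IsMaxStrong G M.1 A}} (hAB : A ≠ B)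
    {a b : V} (ha : a ∈ A.1) (hb : b ∈ B.1) : (quotientGraph G M.1).Adj A B ↔ G.Adj a b := by
  let A' : StrongMod G := ⟨A.1, M.2.trans A.2.prop.1⟩
  let B' : StrongMod G := ⟨B.1, M.2.trans B.2.prop.1⟩
  have hA : A' ⋖ M := isMaxStrong_iff_covBy.1 A.2
  have hB : B' ⋖ M := isMaxStrong_iff_covBy.1 B.2
  have hne : A' ≠ B' := fun e => hAB (Subtype.ext (congrArg (fun X : StrongMod G => X.1) e))
  refine ⟨?_, fun h => ⟨hAB, a, ha, b, hb, h⟩⟩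
  rintro ⟨-, x, hx, y, hy, hxy⟩
  have hy' : y ∉ A'.1 := fun h => hne (StrongMod.eq_of_covBy_of_mem hA hB h hy)
  have ha' : a ∉ B'.1 := fun h => hne (StrongMod.eq_of_covBy_of_mem hA hB ha h)
  have h1 := (A'.2.1.2.2 x hx a ha y (Finset.mem_univ _) hy').1 hxy
  exact ((B'.2.1.2.2 y hy b hb a (Finset.mem_univ _) ha').1 h1.symm).symm

end ModularDecomposition

end Gatex

/-! ### Elementary galled-trees as cycles with pendant leaves -/

namespace Gatex

section ListLemmas

variable {α : Type*}

/-- Each entry of a list without repetition occurs at one position only. Consequently the neighbours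
of a vertex on a directed path are determined by the vertex. -/
theorem eq_of_nodup_append_cons {l s s' r r' : List α} {a : α} (hl : l.Nodup)
    (h : l = s ++ a :: r) (h' : l = s' ++ a :: r') : s = s' ∧ r = r' := by
  rw [h] at hl h'
  have hs := (List.nodup_append.1 hl)
  have h1 : a ∉ s := fun ha => hs.2.2 a ha a (by simp) rfl
  exact (((List.append_cons_inj_of_notMem h1 (List.nodup_cons.1 hs.2.1).1).1 h').imp_right
    And.right)

theorem head_eq_of_pair_infix {l s r : List α} {a b : α} (hl : l.Nodup) (h : l = s ++ a :: r)
    (hab : [a, b] <:+: l) : r.head? = some b := by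
  obtain ⟨s', t, h'⟩ := hab
  have := eq_of_nodup_append_cons hl h (s' := s') (r' := b :: t) (by simp [← h'])
  simp [this.2]

theorem getLast_eq_of_pair_infix {l s r : List α} {a b : α} (hl : l.Nodup) (h : l = s ++ b :: r)
    (hab : [a, b] <:+: l) : s.getLast? = some a := by
  obtain ⟨s', t, h'⟩ := hab
  have := eq_of_nodup_append_cons hl h (s' := s' ++ [a]) (r' := t) (by simp [← h'])
  simp [this.1]

end ListLemmas

section Cycles

variable {W : Type v} {N : Digraph W}

/-- `P` and `Q` are the internal vertices of the two sides of `C`. -/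
def RootedCycle.IsSides (C : RootedCycle N) (P Q : List W) : Prop :=
  (P = C.inner₁ ∧ Q = C.inner₂) ∨ (P = C.inner₂ ∧ Q = C.inner₁)

namespace RootedCycle

variable {C : RootedCycle N} {P Q : List W}

theorem isSides_self (C : RootedCycle N) : C.IsSides C.inner₁ C.inner₂ := Or.inl ⟨rfl, rfl⟩

namespace IsSides

theorem symm (h : C.IsSides P Q) : C.IsSides Q P := by
  rcases h with h | h
  · exact Or.inr ⟨h.2, h.1⟩
  · exact Or.inl ⟨h.2, h.1⟩

theorem nodup (h : C.IsSides P Q) : (C.root :: C.hybrid :: (P ++ Q)).Nodup := by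
  rcases h with ⟨rfl, rfl⟩ | ⟨rfl, rfl⟩
  · exact C.nodup
  · exact (((List.perm_append_comm).cons _).cons _).nodup C.nodup

theorem path (h : C.IsSides P Q) : List.IsChain N.Adj (C.root :: (P ++ [C.hybrid])) := by
  rcases h with ⟨rfl, rfl⟩ | ⟨rfl, rfl⟩
  · exact C.path₁
  · exact C.path₂

theorem mem_verts (h : C.IsSides P Q) {w : W} :
    w ∈ C.verts ↔ w = C.root ∨ w = C.hybrid ∨ w ∈ P ∨ w ∈ Q := by
  rcases h with ⟨rfl, rfl⟩ | ⟨rfl, rfl⟩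
  · simp [verts, vertexList]
  · simp [verts, vertexList, or_comm]

theorem isEdge_iff (h : C.IsSides P Q) {a b : W} :
    C.IsEdge a b ↔ [a, b] <:+: (C.root :: (P ++ [C.hybrid])) ∨
      [a, b] <:+: (C.root :: (Q ++ [C.hybrid])) := by
  rcases h with ⟨rfl, rfl⟩ | ⟨rfl, rfl⟩
  · rfl
  · exact or_comm

theorem nodup_path (h : C.IsSides P Q) : (C.root :: (P ++ [C.hybrid])).Nodup := by
  have := h.nodup
  simp only [List.nodup_cons, List.mem_cons, List.mem_append, not_or, List.nodup_append] at this ⊢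
  refine ⟨⟨this.1.2.1, by simpa using this.1.1⟩, this.2.2.1, by simp, ?_⟩
  rintro a ha b hb rfl
  have hb' : a = C.hybrid := by simpa using hb
  exact this.2.1.1 (hb' ▸ ha)

theorem root_ne_hybrid (h : C.IsSides P Q) : C.root ≠ C.hybrid := by
  have := h.nodup
  simp only [List.nodup_cons, List.mem_cons, not_or] at this
  exact this.1.1

theorem root_notMem (h : C.IsSides P Q) : C.root ∉ P := by
  have := h.nodup
  simp only [List.nodup_cons, List.mem_cons, List.mem_append, not_or] at this
  exact this.1.2.1

theorem hybrid_notMem (h : C.IsSides P Q) : C.hybrid ∉ P := by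
  have := h.nodup
  simp only [List.nodup_cons, List.mem_cons, List.mem_append, not_or] at this
  exact this.2.1.1

theorem disjoint (h : C.IsSides P Q) {w : W} (hP : w ∈ P) : w ∉ Q := by
  have := h.nodup
  simp only [List.nodup_cons, List.nodup_append] at this
  exact fun hQ => this.2.2.2.2 w hP w hQ rfl

theorem nodup_left (h : C.IsSides P Q) : P.Nodup := by
  have := h.nodup
  simp only [List.nodup_cons, List.nodup_append] at this
  exact this.2.2.1

theorem notMem_path (h : C.IsSides P Q) {w : W} (hP : w ∈ P) :
    w ∉ C.root :: (Q ++ [C.hybrid]) := by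
  simp only [List.mem_cons, List.mem_append, List.not_mem_nil, or_false, not_or]
  exact ⟨fun e => h.root_notMem (e ▸ hP), h.disjoint hP, fun e => h.hybrid_notMem (e ▸ hP)⟩

theorem side_mem (h : C.IsSides P Q) {w : W} (hw : w ∈ P) : w ∈ C.verts ∧ w ≠ C.root :=
  ⟨h.mem_verts.2 (Or.inr (Or.inr (Or.inl hw))), fun e => h.root_notMem (e ▸ hw)⟩

end IsSides

theorem hybrid_mem (C : RootedCycle N) : C.hybrid ∈ C.verts ∧ C.hybrid ≠ C.root :=
  ⟨C.isSides_self.mem_verts.2 (Or.inr (Or.inl rfl)), C.isSides_self.root_ne_hybrid.symm⟩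

theorem mem_verts_of_isEdge {a b : W} (h : C.IsEdge a b) : a ∈ C.verts ∧ b ∈ C.verts := by
  have hC := C.isSides_self
  simp only [hC.mem_verts]
  rcases (hC.isEdge_iff).1 h with h | h
  · have ha := h.subset (show a ∈ [a, b] by simp)
    have hb := h.subset (show b ∈ [a, b] by simp)
    simp only [List.mem_cons, List.mem_append, List.not_mem_nil, or_false] at ha hb
    tauto
  · have ha := h.subset (show a ∈ [a, b] by simp)
    have hb := h.subset (show b ∈ [a, b] by simp)
    simp only [List.mem_cons, List.mem_append, List.not_mem_nil, or_false] at ha hb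
    tauto

end RootedCycle

theorem rel_of_pair_infix {r : W → W → Prop} {l : List W} {a b : W} (h : List.IsChain r l)
    (hab : [a, b] <:+: l) : r a b := by
  have := h.infix hab
  simpa using this

/-- If `q` lists the internal vertices of a side that remain below some vertex, `q.headD C.hybrid`
is the child of that vertex on the cycle: the head of `q`, or the hybrid-vertex when `q` is empty.
This notation is used throughout. -/
theorem head?_append_singleton {q : List W} {a : W} : (q ++ [a]).head? = some (q.headD a) := by
  cases q <;> simp

/-- `N` consists of the rooted cycle `C` and of the edges that attach to each vertex `w` of `C` other
than the root the leaf `lf w`. -/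
structure IsPendantCycle (N : Digraph W) (X : Set W) (C : RootedCycle N) (lf : W → W) : Prop where
  acyclic : IsAcyclic N
  parents_root : parents N C.root = ∅
  eq_root : ∀ w, parents N w = ∅ → w = C.root
  side_ne_nil : ∀ P Q, C.IsSides P Q → P ≠ []
  children_root : ∀ P Q, C.IsSides P Q →
    children N C.root = {P.headD C.hybrid, Q.headD C.hybrid}
  children_side : ∀ P Q, C.IsSides P Q → ∀ p w q, P = p ++ w :: q →
    children N w = {q.headD C.hybrid, lf w}
  children_hybrid : children N C.hybrid = {lf C.hybrid}
  children_leaf : ∀ x ∈ X, children N x = ∅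
  notMem_leaves_iff : ∀ w, w ∉ X ↔ w ∈ C.verts
  lf_mem : ∀ w ∈ C.verts, w ≠ C.root → lf w ∈ X
  lf_inj : ∀ w ∈ C.verts, w ≠ C.root → ∀ z ∈ C.verts, z ≠ C.root → lf w = lf z → w = z
  lf_surj : ∀ x ∈ X, ∃ w ∈ C.verts, w ≠ C.root ∧ lf w = x
  parents_subsingleton : ∀ w, w ≠ C.hybrid → (parents N w).Subsingleton
  adj_hybrid_iff : ∀ P Q, C.IsSides P Q → ∀ w, N.Adj w C.hybrid ↔
    (∃ p, P = p ++ [w]) ∨ ∃ p, Q = p ++ [w]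

/-- Every edge is a cycle edge or ends in a leaf. As leaves are not on the cycle, an edge entering a
cycle vertex is a cycle edge; this determines children and parents of every vertex. Strongness makes
both sides non-empty. -/
theorem IsElementary.exists_isPendantCycle {X : Set W} (h : IsElementary N X)
    (hs : IsStrongTree N) : ∃ C lf, IsPendantCycle N X C lf := by
  classical
  obtain ⟨hG, C, -, hroot, hcover, hleaf, hedge⟩ := h
  have hfin := hG.finite
  -- The one-vertex galled-tree is impossible, since a rooted cycle has distinct vertices `root` and
  -- `hybrid`.
  rcases hG.shape with ⟨x, -, hx⟩ | ⟨ρ, ⟨hρ0, -, hρu⟩, hX, -, -⟩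
  · have h1 : C.root ∈ ({x} : Set W) := hx ▸ Set.mem_univ _
    have h2 : C.hybrid ∈ ({x} : Set W) := hx ▸ Set.mem_univ _
    exact absurd (h1.trans h2.symm) C.isSides_self.root_ne_hybrid
  have hne : ∀ P Q, C.IsSides P Q → P ≠ [] := by
    have := (hs C).1
    rintro P Q (⟨rfl, rfl⟩ | ⟨rfl, rfl⟩) <;> tauto
  have hXch : ∀ x ∈ X, children N x = ∅ := fun x hx =>
    (Set.ncard_eq_zero (Set.toFinite _)).1 ((hX x).1 hx).1
  have hXpar : ∀ x ∈ X, ∃ a, parents N x = {a} := fun x hx =>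
    Set.ncard_eq_one.1 ((hX x).1 hx).2
  have hmem : ∀ w, w ∈ C.verts → w ∉ X := by
    intro w hw hwX
    have hch := hXch w hwX
    by_cases hr : w = C.root
    · have hp := C.path₁
      have := hne _ _ C.isSides_self
      cases hi : C.inner₁ with
      | nil => exact this hi
      | cons a l =>
        rw [hi] at hp
        simp only [List.cons_append, List.isChain_cons_cons] at hp
        have : a ∈ children N w := hr ▸ hp.1
        rw [hch] at this
        exact this
    · obtain ⟨x, ⟨-, hx⟩, -⟩ := hleaf w hw hr
      have : x ∈ children N w := hx
      rw [hch] at this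
      exact this
  choose! lf hlf hlfu using hleaf
  have hpend : ∀ w ∈ C.verts, w ≠ C.root → ∀ b ∈ X, N.Adj w b → b = lf w :=
    fun w hw hr b hb hwb => hlfu w hw hr b ⟨hb, hwb⟩
  have hadjE : ∀ a b, b ∈ C.verts → N.Adj a b → C.IsEdge a b := fun a b hb hab =>
    (hedge a b hab).resolve_right fun h => hmem b hb h.2.2
  have hrootverts : C.root ∈ C.verts := C.isSides_self.mem_verts.2 (Or.inl rfl)
  have hhybverts : C.hybrid ∈ C.verts := C.isSides_self.mem_verts.2 (Or.inr (Or.inl rfl))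
  have hEadj : ∀ a b, C.IsEdge a b → N.Adj a b := by
    rintro a b (h | h)
    · exact rel_of_pair_infix C.path₁ h
    · exact rel_of_pair_infix C.path₂ h
  have hedge_root : ∀ P Q, C.IsSides P Q → ∀ b, [C.root, b] <:+: (C.root :: (P ++ [C.hybrid])) →
      b = P.headD C.hybrid := by
    intro P Q hPQ b hb
    have := head_eq_of_pair_infix hPQ.nodup_path (s := []) rfl hb
    rw [head?_append_singleton] at this
    exact (Option.some.inj this).symm
  have hroot_edge : ∀ P : List W,
      [C.root, P.headD C.hybrid] <:+: (C.root :: (P ++ [C.hybrid])) := by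
    intro P
    cases P with
    | nil => simp
    | cons a l => exact ⟨[], l ++ [C.hybrid], by simp⟩
  refine ⟨C, lf, hG.acyclic, hroot, ?_, hne, ?_, ?_, ?_, hXch, ?_, ?_, ?_, ?_, ?_, ?_⟩
  · intro w hw
    rw [hρu w (by simp [hw]), hρu C.root (by simp [hroot])]
  · intro P Q hPQ
    ext b
    simp only [children, Set.mem_ofPred_eq, Set.mem_insert_iff, Set.mem_singleton_iff]
    constructor
    · intro hb
      have hE := (hedge _ _ hb).resolve_right fun h => h.2.1 rfl
      rcases hPQ.isEdge_iff.1 hE with h | h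
      · exact Or.inl (hedge_root P Q hPQ b h)
      · exact Or.inr (hedge_root Q P hPQ.symm b h)
    · rintro (rfl | rfl)
      · exact hEadj _ _ (hPQ.isEdge_iff.2 (Or.inl (hroot_edge P)))
      · exact hEadj _ _ (hPQ.isEdge_iff.2 (Or.inr (hroot_edge Q)))
  · intro P Q hPQ p w q hP
    have hwP : w ∈ P := by simp [hP]
    have hwv : w ∈ C.verts := hPQ.mem_verts.2 (Or.inr (Or.inr (Or.inl hwP)))
    have hwr : w ≠ C.root := fun e => hPQ.root_notMem (e ▸ hwP)
    have hl : C.root :: (P ++ [C.hybrid]) = (C.root :: p) ++ w :: (q ++ [C.hybrid]) := by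
      simp [hP]
    ext b
    simp only [children, Set.mem_ofPred_eq, Set.mem_insert_iff, Set.mem_singleton_iff]
    constructor
    · intro hb
      rcases hedge _ _ hb with hE | hE
      · left
        rcases hPQ.isEdge_iff.1 hE with h | h
        · have := head_eq_of_pair_infix hPQ.nodup_path hl h
          rw [head?_append_singleton] at this
          exact (Option.some.inj this).symm
        · exact absurd (h.subset (by simp)) (hPQ.notMem_path hwP)
      · exact Or.inr (hpend w hwv hwr b hE.2.2 hb)
    · rintro (rfl | rfl)
      · refine hEadj _ _ (hPQ.isEdge_iff.2 (Or.inl ?_))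
        rw [hl]
        cases q with
        | nil => exact ⟨C.root :: p, [], by simp⟩
        | cons c q => exact ⟨C.root :: p, q ++ [C.hybrid], by simp⟩
      · exact (hlf w hwv hwr).2
  · have hPQ := C.isSides_self
    have hno : ∀ P Q, C.IsSides P Q → ∀ b, ¬ [C.hybrid, b] <:+: (C.root :: (P ++ [C.hybrid])) := by
      intro P Q hPQ b hb
      have := head_eq_of_pair_infix hPQ.nodup_path (s := C.root :: P) (r := []) (by simp) hb
      simp at this
    ext b
    simp only [children, Set.mem_ofPred_eq, Set.mem_singleton_iff]
    constructor
    · intro hb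
      rcases hedge _ _ hb with hE | hE
      · rcases hPQ.isEdge_iff.1 hE with h | h
        · exact absurd h (hno _ _ hPQ b)
        · exact absurd h (hno _ _ hPQ.symm b)
      · exact hpend _ hE.1 hE.2.1 b hE.2.2 hb
    · rintro rfl
      exact (hlf _ hhybverts hPQ.root_ne_hybrid.symm).2
  · exact fun w => ⟨fun h => (hcover w).resolve_right h, hmem w⟩
  · exact fun w hw hr => (hlf w hw hr).1
  · intro w hw hr z hz hr' e
    obtain ⟨a, ha⟩ := hXpar _ (hlf w hw hr).1
    have h1 : w ∈ parents N (lf w) := (hlf w hw hr).2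
    have h2 : z ∈ parents N (lf w) := e ▸ (hlf z hz hr').2
    rw [ha] at h1 h2
    exact h1.trans h2.symm
  · intro x hx
    obtain ⟨a, ha⟩ := hXpar x hx
    have hax : N.Adj a x := show a ∈ parents N x from ha ▸ rfl
    rcases hedge _ _ hax with hE | hE
    · exact absurd hx (hmem _ (RootedCycle.mem_verts_of_isEdge hE).2)
    · exact ⟨a, hE.1, hE.2.1, (hpend a hE.1 hE.2.1 x hx hax).symm⟩
  · intro w hwh a ha b hb
    by_cases hwX : w ∈ X
    · obtain ⟨c, hc⟩ := hXpar w hwX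
      rw [hc] at ha hb
      exact ha.trans hb.symm
    have hwv := (hcover w).resolve_right hwX
    -- A parent of a side vertex `w` precedes it on its own side, because `w` does not occur on the
    -- other one.
    have key : ∀ P Q, C.IsSides P Q → w ∈ P → a = b := by
      intro P Q hPQ hwP
      obtain ⟨p, q, rfl⟩ := List.append_of_mem hwP
      have hl : C.root :: ((p ++ w :: q) ++ [C.hybrid])
        = (C.root :: p) ++ w :: (q ++ [C.hybrid]) := by simp
      have aux : ∀ c, N.Adj c w → (C.root :: p).getLast? = some c := by
        intro c hc
        rcases hPQ.isEdge_iff.1 (hadjE c w hwv hc) with h | h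
        · exact getLast_eq_of_pair_infix hPQ.nodup_path hl h
        · exact absurd (h.subset (by simp)) (hPQ.notMem_path hwP)
      exact Option.some.inj ((aux a ha).symm.trans (aux b hb))
    rcases C.isSides_self.mem_verts.1 hwv with h | h | h | h
    · rw [h, hroot] at ha
      exact absurd ha (Set.notMem_empty a)
    · exact absurd h hwh
    · exact key _ _ C.isSides_self h
    · exact key _ _ C.isSides_self.symm h
  · intro P Q hPQ w
    have key : ∀ P Q, C.IsSides P Q →
        ([w, C.hybrid] <:+: (C.root :: (P ++ [C.hybrid])) ↔ ∃ p, P = p ++ [w]) := by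
      intro P Q hPQ
      constructor
      · intro h
        have := getLast_eq_of_pair_infix hPQ.nodup_path (s := C.root :: P) (r := []) (by simp) h
        obtain ⟨a, l, rfl⟩ := List.exists_cons_of_ne_nil (hne P Q hPQ)
        rw [List.getLast?_cons_cons] at this
        exact ⟨_, (List.dropLast_append_getLast? w this).symm⟩
      · rintro ⟨p, rfl⟩
        exact ⟨C.root :: p, [], by simp⟩
    rw [← key P Q hPQ, ← key Q P hPQ.symm, ← hPQ.isEdge_iff]
    exact ⟨hadjE _ _ hhybverts, hEadj _ _⟩

end Cycles

end Gatex

/-! ### Lowest common ancestors in a cycle with pendant leaves -/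

namespace Gatex

section LowestCommonAncestors

variable {W : Type v} {N : Digraph W} {X : Set W} {C : RootedCycle N} {lf : W → W}

theorem IsAcyclic.eq_of_anc (h : IsAcyclic N) {a b : W} (hab : Anc N a b) (hba : Anc N b a) :
    a = b := by
  rcases Relation.reflTransGen_iff_eq_or_transGen.1 hab with e | hab
  · exact e.symm
  · exact absurd (hab.trans_left hba) (h a)

/-- If the common ancestors form the set of ancestors of a single `w`, antisymmetry of the ancestor
relation singles out `w`. All lowest common ancestors are found through this criterion. -/
theorem IsAcyclic.isLCA_iff (h : IsAcyclic N) {x y w : W}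
    (hw : ∀ z, Anc N z x ∧ Anc N z y ↔ Anc N z w) (z : W) : IsLCA N x y z ↔ z = w := by
  have hww := (hw w).2 Relation.ReflTransGen.refl
  constructor
  · rintro ⟨hz, hmin⟩
    exact (hmin w hww.1 hww.2 ((hw z).1 hz)).symm
  · rintro rfl
    exact ⟨hww, fun z hx hy hwz => h.eq_of_anc ((hw z).1 ⟨hx, hy⟩) hwz⟩

theorem transGen_of_isChain_cons {r : W → W → Prop} {a b : W} {l : List W}
    (h : List.IsChain r (a :: l)) (hb : b ∈ l) : Relation.TransGen r a b :=
  (h.imp fun _ _ => Relation.TransGen.single).rel_cons hb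

namespace IsPendantCycle

variable (h : IsPendantCycle N X C lf)
include h

theorem adj_lf {w : W} (hw : w ∈ C.verts) (hr : w ≠ C.root) : N.Adj w (lf w) := by
  have key : ∀ P Q, C.IsSides P Q → w ∈ P → N.Adj w (lf w) := by
    intro P Q hPQ hwP
    obtain ⟨p, q, rfl⟩ := List.append_of_mem hwP
    have : lf w ∈ children N w := by
      rw [h.children_side _ _ hPQ p w q rfl]
      simp
    exact this
  rcases C.isSides_self.mem_verts.1 hw with e | e | e | e
  · exact absurd e hr
  · have : lf C.hybrid ∈ children N C.hybrid := by
      rw [h.children_hybrid]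
      rfl
    rw [e]
    exact this
  · exact key _ _ C.isSides_self e
  · exact key _ _ C.isSides_self.symm e

theorem lf_ne_hybrid {w : W} (hw : w ∈ C.verts) (hr : w ≠ C.root) : lf w ≠ C.hybrid := fun e =>
  (h.notMem_leaves_iff C.hybrid).2 C.hybrid_mem.1 (e ▸ h.lf_mem w hw hr)

theorem anc_lf_iff {w z : W} (hw : w ∈ C.verts) (hr : w ≠ C.root) :
    Anc N z (lf w) ↔ z = lf w ∨ Anc N z w := by
  constructor
  · intro hz
    rcases Relation.ReflTransGen.cases_tail hz with e | ⟨b, hzb, hb⟩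
    · exact Or.inl e.symm
    · right
      rwa [h.parents_subsingleton _ (h.lf_ne_hybrid hw hr) (show b ∈ parents N (lf w) from hb)
        (h.adj_lf hw hr)] at hzb
  · rintro (rfl | hz)
    · exact Relation.ReflTransGen.refl
    · exact Relation.ReflTransGen.tail hz (h.adj_lf hw hr)

theorem eq_of_anc_leaf {x z : W} (hx : x ∈ X) (hz : Anc N x z) : x = z := by
  rcases Relation.ReflTransGen.cases_head hz with e | ⟨b, hb, -⟩
  · exact e
  · have : b ∈ children N x := hb
    rw [h.children_leaf x hx] at this
    exact absurd this (Set.notMem_empty b)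

/-- An attached leaf has no descendant but itself and its only parent is its cycle vertex, so lowest
common ancestors of leaves become lowest common ancestors on the cycle. -/
theorem common_anc_lf_iff {w u : W} (hw : w ∈ C.verts) (hr : w ≠ C.root) (hu : u ∈ C.verts)
    (hur : u ≠ C.root) (hwu : w ≠ u) (z : W) :
    Anc N z (lf w) ∧ Anc N z (lf u) ↔ Anc N z w ∧ Anc N z u := by
  have hne : lf w ≠ lf u := fun e => hwu (h.lf_inj w hw hr u hu hur e)
  rw [h.anc_lf_iff hw hr, h.anc_lf_iff hu hur]
  constructor
  · rintro ⟨rfl | h1, h2⟩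
    · rcases h2 with h2 | h2
      · exact absurd h2 hne
      · have := h.eq_of_anc_leaf (h.lf_mem w hw hr) h2
        exact absurd (this ▸ h.lf_mem w hw hr) ((h.notMem_leaves_iff u).2 hu)
    · rcases h2 with rfl | h2
      · have := h.eq_of_anc_leaf (h.lf_mem u hu hur) h1
        exact absurd (this ▸ h.lf_mem u hu hur) ((h.notMem_leaves_iff w).2 hw)
      · exact ⟨h1, h2⟩
  · exact fun h' => ⟨Or.inr h'.1, Or.inr h'.2⟩

/-- Parents are unique away from the hybrid-vertex, so climbing from an internal vertex of a side
stays on that side until the root is reached. -/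
theorem mem_of_anc_side {P Q : List W} (hPQ : C.IsSides P Q) {u z : W} (hu : u ∈ P)
    (hz : Anc N z u) : z = C.root ∨ z ∈ P := by
  induction hz using Relation.ReflTransGen.head_induction_on with
  | refl => exact Or.inr hu
  | @head a c hac _ ih =>
    rcases ih with rfl | hc
    · have : a ∈ parents N C.root := hac
      rw [h.parents_root] at this
      exact absurd this (Set.notMem_empty a)
    · obtain ⟨p, q, rfl⟩ := List.append_of_mem hc
      have hch : c ≠ C.hybrid := fun e => hPQ.hybrid_notMem (e ▸ hc)
      rcases List.eq_nil_or_concat p with rfl | ⟨p', b, rfl⟩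
      · left
        have hp := hPQ.path
        simp only [List.nil_append, List.cons_append, List.isChain_cons_cons] at hp
        exact h.parents_subsingleton c hch hac hp.1
      · right
        have hb : N.Adj b c := rel_of_pair_infix hPQ.path
          ⟨C.root :: p', q ++ [C.hybrid], by simp⟩
        have e := h.parents_subsingleton c hch (show a ∈ parents N c from hac) hb
        rw [e]
        simp

variable (t : W → NLabel)

/-- As `w` is an ancestor of `u`, the common ancestors of the two are the ancestors of `w`. The case
that `u` is the hybrid-vertex is included, whichever side `w` is on. -/
theorem explained_adj_side {P Q p q : List W} (hPQ : C.IsSides P Q) {w u : W}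
    (hP : P = p ++ w :: q) (hu : u ∈ q ++ [C.hybrid]) (hw' : lf w ∈ X) (hu' : lf u ∈ X) :
    (explained N X t).Adj ⟨lf w, hw'⟩ ⟨lf u, hu'⟩ ↔ t w = NLabel.one := by
  have hpath := hPQ.path
  have hl : C.root :: (P ++ [C.hybrid]) = (C.root :: p) ++ w :: (q ++ [C.hybrid]) := by simp [hP]
  have hnd := hPQ.nodup_path
  rw [hl] at hpath hnd
  have hwu : Relation.TransGen N.Adj w u := transGen_of_isChain_cons hpath.right_of_append hu
  have hne : w ≠ u := by
    rintro rfl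
    exact h.acyclic w hwu
  have hwP : w ∈ P := by simp [hP]
  have hwr : w ≠ C.root := fun e => hPQ.root_notMem (e ▸ hwP)
  have hwv : w ∈ C.verts := hPQ.mem_verts.2 (Or.inr (Or.inr (Or.inl hwP)))
  have huu : u = C.hybrid ∨ u ∈ P := by
    rw [hP]
    simp only [List.mem_append, List.mem_cons, List.not_mem_nil, or_false] at hu ⊢
    tauto
  have huv : u ∈ C.verts := by
    rw [hPQ.mem_verts]
    tauto
  have hur : u ≠ C.root := by
    rcases huu with e | e
    · rw [e]
      exact hPQ.root_ne_hybrid.symm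
    · exact fun e' => hPQ.root_notMem (e' ▸ e)
  have hlca := h.acyclic.isLCA_iff (x := lf w) (y := lf u) (w := w) fun z => by
    rw [h.common_anc_lf_iff hwv hwr huv hur hne z]
    exact ⟨And.left, fun hz => ⟨hz, Relation.ReflTransGen.trans hz hwu.to_reflTransGen⟩⟩
  have hne' : lf w ≠ lf u := fun e => hne (h.lf_inj w hwv hwr u huv hur e)
  simp [explained, hlca, hne']

/-- A common ancestor of vertices on different sides would lie on both sides unless it is the root.
-/
theorem explained_adj_cross {P Q : List W} (hPQ : C.IsSides P Q) {w u : W} (hw : w ∈ P)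
    (hu : u ∈ Q) (hw' : lf w ∈ X) (hu' : lf u ∈ X) :
    (explained N X t).Adj ⟨lf w, hw'⟩ ⟨lf u, hu'⟩ ↔ t C.root = NLabel.one := by
  have hne : w ≠ u := by
    rintro rfl
    exact hPQ.disjoint hw hu
  have hwr : w ≠ C.root := fun e => hPQ.root_notMem (e ▸ hw)
  have hwv : w ∈ C.verts := hPQ.mem_verts.2 (Or.inr (Or.inr (Or.inl hw)))
  have hur : u ≠ C.root := fun e => hPQ.symm.root_notMem (e ▸ hu)
  have huv : u ∈ C.verts := hPQ.mem_verts.2 (Or.inr (Or.inr (Or.inr hu)))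
  have h1 : Anc N C.root w := (transGen_of_isChain_cons hPQ.path (by simp [hw])).to_reflTransGen
  have h2 : Anc N C.root u :=
    (transGen_of_isChain_cons hPQ.symm.path (by simp [hu])).to_reflTransGen
  have hlca := h.acyclic.isLCA_iff (x := lf w) (y := lf u) (w := C.root) fun z => by
    rw [h.common_anc_lf_iff hwv hwr huv hur hne z]
    constructor
    · rintro ⟨hzw, hzu⟩
      rcases h.mem_of_anc_side hPQ hw hzw with rfl | hz
      · exact Relation.ReflTransGen.refl
      · rcases h.mem_of_anc_side hPQ.symm hu hzu with rfl | hz'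
        · exact Relation.ReflTransGen.refl
        · exact absurd hz' (hPQ.disjoint hz)
    · exact fun hz => ⟨hz.trans h1, hz.trans h2⟩
  have hne' : lf w ≠ lf u := fun e => hne (h.lf_inj w hwv hwr u huv hur e)
  simp [explained, hlca, hne']

end IsPendantCycle

end LowestCommonAncestors

end Gatex

/-! ### Gluing the galled-trees into the modular decomposition tree -/

namespace Gatex

namespace PvrNetwork

variable {V : Type u} [Fintype V] {G : SimpleGraph V} (D : PvrNetwork.{u, v} G)

theorem exists_isPendantCycle (M : PrimeMod G) :
    ∃ C lf, IsPendantCycle (D.tree M) (D.leaves M) C lf ∧ D.treeRoot M = C.root := by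
  obtain ⟨C, lf, h⟩ := (D.elementary M).exists_isPendantCycle (D.strong M)
  exact ⟨C, lf, h, h.eq_root _ (D.treeRoot_spec M)⟩

theorem treeRoot_notMem (M : PrimeMod G) : D.treeRoot M ∉ D.leaves M := by
  obtain ⟨C, lf, h, e⟩ := D.exists_isPendantCycle M
  rw [e, h.notMem_leaves_iff, C.isSides_self.mem_verts]
  exact Or.inl rfl

/-- The child of `M` that is identified with the leaf `w` of the galled-tree for `M`. -/
def childMod (M : PrimeMod G) (w : D.W M) (hl : w ∈ D.leaves M) : StrongMod G :=
  ⟨((D.explains M).symm ⟨w, hl⟩).1,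
    IsStrongModule.trans M.1.2 ((D.explains M).symm ⟨w, hl⟩).2.prop.1⟩

theorem childMod_covBy (M : PrimeMod G) (w : D.W M) (hl : w ∈ D.leaves M) :
    D.childMod M w hl ⋖ M.1 :=
  isMaxStrong_iff_covBy.1 ((D.explains M).symm ⟨w, hl⟩).2

theorem childMod_inj {M : PrimeMod G} {w z : D.W M} {hw : w ∈ D.leaves M} {hz : z ∈ D.leaves M}
    (h : D.childMod M w hw = D.childMod M z hz) : w = z := by
  have h1 : (D.explains M).symm ⟨w, hw⟩ = (D.explains M).symm ⟨z, hz⟩ :=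
    Subtype.ext (congrArg (fun A : StrongMod G => A.1) h)
  exact congrArg Subtype.val ((D.explains M).symm.injective h1)

theorem exists_childMod_eq {M : PrimeMod G} {A : StrongMod G} (hA : A ⋖ M.1) :
    ∃ w hw, D.childMod M w hw = A := by
  refine ⟨(D.explains M ⟨A.1, isMaxStrong_iff_covBy.2 hA⟩).1,
    (D.explains M ⟨A.1, isMaxStrong_iff_covBy.2 hA⟩).2, ?_⟩
  apply Subtype.ext
  simp [childMod]

theorem adj_iff_of_mem_childMod {M : PrimeMod G} {w z : D.W M} {hw : w ∈ D.leaves M}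
    {hz : z ∈ D.leaves M} (hwz : w ≠ z) {a b : V} (ha : a ∈ (D.childMod M w hw).1)
    (hb : b ∈ (D.childMod M z hz).1) :
    G.Adj a b ↔ (explained (D.tree M) (D.leaves M) (D.treeLabel M)).Adj ⟨w, hw⟩ ⟨z, hz⟩ := by
  have hne : (D.explains M).symm ⟨w, hw⟩ ≠ (D.explains M).symm ⟨z, hz⟩ := fun e =>
    hwz (congrArg Subtype.val ((D.explains M).symm.injective e))
  rw [← quotientGraph_adj_iff (M := M.1) hne ha hb]
  exact (D.explains M).symm.map_adj_iff

theorem glue_leaf {M : PrimeMod G} {w : D.W M} (hl : w ∈ D.leaves M) :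
    D.glue M w = Sum.inl (D.childMod M w hl) := by
  simp [glue, hl, childMod]

theorem glue_root (M : PrimeMod G) : D.glue M (D.treeRoot M) = Sum.inl M.1 := by
  simp [glue, D.treeRoot_notMem]

theorem glue_inner {M : PrimeMod G} {w : D.W M} (hl : w ∉ D.leaves M) (hr : w ≠ D.treeRoot M) :
    D.glue M w = Sum.inr ⟨M, w, hl, hr⟩ := by
  simp [glue, hl, hr]

/-- Different galled-trees share a network vertex only where a leaf of one is the root of another,
or where prime modules share a child. Without leaves nothing is identified; `glue_eq_of_ne_root` is
the counterpart without roots, using that a child has only one parent in the tree. -/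
theorem glue_eq_of_notMem {M M' : PrimeMod G} {w : D.W M} {w' : D.W M'} (hw : w ∉ D.leaves M)
    (hw' : w' ∉ D.leaves M') (h : D.glue M w = D.glue M' w') :
    (⟨M, w⟩ : Σ M, D.W M) = ⟨M', w'⟩ := by
  by_cases hr : w = D.treeRoot M <;> by_cases hr' : w' = D.treeRoot M'
  · rw [hr, hr', glue_root, glue_root] at h
    obtain rfl : M = M' := Subtype.ext (Sum.inl.inj h)
    rw [hr, hr']
  · rw [hr, glue_root, D.glue_inner hw' hr'] at h
    exact absurd h (by simp)
  · rw [hr', glue_root, D.glue_inner hw hr] at h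
    exact absurd h (by simp)
  · rw [D.glue_inner hw hr, D.glue_inner hw' hr'] at h
    cases h
    rfl

theorem glue_eq_of_ne_root {M M' : PrimeMod G} {w : D.W M} {w' : D.W M'} (hw : w ≠ D.treeRoot M)
    (hw' : w' ≠ D.treeRoot M') (h : D.glue M w = D.glue M' w') :
    (⟨M, w⟩ : Σ M, D.W M) = ⟨M', w'⟩ := by
  by_cases hl : w ∈ D.leaves M <;> by_cases hl' : w' ∈ D.leaves M'
  · rw [D.glue_leaf hl, D.glue_leaf hl'] at h
    have h := Sum.inl.inj h
    obtain rfl : M = M' := Subtype.ext (StrongMod.eq_of_covBy (D.childMod_covBy M w hl)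
      (h ▸ D.childMod_covBy M' w' hl'))
    rw [D.childMod_inj h]
  · rw [D.glue_leaf hl, D.glue_inner hl' hw'] at h
    exact absurd h (by simp)
  · rw [D.glue_leaf hl', D.glue_inner hl hw] at h
    exact absurd h (by simp)
  · exact D.glue_eq_of_notMem hl hl' h

theorem glue_injective (M : PrimeMod G) : Function.Injective (D.glue M) := by
  have key : ∀ w z, D.glue M w = D.glue M z → w ∈ D.leaves M → w = z := by
    intro w z h hw
    have hwr : w ≠ D.treeRoot M := fun e => D.treeRoot_notMem M (e ▸ hw)
    by_cases hz : z = D.treeRoot M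
    · rw [D.glue_leaf hw, hz, glue_root] at h
      exact absurd (Sum.inl.inj h) (D.childMod_covBy M w hw).lt.ne
    · simpa using D.glue_eq_of_ne_root hwr hz h
  intro w z h
  by_cases hw : w ∈ D.leaves M
  · exact key w z h hw
  by_cases hz : z ∈ D.leaves M
  · exact (key z w h.symm hz).symm
  · simpa using D.glue_eq_of_notMem hw hz h

theorem notMem_leaves_of_adj {M : PrimeMod G} {w z : D.W M} (h : (D.tree M).Adj w z) :
    w ∉ D.leaves M := by
  obtain ⟨C, lf, hC, -⟩ := D.exists_isPendantCycle M
  intro hw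
  have : z ∈ children (D.tree M) w := h
  rw [hC.children_leaf w hw] at this
  exact this

theorem ne_treeRoot_of_adj {M : PrimeMod G} {w z : D.W M} (h : (D.tree M).Adj w z) :
    z ≠ D.treeRoot M := by
  rintro rfl
  have : w ∈ parents (D.tree M) (D.treeRoot M) := h
  rw [D.treeRoot_spec] at this
  exact this

theorem adj_glue {M : PrimeMod G} {w z : D.W M} (h : (D.tree M).Adj w z) :
    D.network.Adj (D.glue M w) (D.glue M z) :=
  Or.inr ⟨M, w, z, h, rfl, rfl⟩

theorem eq_of_glue_eq_inl {M : PrimeMod G} {w : D.W M} (hw : w ∉ D.leaves M) {A : StrongMod G}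
    (h : D.glue M w = Sum.inl A) : M.1 = A := by
  by_cases hr : w = D.treeRoot M
  · rw [hr, glue_root] at h
    exact Sum.inl.inj h
  · rw [D.glue_inner hw hr] at h
    exact absurd h (by simp)

/-- Edges leaving a network vertex come from the galled-tree in which the vertex is not a leaf;
dually, for `parents_glue`, edges entering it come from the one in which it is not the root. -/
theorem ch_glue {M : PrimeMod G} {w : D.W M} (hw : w ∉ D.leaves M) :
    D.ch (D.glue M w) = D.glue M '' children (D.tree M) w := by
  ext b
  constructor
  · rintro (⟨A, B, hA, -, hwA, -⟩ | ⟨M', w', z', hadj, hww', rfl⟩)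
    · exact absurd M.2 (D.eq_of_glue_eq_inl hw hwA ▸ hA)
    · cases D.glue_eq_of_notMem hw (D.notMem_leaves_of_adj hadj) hww'
      exact ⟨z', hadj, rfl⟩
  · rintro ⟨z, hz, rfl⟩
    exact D.adj_glue hz

theorem parents_glue {M : PrimeMod G} {w : D.W M} (hw : w ≠ D.treeRoot M) :
    parents D.network (D.glue M w) = D.glue M '' parents (D.tree M) w := by
  ext a
  constructor
  · rintro (⟨A, B, hA, hBA, rfl, hB⟩ | ⟨M', a', w', hadj, rfl, hww'⟩)
    · by_cases hl : w ∈ D.leaves M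
      · rw [D.glue_leaf hl] at hB
        have := StrongMod.eq_of_covBy (D.childMod_covBy M w hl) (Sum.inl.inj hB ▸ hBA)
        exact absurd M.2 (this ▸ hA)
      · rw [D.glue_inner hl hw] at hB
        exact absurd hB (by simp)
    · cases D.glue_eq_of_ne_root hw (D.ne_treeRoot_of_adj hadj) hww'
      exact ⟨a', hadj, rfl⟩
  · rintro ⟨a, ha, rfl⟩
    exact D.adj_glue ha

theorem ch_inl {A : StrongMod G} (hA : mdLabel G A ≠ MDLabel.prime) :
    D.ch (Sum.inl A) = Sum.inl '' {B : StrongMod G | B ⋖ A} := by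
  ext b
  constructor
  · rintro (⟨A', B, -, hB, hAA', rfl⟩ | ⟨M, w, z, hadj, hw, rfl⟩)
    · obtain rfl := Sum.inl.inj hAA'
      exact ⟨B, hB, rfl⟩
    · exact absurd M.2 (D.eq_of_glue_eq_inl (D.notMem_leaves_of_adj hadj) hw.symm ▸ hA)
  · rintro ⟨B, hB, rfl⟩
    exact Or.inl ⟨A, B, hA, hB, rfl, rfl⟩

theorem label_glue {M : PrimeMod G} {w : D.W M} (hw : w ∉ D.leaves M) :
    D.label (D.glue M w) = D.treeLabel M w := by
  by_cases hr : w = D.treeRoot M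
  · rw [hr, glue_root]
    simp [label, M.2]
  · rw [D.glue_inner hw hr]
    rfl

/-- A vertex with two parents is the hybrid-vertex of the galled-tree of some prime module. -/
theorem parents_subsingleton_or (v : D.Vert) :
    (parents D.network v).Subsingleton ∨
      ∃ M C lf, IsPendantCycle (D.tree M) (D.leaves M) C lf ∧ D.treeRoot M = C.root ∧
        v = D.glue M C.hybrid := by
  by_cases hv : ∃ M w, w ≠ D.treeRoot M ∧ v = D.glue M w
  · obtain ⟨M, w, hw, rfl⟩ := hv
    obtain ⟨C, lf, hC, e⟩ := D.exists_isPendantCycle M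
    by_cases hh : w = C.hybrid
    · exact Or.inr ⟨M, C, lf, hC, e, by rw [hh]⟩
    · left
      rw [D.parents_glue hw]
      exact (hC.parents_subsingleton w hh).image _
  · left
    push Not at hv
    rintro a (⟨A, B, -, hBA, rfl, hB⟩ | ⟨M, w, z, hadj, -, hz⟩)
    · rintro b (⟨A', B', -, hBA', rfl, hB'⟩ | ⟨M, w, z, hadj, -, hz⟩)
      · obtain rfl := Sum.inl.inj (hB.symm.trans hB')
        rw [StrongMod.eq_of_covBy hBA hBA']
      · exact absurd hz (hv M z (D.ne_treeRoot_of_adj hadj))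
    · exact absurd hz (hv M z (D.ne_treeRoot_of_adj hadj))

/-- A height function that does not increase along edges. -/
def rank : D.Vert → ℕ
  | Sum.inl A => 2 * A.1.card
  -- This lies strictly between the rank of `M` and the ranks of the children of `M`, which are at
  -- most `2 * (|M| - 1)`.
  | Sum.inr p => 2 * p.1.1.1.card - 1

theorem rank_le_of_adj {a b : D.Vert} (h : D.network.Adj a b) : D.rank b ≤ D.rank a := by
  rcases h with ⟨A, B, -, hBA, rfl, rfl⟩ | ⟨M, w, z, hadj, rfl, rfl⟩
  · have : B.1.card < A.1.card := Finset.card_lt_card hBA.lt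
    simp only [rank]
    omega
  · have h1 : 2 * M.1.1.card - 1 ≤ D.rank (D.glue M w) := by
      by_cases hr : w = D.treeRoot M
      · rw [hr, glue_root]
        simp only [rank]
        omega
      · rw [D.glue_inner (D.notMem_leaves_of_adj hadj) hr]
        exact le_rfl
    have h2 : D.rank (D.glue M z) ≤ 2 * M.1.1.card - 1 := by
      by_cases hl : z ∈ D.leaves M
      · rw [D.glue_leaf hl]
        have : (D.childMod M z hl).1.card < M.1.1.card :=
          Finset.card_lt_card (D.childMod_covBy M z hl).lt
        simp only [rank]
        omega
      · rw [D.glue_inner hl (D.ne_treeRoot_of_adj hadj)]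
        exact le_rfl
    exact h2.trans h1

theorem rank_le_of_anc {a b : D.Vert} (h : Anc D.network a b) : D.rank b ≤ D.rank a := by
  induction h with
  | refl => exact le_rfl
  | tail _ hbc ih => exact (D.rank_le_of_adj hbc).trans ih

end PvrNetwork

end Gatex

/-! ### Rooted cycles of the network -/

namespace Gatex

/-- The image of a rooted cycle under an injective homomorphism of directed graphs. -/
def RootedCycle.map {W : Type*} {W' : Type*} {N : Digraph W} {N' : Digraph W'}
    (C : RootedCycle N) (f : W → W') (hf : Function.Injective f)
    (hadj : ∀ a b, N.Adj a b → N'.Adj (f a) (f b)) : RootedCycle N' where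
  root := f C.root
  hybrid := f C.hybrid
  inner₁ := C.inner₁.map f
  inner₂ := C.inner₂.map f
  path₁ := by simpa using List.isChain_map_of_isChain f hadj C.path₁
  path₂ := by simpa using List.isChain_map_of_isChain f hadj C.path₂
  nodup := by simpa using C.nodup.map hf
  nontrivial := by simpa using C.nontrivial

theorem RootedCycle.isSides_map {W : Type*} {W' : Type*} {N : Digraph W} {N' : Digraph W'}
    {C : RootedCycle N} {f : W → W'} {hf : Function.Injective f}
    {hadj : ∀ a b, N.Adj a b → N'.Adj (f a) (f b)} {P Q : List W'}
    (h : (C.map f hf hadj).IsSides P Q) :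
    ∃ P' Q', C.IsSides P' Q' ∧ P = P'.map f ∧ Q = Q'.map f := by
  rcases h with ⟨rfl, rfl⟩ | ⟨rfl, rfl⟩
  · exact ⟨_, _, C.isSides_self, rfl, rfl⟩
  · exact ⟨_, _, C.isSides_self.symm, rfl, rfl⟩

theorem RootedCycle.mem_verts_map {W : Type*} {W' : Type*} {N : Digraph W} {N' : Digraph W'}
    {C : RootedCycle N} {f : W → W'} {hf : Function.Injective f}
    {hadj : ∀ a b, N.Adj a b → N'.Adj (f a) (f b)} {v : W'} :
    v ∈ (C.map f hf hadj).verts ↔ ∃ w ∈ C.verts, f w = v := by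
  have : (C.map f hf hadj).vertexList = C.vertexList.map f := by
    simp [vertexList, RootedCycle.map]
  simp [verts, this]

namespace PvrNetwork

variable {V : Type u} [Fintype V] {G : SimpleGraph V} (D : PvrNetwork.{u, v} G)

/-- `C` is the cycle of the network below the prime module `M`, where the children of `M` are attached
to the vertices of `C` by the map `B`. -/
structure IsCycleAt (M : PrimeMod G) (C : RootedCycle D.network) (B : D.Vert → StrongMod G) :
    Prop where
  root_eq : C.root = Sum.inl M.1
  mem_iff : ∀ v, v ∈ C.verts ∧ v ≠ C.root ↔ ∃ w, v = Sum.inr ⟨M, w⟩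
  side_ne_nil : ∀ P Q, C.IsSides P Q → P ≠ []
  ch_root : ∀ P Q, C.IsSides P Q → D.ch C.root = {P.headD C.hybrid, Q.headD C.hybrid}
  ch_side : ∀ P Q, C.IsSides P Q → ∀ p w q, P = p ++ w :: q →
    D.ch w = {q.headD C.hybrid, Sum.inl (B w)}
  ch_hybrid : D.ch C.hybrid = {Sum.inl (B C.hybrid)}
  adj_hybrid_iff : ∀ P Q, C.IsSides P Q → ∀ w, D.network.Adj w C.hybrid ↔
    (∃ p, P = p ++ [w]) ∨ ∃ p, Q = p ++ [w]
  parents_subsingleton : ∀ v ∈ C.verts, v ≠ C.hybrid → v ≠ C.root →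
    (parents D.network v).Subsingleton
  covBy : ∀ v ∈ C.verts, v ≠ C.root → B v ⋖ M.1
  inj : ∀ v ∈ C.verts, v ≠ C.root → ∀ w ∈ C.verts, w ≠ C.root → B v = B w → v = w
  surj : ∀ A : StrongMod G, A ⋖ M.1 → ∃ v ∈ C.verts, v ≠ C.root ∧ B v = A
  adj_side : ∀ P Q, C.IsSides P Q → ∀ p w q, P = p ++ w :: q → ∀ u ∈ q ++ [C.hybrid],
    ∀ a ∈ (B w).1, ∀ b ∈ (B u).1, G.Adj a b ↔ D.label w = NLabel.one
  adj_cross : ∀ P Q, C.IsSides P Q → ∀ w ∈ P, ∀ u ∈ Q,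
    ∀ a ∈ (B w).1, ∀ b ∈ (B u).1, G.Adj a b ↔ D.label C.root = NLabel.one
  label_ne_leaf : ∀ v ∈ C.verts, D.label v ≠ NLabel.leaf

/-- The description of the cycle does not depend on the order of its sides. -/
theorem IsCycleAt.congr {M : PrimeMod G} {C C' : RootedCycle D.network} {B : D.Vert → StrongMod G}
    (h : D.IsCycleAt M C B) (hr : C'.root = C.root) (hh : C'.hybrid = C.hybrid)
    (hs : ∀ P Q, C'.IsSides P Q → C.IsSides P Q) : D.IsCycleAt M C' B := by
  have hv : ∀ v, v ∈ C'.verts ↔ v ∈ C.verts := fun v => by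
    rw [C'.isSides_self.mem_verts, (hs _ _ C'.isSides_self).mem_verts, hr, hh]
  constructor <;> (try simp only [hv, hr, hh])
  · exact h.root_eq
  · exact h.mem_iff
  · exact fun P Q hPQ => h.side_ne_nil P Q (hs P Q hPQ)
  · exact fun P Q hPQ => h.ch_root P Q (hs P Q hPQ)
  · exact fun P Q hPQ => h.ch_side P Q (hs P Q hPQ)
  · exact h.ch_hybrid
  · exact fun P Q hPQ => h.adj_hybrid_iff P Q (hs P Q hPQ)
  · exact h.parents_subsingleton
  · exact h.covBy
  · exact h.inj
  · exact h.surj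
  · exact fun P Q hPQ => h.adj_side P Q (hs P Q hPQ)
  · exact fun P Q hPQ => h.adj_cross P Q (hs P Q hPQ)
  · exact h.label_ne_leaf

theorem headD_map {α β : Type*} (f : α → β) (l : List α) (a : α) :
    (l.map f).headD (f a) = f (l.headD a) := by
  cases l <;> rfl

/-- Transports the pendant cycle along the injective gluing map; a leaf `lf w` turns into the child
module `B` at `w`, and adjacency in the quotient turns into adjacency between modules. The equation
for the hybrid-vertex allows an arbitrary rooted cycle to be matched with this one. -/
theorem exists_isCycleAt_of_isPendantCycle {M : PrimeMod G} {T : RootedCycle (D.tree M)}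
    {lf : D.W M → D.W M} (h : IsPendantCycle (D.tree M) (D.leaves M) T lf)
    (hr : D.treeRoot M = T.root) :
    ∃ C B, D.IsCycleAt M C B ∧ C.hybrid = D.glue M T.hybrid := by
  classical
  have hinj := D.glue_injective M
  have : Nonempty (D.W M) := ⟨D.treeRoot M⟩
  let inv : D.Vert → D.W M := Function.invFun (D.glue M)
  have hinv : ∀ w, inv (D.glue M w) = w := Function.leftInverse_invFun hinj
  let B : D.Vert → StrongMod G := fun v =>
    -- The value `M.1` is a dummy; `B` matters only at cycle vertices other than the root.
    if hl : lf (inv v) ∈ D.leaves M then D.childMod M _ hl else M.1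
  have hB : ∀ w (hw : w ∈ T.verts) (hwr : w ≠ T.root),
      B (D.glue M w) = D.childMod M (lf w) (h.lf_mem w hw hwr) := by
    intro w hw hwr
    have hl := h.lf_mem w hw hwr
    have : lf (inv (D.glue M w)) ∈ D.leaves M := by rw [hinv]; exact hl
    simp only [B, this, dif_pos]
    congr 1
    rw [hinv]
  have hB' : ∀ w (hw : w ∈ T.verts) (hwr : w ≠ T.root),
      Sum.inl (B (D.glue M w)) = D.glue M (lf w) := by
    intro w hw hwr
    rw [hB w hw hwr, D.glue_leaf (h.lf_mem w hw hwr)]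
  have hnl : ∀ w ∈ T.verts, w ∉ D.leaves M := fun w hw => (h.notMem_leaves_iff w).2 hw
  have hrv : T.root ∈ T.verts := T.isSides_self.mem_verts.2 (Or.inl rfl)
  have hhv : T.hybrid ∈ T.verts := T.isSides_self.mem_verts.2 (Or.inr (Or.inl rfl))
  have hhr : T.hybrid ≠ T.root := T.isSides_self.root_ne_hybrid.symm
  have hsv : ∀ P Q, T.IsSides P Q → ∀ w ∈ P, w ∈ T.verts ∧ w ≠ T.root := fun P Q hPQ w hw =>
    ⟨hPQ.mem_verts.2 (Or.inr (Or.inr (Or.inl hw))), fun e => hPQ.root_notMem (e ▸ hw)⟩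
  have hadjB : ∀ w (hw : w ∈ T.verts) (hwr : w ≠ T.root) u (hu : u ∈ T.verts) (hur : u ≠ T.root),
      w ≠ u → ∀ a ∈ (B (D.glue M w)).1, ∀ b ∈ (B (D.glue M u)).1, (G.Adj a b ↔
        (explained (D.tree M) (D.leaves M) (D.treeLabel M)).Adj ⟨lf w, h.lf_mem w hw hwr⟩
          ⟨lf u, h.lf_mem u hu hur⟩) := by
    intro w hw hwr u hu hur hwu a ha b hb
    rw [hB w hw hwr] at ha
    rw [hB u hu hur] at hb
    exact D.adj_iff_of_mem_childMod (fun e => hwu (h.lf_inj w hw hwr u hu hur e)) ha hb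
  let C : RootedCycle D.network := T.map (D.glue M) hinj fun _ _ => D.adj_glue
  have hCr : C.root = D.glue M T.root := rfl
  have hCh : C.hybrid = D.glue M T.hybrid := rfl
  have hCv : ∀ v, v ∈ C.verts ↔ ∃ w ∈ T.verts, D.glue M w = v := fun v => RootedCycle.mem_verts_map
  have hCs : ∀ P Q, C.IsSides P Q → ∃ P' Q', T.IsSides P' Q' ∧ P = P'.map (D.glue M) ∧
    Q = Q'.map (D.glue M) := fun P Q hPQ => RootedCycle.isSides_map hPQ
  have hCvr : ∀ v, v ∈ C.verts → v ≠ C.root → ∃ w ∈ T.verts, w ≠ T.root ∧ D.glue M w = v := by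
    intro v hv hvr
    obtain ⟨w, hw, rfl⟩ := (hCv v).1 hv
    exact ⟨w, hw, fun e => hvr (by rw [hCr, e]), rfl⟩
  have hsplit : ∀ (P' : List (D.W M)) (p : List D.Vert) w q, P'.map (D.glue M) = p ++ w :: q →
      ∃ p' w' q', P' = p' ++ w' :: q' ∧ w = D.glue M w' ∧ q = q'.map (D.glue M) ∧
        p = p'.map (D.glue M) := by
    intro P' p w q e
    obtain ⟨p', r, rfl, rfl, hr⟩ := List.map_eq_append_iff.1 e
    obtain ⟨w', q', rfl, rfl, rfl⟩ := List.map_eq_cons_iff.1 hr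
    exact ⟨p', w', q', rfl, rfl, rfl, rfl⟩
  refine ⟨C, B, ⟨?_, ?_, ?_, ?_, ?_, ?_, ?_, ?_, ?_, ?_, ?_, ?_, ?_, ?_⟩, rfl⟩
  · rw [hCr, ← hr, glue_root]
  · intro v
    constructor
    · rintro ⟨hv, hvr⟩
      obtain ⟨w, hw, hwr, rfl⟩ := hCvr v hv hvr
      have hwr' : w ≠ D.treeRoot M := fun e => hwr (e.trans hr)
      exact ⟨⟨w, hnl w hw, hwr'⟩, D.glue_inner (hnl w hw) hwr'⟩
    · rintro ⟨⟨w, hw, hwr⟩, rfl⟩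
      rw [← D.glue_inner hw hwr]
      refine ⟨(hCv _).2 ⟨w, (h.notMem_leaves_iff w).1 hw, rfl⟩, fun e => hwr ?_⟩
      exact (hinj e).trans hr.symm
  · intro P Q hPQ
    obtain ⟨P', Q', hPQ', rfl, rfl⟩ := hCs P Q hPQ
    simpa using h.side_ne_nil P' Q' hPQ'
  · intro P Q hPQ
    obtain ⟨P', Q', hPQ', rfl, rfl⟩ := hCs P Q hPQ
    rw [hCr, hCh, headD_map, headD_map, D.ch_glue (hnl _ hrv), h.children_root P' Q' hPQ',
      Set.image_pair]
  · intro P Q hPQ p w q e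
    obtain ⟨P', Q', hPQ', rfl, rfl⟩ := hCs P Q hPQ
    obtain ⟨p', w', q', rfl, rfl, rfl, rfl⟩ := hsplit _ _ _ _ e
    obtain ⟨hwv, hwr⟩ := hsv _ _ hPQ' w' (by simp)
    rw [hCh, headD_map, D.ch_glue (hnl _ hwv), h.children_side _ Q' hPQ' p' w' q' rfl,
      Set.image_pair, hB' w' hwv hwr]
  · rw [hCh, D.ch_glue (hnl _ hhv), h.children_hybrid, Set.image_singleton, hB' _ hhv hhr]
  · intro P Q hPQ w
    obtain ⟨P', Q', hPQ', rfl, rfl⟩ := hCs P Q hPQ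
    have h1 : D.network.Adj w C.hybrid ↔ ∃ w', (D.tree M).Adj w' T.hybrid ∧ D.glue M w' = w := by
      have := D.parents_glue (M := M) (w := T.hybrid) (by rw [hr]; exact hhr)
      exact Set.ext_iff.1 this w
    have h2 : ∀ R : List (D.W M), (∃ p, R.map (D.glue M) = p ++ [w]) ↔
        ∃ w', (∃ p, R = p ++ [w']) ∧ D.glue M w' = w := by
      intro R
      constructor
      · rintro ⟨p, e⟩
        obtain ⟨p', w', q', rfl, rfl, hq, rfl⟩ := hsplit _ _ _ _ e
        obtain rfl : q' = [] := by simpa using hq.symm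
        exact ⟨w', ⟨p', rfl⟩, rfl⟩
      · rintro ⟨w', ⟨p, rfl⟩, rfl⟩
        exact ⟨p.map (D.glue M), by simp⟩
    rw [h1, h2, h2]
    simp only [h.adj_hybrid_iff P' Q' hPQ', or_and_right, exists_or]
  · intro v hv hvh hvr
    obtain ⟨w, hw, hwr, rfl⟩ := hCvr v hv hvr
    rw [D.parents_glue (by rwa [hr])]
    exact (h.parents_subsingleton w fun e => hvh (by rw [hCh, e])).image _
  · intro v hv hvr
    obtain ⟨w, hw, hwr, rfl⟩ := hCvr v hv hvr
    rw [hB w hw hwr]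
    exact D.childMod_covBy _ _ _
  · intro v hv hvr z hz hzr e
    obtain ⟨w, hw, hwr, rfl⟩ := hCvr v hv hvr
    obtain ⟨y, hy, hyr, rfl⟩ := hCvr z hz hzr
    rw [hB w hw hwr, hB y hy hyr] at e
    rw [h.lf_inj w hw hwr y hy hyr (D.childMod_inj e)]
  · intro A hA
    obtain ⟨x, hx, rfl⟩ := D.exists_childMod_eq hA
    obtain ⟨w, hw, hwr, rfl⟩ := h.lf_surj x hx
    exact ⟨D.glue M w, (hCv _).2 ⟨w, hw, rfl⟩, fun e => hwr (hinj e), hB w hw hwr⟩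
  · intro P Q hPQ p w q e u hu a ha b hb
    obtain ⟨P', Q', hPQ', rfl, rfl⟩ := hCs P Q hPQ
    obtain ⟨p', w', q', rfl, rfl, rfl, rfl⟩ := hsplit _ _ _ _ e
    have hu2 : u ∈ (q' ++ [T.hybrid]).map (D.glue M) := by simpa [hCh] using hu
    obtain ⟨u', hu', rfl⟩ := List.mem_map.1 hu2
    obtain ⟨hwv, hwr⟩ := hsv _ _ hPQ' w' (by simp)
    have huv : u' ∈ T.verts ∧ u' ≠ T.root := by
      rcases List.mem_append.1 hu' with hq | hq
      · exact hsv _ _ hPQ' u' (by simp [hq])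
      · rw [List.mem_singleton.1 hq]
        exact ⟨hhv, hhr⟩
    have hne : w' ≠ u' := by
      rintro rfl
      have := hPQ'.nodup_path
      simp only [List.append_assoc, List.cons_append, List.nodup_cons, List.nodup_append] at this
      exact this.2.2.1.1 hu'
    rw [hadjB w' hwv hwr u' huv.1 huv.2 hne a ha b hb, D.label_glue (hnl _ hwv)]
    exact h.explained_adj_side _ hPQ' rfl hu' _ _
  · intro P Q hPQ w hw u hu a ha b hb
    obtain ⟨P', Q', hPQ', rfl, rfl⟩ := hCs P Q hPQ
    obtain ⟨w', hw', rfl⟩ := List.mem_map.1 hw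
    obtain ⟨u', hu', rfl⟩ := List.mem_map.1 hu
    obtain ⟨hwv, hwr⟩ := hsv _ _ hPQ' w' hw'
    obtain ⟨huv, hur⟩ := hsv _ _ hPQ'.symm u' hu'
    have hne : w' ≠ u' := by
      rintro rfl
      exact hPQ'.disjoint hw' hu'
    rw [hadjB w' hwv hwr u' huv hur hne a ha b hb, hCr, D.label_glue (hnl _ hrv)]
    exact h.explained_adj_cross _ hPQ' hw' hu' _ _
  · intro v hv
    obtain ⟨w, hw, rfl⟩ := (hCv v).1 hv
    rw [D.label_glue (hnl w hw)]
    exact fun e => hnl w hw ((D.labeling M w).1 e)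

theorem exists_isCycleAt (M : PrimeMod G) : ∃ C B, D.IsCycleAt M C B := by
  obtain ⟨T, lf, h, hr⟩ := D.exists_isPendantCycle M
  obtain ⟨C, B, hC, -⟩ := D.exists_isCycleAt_of_isPendantCycle h hr
  exact ⟨C, B, hC⟩

/-- Two directed paths that end in the same vertex and avoid vertices with several parents are
comparable. -/
theorem suffix_or_suffix_of_isChain {W : Type*} {N : Digraph W} {S : Set W}
    (hS : ∀ v ∈ S, (parents N v).Subsingleton) (l l' : List W) (c : W)
    (hl : List.IsChain N.Adj (l ++ [c])) (hl' : List.IsChain N.Adj (l' ++ [c]))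
    (hlS : ∀ v ∈ (l ++ [c]).tail, v ∈ S) : l <:+ l' ∨ l' <:+ l := by
  induction l using List.reverseRecOn generalizing l' c with
  | nil => exact Or.inl (List.nil_suffix)
  | append_singleton l d ih =>
    rcases List.eq_nil_or_concat l' with rfl | ⟨l', d', rfl⟩
    · exact Or.inr (List.nil_suffix)
    · rw [List.concat_eq_append] at hl' ⊢
      have h1 : N.Adj d c := rel_of_pair_infix hl ⟨l, [], by simp⟩
      have h2 : N.Adj d' c := rel_of_pair_infix hl' ⟨l', [], by simp⟩
      obtain rfl := hS c (hlS c (by cases l <;> simp)) h1 h2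
      rcases ih l' d hl.left_of_append hl'.left_of_append
        (fun v hv => hlS v (by cases l <;> simp at hv ⊢; tauto)) with ⟨s, rfl⟩ | ⟨s, rfl⟩
      · exact Or.inl ⟨s, by simp⟩
      · exact Or.inr ⟨s, by simp⟩

theorem eq_of_cons_suffix_cons {α : Type*} {a : α} {l l' : List α} (h : a :: l <:+ a :: l')
    (hl' : (a :: l').Nodup) : l = l' := by
  obtain ⟨s, hs⟩ := h
  exact (eq_of_nodup_append_cons hl' hs.symm (s' := []) rfl).2

/-- Every rooted cycle of the network is the cycle below a prime module. -/
theorem exists_isCycleAt_of_rootedCycle (C' : RootedCycle D.network) :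
    ∃ M B, D.IsCycleAt M C' B := by
  have hs' := C'.isSides_self
  -- `c₁` and `c₂` are the last vertices of the two sides before the hybrid-vertex; an empty side
  -- would give the root.
  obtain ⟨l₁, c₁, hl₁⟩ : ∃ l c, C'.root :: C'.inner₁ = l ++ [c] :=
    ⟨_, _, (List.dropLast_append_getLast (List.cons_ne_nil _ _)).symm⟩
  obtain ⟨l₂, c₂, hl₂⟩ : ∃ l c, C'.root :: C'.inner₂ = l ++ [c] :=
    ⟨_, _, (List.dropLast_append_getLast (List.cons_ne_nil _ _)).symm⟩
  have hpath₁ : List.IsChain D.network.Adj ((l₁ ++ [c₁]) ++ [C'.hybrid]) := by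
    rw [← hl₁]
    exact C'.path₁
  have hpath₂ : List.IsChain D.network.Adj ((l₂ ++ [c₂]) ++ [C'.hybrid]) := by
    rw [← hl₂]
    exact C'.path₂
  have hadj₁ : D.network.Adj c₁ C'.hybrid := rel_of_pair_infix hpath₁ ⟨l₁, [], by simp⟩
  have hadj₂ : D.network.Adj c₂ C'.hybrid := rel_of_pair_infix hpath₂ ⟨l₂, [], by simp⟩
  have hm₁ : c₁ = C'.root ∧ C'.inner₁ = [] ∨ c₁ ∈ C'.inner₁ := by
    rcases l₁ with _ | ⟨a, l₁⟩ <;> simp at hl₁ <;> simp [hl₁]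
  have hm₂ : c₂ = C'.root ∧ C'.inner₂ = [] ∨ c₂ ∈ C'.inner₂ := by
    rcases l₂ with _ | ⟨a, l₂⟩ <;> simp at hl₂ <;> simp [hl₂]
  -- A common vertex can only be the root, and then both sides would be empty. Thus the end of `C'`
  -- has two parents and is the hybrid-vertex of some galled-tree.
  have hne : c₁ ≠ c₂ := by
    rintro rfl
    rcases hm₁ with h1 | h1 <;> rcases hm₂ with h2 | h2
    · exact C'.nontrivial.elim (fun h => h h1.2) (fun h => h h2.2)
    · exact hs'.symm.root_notMem (h1.1 ▸ h2)
    · exact hs'.root_notMem (h2.1 ▸ h1)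
    · exact hs'.disjoint h1 h2
  rcases D.parents_subsingleton_or C'.hybrid with hsub | ⟨M, T, lf, hT, hr, hh⟩
  · exact absurd (hsub hadj₁ hadj₂) hne
  obtain ⟨C, B, hC, hCh⟩ := D.exists_isCycleAt_of_isPendantCycle hT hr
  have hh' : C'.hybrid = C.hybrid := hh.trans hCh.symm
  refine ⟨M, B, ?_⟩
  rw [hh', hC.adj_hybrid_iff _ _ C.isSides_self] at hadj₁ hadj₂
  obtain ⟨P, Q, hPQ, p, hp, q, hq⟩ : ∃ P Q, C.IsSides P Q ∧ ∃ p, P = p ++ [c₁] ∧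
      ∃ q, Q = q ++ [c₂] := by
    rcases hadj₁ with ⟨p, hp⟩ | ⟨p, hp⟩ <;> rcases hadj₂ with ⟨q, hq⟩ | ⟨q, hq⟩
    · exact absurd (by simpa using (congrArg List.getLast? (hp.symm.trans hq))) hne
    · exact ⟨_, _, C.isSides_self, p, hp, q, hq⟩
    · exact ⟨_, _, C.isSides_self.symm, p, hp, q, hq⟩
    · exact absurd (by simpa using (congrArg List.getLast? (hp.symm.trans hq))) hne
  let S : Set D.Vert := {v | v ∈ C.verts ∧ v ≠ C.hybrid ∧ v ≠ C.root}
  have hS : ∀ v ∈ S, (parents D.network v).Subsingleton := fun v hv =>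
    hC.parents_subsingleton v hv.1 hv.2.1 hv.2.2
  -- Followed upwards from their common last vertex, the two paths agree as long as parents are
  -- unique, so one is a suffix of the other.
  have comp : ∀ P Q, C.IsSides P Q → ∀ P' Q', C'.IsSides P' Q' → ∀ p l c, P = p ++ [c] →
      C'.root :: P' = l ++ [c] → (C.root :: P <:+ C'.root :: P' ∨ C'.root :: P' <:+ C.root :: P) := by
    intro P Q hPQ P' Q' hPQ' p l c hP hP'
    have hmem : ∀ v ∈ p ++ [c], v ∈ S := by
      intro v hv
      rw [← hP] at hv
      exact ⟨hPQ.mem_verts.2 (Or.inr (Or.inr (Or.inl hv))), fun e => hPQ.hybrid_notMem (e ▸ hv),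
        fun e => hPQ.root_notMem (e ▸ hv)⟩
    have hc1 : List.IsChain D.network.Adj (C.root :: p ++ [c]) := by
      have := hPQ.path
      rw [hP] at this
      exact List.IsChain.left_of_append (l₂ := [C.hybrid]) (by simpa using this)
    have hc2 : List.IsChain D.network.Adj (l ++ [c]) := by
      have := hPQ'.path
      rw [← List.cons_append, hP'] at this
      exact this.left_of_append
    rcases suffix_or_suffix_of_isChain hS (C.root :: p) l c hc1 hc2 hmem with ⟨s, hs⟩ | ⟨s, hs⟩
    · left
      rw [hP', hP]
      exact ⟨s, by rw [← hs]; simp⟩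
    · right
      rw [hP', hP]
      exact ⟨s, by rw [← List.append_assoc, hs]; simp⟩
  have comp₁ := comp P Q hPQ _ _ hs' p l₁ c₁ hp hl₁
  have comp₂ := comp Q P hPQ.symm _ _ hs'.symm q l₂ c₂ hq hl₂
  -- Vertices inside a side of `C` have smaller rank than `C.root`, and rank never increases along a
  -- path. So a root of `C'` inside a side of `C` has no path to `C.root`.
  have hdown : ∀ P Q, C.IsSides P Q → C'.root ∈ P → ∀ P' Q', C'.IsSides P' Q' →
      C.root ∉ C'.root :: P' := by
    intro P Q hPQ hP P' Q' hPQ' hmem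
    obtain ⟨w, hw⟩ := (hC.mem_iff C'.root).1 ⟨hPQ.mem_verts.2 (Or.inr (Or.inr (Or.inl hP))),
      fun e => hPQ.root_notMem (e ▸ hP)⟩
    have hanc : Anc D.network C'.root C.root := by
      rcases List.mem_cons.1 hmem with e | e
      · rw [e]
        exact Relation.ReflTransGen.refl
      · exact (transGen_of_isChain_cons hPQ'.path (List.mem_append_left _ e)).to_reflTransGen
    have hle := D.rank_le_of_anc hanc
    rw [hw, hC.root_eq] at hle
    simp only [rank] at hle
    have := M.1.nonempty.card_pos
    omega
  -- Otherwise each pair of matching sides puts one root inside a side of the other cycle. If it is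
  -- the same root for both pairs, it lies on two disjoint sides; if not, `hdown` is violated.
  have hroot : C'.root = C.root := by
    by_contra hcon
    have step : ∀ P Q, C.IsSides P Q → ∀ P' Q', C'.IsSides P' Q' →
        (C.root :: P <:+ C'.root :: P' ∨ C'.root :: P' <:+ C.root :: P) →
        C.root ∈ P' ∨ C'.root ∈ P := by
      intro P Q hPQ P' Q' hPQ' h
      rcases h with h | h
      · exact Or.inl ((List.mem_cons.1 (h.subset (by simp))).resolve_left fun e => hcon e.symm)
      · exact Or.inr ((List.mem_cons.1 (h.subset (by simp))).resolve_left hcon)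
    rcases step _ _ hPQ _ _ hs' comp₁ with h1 | h1
    · rcases step _ _ hPQ.symm _ _ hs'.symm comp₂ with h2 | h2
      · exact hs'.disjoint h1 h2
      · exact hdown _ _ hPQ.symm h2 _ _ hs' (List.mem_cons_of_mem _ h1)
    · rcases step _ _ hPQ.symm _ _ hs'.symm comp₂ with h2 | h2
      · exact hdown _ _ hPQ h1 _ _ hs'.symm (List.mem_cons_of_mem _ h2)
      · exact hPQ.disjoint h1 h2
  have heq : ∀ P Q, C.IsSides P Q → ∀ P' Q', C'.IsSides P' Q' →
      (C.root :: P <:+ C'.root :: P' ∨ C'.root :: P' <:+ C.root :: P) → P' = P := by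
    intro P Q hPQ P' Q' hPQ' h
    have h1 : (C.root :: P).Nodup := List.nodup_cons.2 ⟨hPQ.root_notMem, hPQ.nodup_left⟩
    have h2 : (C'.root :: P').Nodup := List.nodup_cons.2 ⟨hPQ'.root_notMem, hPQ'.nodup_left⟩
    rw [hroot] at h h2
    rcases h with h | h
    · exact (eq_of_cons_suffix_cons h h2).symm
    · exact eq_of_cons_suffix_cons h h1
  have e₁ := heq _ _ hPQ _ _ hs' comp₁
  have e₂ := heq _ _ hPQ.symm _ _ hs'.symm comp₂
  refine IsCycleAt.congr D hC hroot hh' ?_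
  rintro P' Q' (⟨rfl, rfl⟩ | ⟨rfl, rfl⟩)
  · rw [e₁, e₂]
    exact hPQ
  · rw [e₁, e₂]
    exact hPQ.symm

end PvrNetwork

end Gatex

/-! ### Leaves below a vertex and clique numbers along a cycle -/

namespace Gatex

namespace PvrNetwork

variable {V : Type u} [Fintype V] {G : SimpleGraph V} (D : PvrNetwork.{u, v} G)

/-- The leaves that are reached from `v` by a directed path whose vertices other than `v` lie
in `a`. -/
def reach (a : Set D.Vert) (v : D.Vert) : Set V :=
  {x | Relation.ReflTransGen (fun y z => D.network.Adj y z ∧ z ∈ a) v (D.leafVert x)}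

theorem leavesBelow_eq_reach (v : D.Vert) : D.leavesBelow v = D.reach Set.univ v := by
  simp [leavesBelow, reach, Anc]

theorem leafVert_injective : Function.Injective D.leafVert := by
  intro x y h
  have := congrArg Subtype.val (Sum.inl.inj h)
  exact Finset.singleton_injective this

theorem ch_inl_eq_empty {A : StrongMod G} (hA : A.1.card = 1) : D.ch (Sum.inl A) = ∅ := by
  have hl := mdLabel_eq_leaf_iff.2 hA
  rw [D.ch_inl (by rw [hl]; simp)]
  ext b
  simp only [Set.mem_image, Set.mem_empty_iff_false, iff_false]
  rintro ⟨B, hB, -⟩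
  exact card_ne_one_of_covBy hB hA

theorem reach_inl_of_card {A : StrongMod G} (hA : A.1.card = 1) (a : Set D.Vert) :
    D.reach a (Sum.inl A) = (A.1 : Set V) := by
  obtain ⟨x, hx⟩ := Finset.card_eq_one.1 hA
  have hAx : (Sum.inl A : D.Vert) = D.leafVert x := congrArg Sum.inl (Subtype.ext hx)
  ext y
  simp only [hx, Finset.coe_singleton, Set.mem_singleton_iff]
  constructor
  · intro hy
    rcases Relation.ReflTransGen.cases_head hy with e | ⟨b, hb, -⟩
    · exact (D.leafVert_injective (hAx.symm.trans e)).symm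
    · have : b ∈ D.ch (Sum.inl A) := hb.1
      rw [D.ch_inl_eq_empty hA] at this
      exact absurd this (Set.notMem_empty b)
  · rintro rfl
    rw [hAx]
    exact Relation.ReflTransGen.refl

/-- The condition on `v` says that `v` is not itself a leaf, so a path from `v` to a leaf has a
first edge. -/
theorem reach_eq_iUnion {v : D.Vert} (hv : ∀ A, v = Sum.inl A → A.1.card ≠ 1) (a : Set D.Vert) :
    D.reach a v = ⋃ c ∈ D.ch v ∩ a, D.reach a c := by
  ext y
  simp only [Set.mem_iUnion, exists_prop]
  constructor
  · intro hy
    rcases Relation.ReflTransGen.cases_head hy with e | ⟨b, hb, hby⟩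
    · exact absurd (Finset.card_singleton y) (hv _ e)
    · exact ⟨b, hb, hby⟩
  · rintro ⟨c, hc, hy⟩
    exact Relation.ReflTransGen.head hc hy

theorem reach_inr (p) (a : Set D.Vert) :
    D.reach a (Sum.inr p) = ⋃ c ∈ D.ch (Sum.inr p) ∩ a, D.reach a c :=
  D.reach_eq_iUnion (by simp) a

theorem card_ne_one_of_prime (M : PrimeMod G) : M.1.1.card ≠ 1 := by
  intro h
  have := mdLabel_eq_leaf_iff.2 h
  rw [M.2] at this
  cases this

/-- The union of the modules attached to the vertices in `q`. -/
def sideSet (B : D.Vert → StrongMod G) (q : List D.Vert) : Set V := {x | ∃ w ∈ q, x ∈ (B w).1}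

/-- The union of the modules attached to the vertices in `q` with label `1`. -/
def oneSet (B : D.Vert → StrongMod G) (q : List D.Vert) : Set V :=
  {x | ∃ w ∈ q, D.label w = NLabel.one ∧ x ∈ (B w).1}

variable {B : D.Vert → StrongMod G}

theorem sideSet_nil : D.sideSet B [] = ∅ := by simp [sideSet]

theorem sideSet_cons (w : D.Vert) (q : List D.Vert) :
    D.sideSet B (w :: q) = D.sideSet B q ∪ (B w).1 := by
  ext x
  constructor
  · rintro ⟨u, hu, hx⟩
    rcases List.mem_cons.1 hu with rfl | hu
    · exact Or.inr hx
    · exact Or.inl ⟨u, hu, hx⟩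
  · rintro (⟨u, hu, hx⟩ | hx)
    · exact ⟨u, List.mem_cons_of_mem _ hu, hx⟩
    · exact ⟨w, List.mem_cons_self, hx⟩

theorem oneSet_subset (q : List D.Vert) : D.oneSet B q ⊆ D.sideSet B q :=
  fun _ ⟨w, hw, _, hx⟩ => ⟨w, hw, hx⟩

theorem oneSet_cons_of_eq {w : D.Vert} (hw : D.label w = NLabel.one) (q : List D.Vert) :
    D.oneSet B (w :: q) = D.oneSet B q ∪ (B w).1 := by
  ext x
  constructor
  · rintro ⟨u, hu, hl, hx⟩
    rcases List.mem_cons.1 hu with rfl | hu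
    · exact Or.inr hx
    · exact Or.inl ⟨u, hu, hl, hx⟩
  · rintro (⟨u, hu, hl, hx⟩ | hx)
    · exact ⟨u, List.mem_cons_of_mem _ hu, hl, hx⟩
    · exact ⟨w, List.mem_cons_self, hw, hx⟩

theorem oneSet_cons_of_ne {w : D.Vert} (hw : D.label w ≠ NLabel.one) (q : List D.Vert) :
    D.oneSet B (w :: q) = D.oneSet B q := by
  ext x
  simp [oneSet, hw]

variable {D}

namespace IsCycleAt

variable {M : PrimeMod G} {C : RootedCycle D.network} {P Q p q : List D.Vert} {w : D.Vert}

section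

variable (h : D.IsCycleAt M C B) (hPQ : C.IsSides P Q)
include h

include hPQ

omit h in
theorem headD_mem (hP : P = p ++ q) : q.headD C.hybrid ∈ C.verts ∧ q.headD C.hybrid ≠ C.root := by
  cases q with
  | nil => exact C.hybrid_mem
  | cons w q => exact hPQ.side_mem (by simp [hP])

/-- The hybrid module appears twice so that each half is the leaf set below one child of the root.
-/
theorem coe_eq :
    (M.1.1 : Set V) = (D.sideSet B P ∪ (B C.hybrid).1) ∪ (D.sideSet B Q ∪ (B C.hybrid).1) := by
  ext x
  constructor
  · intro hx
    obtain ⟨A, hA, hxA⟩ := StrongMod.exists_covBy_mem (card_ne_one_of_prime M) hx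
    obtain ⟨v, hv, hvr, rfl⟩ := h.surj A hA
    rcases hPQ.mem_verts.1 hv with e | rfl | e | e
    · exact absurd e hvr
    · exact Or.inl (Or.inr hxA)
    · exact Or.inl (Or.inl ⟨v, e, hxA⟩)
    · exact Or.inr (Or.inl ⟨v, e, hxA⟩)
  · have hB : ∀ v, v ∈ C.verts ∧ v ≠ C.root → x ∈ (B v).1 → x ∈ M.1.1 := fun v hv hx =>
      (h.covBy v hv.1 hv.2).le hx
    rintro ((⟨w, hw, hx⟩ | hx) | (⟨w, hw, hx⟩ | hx))
    · exact hB w (hPQ.side_mem hw) hx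
    · exact hB _ C.hybrid_mem hx
    · exact hB w (hPQ.symm.side_mem hw) hx
    · exact hB _ C.hybrid_mem hx

omit hPQ in
theorem reach_of_mem {a : Set D.Vert} {v : D.Vert} (hv : v ∈ C.verts ∧ v ≠ C.root) :
    D.reach a v = ⋃ c ∈ D.ch v ∩ a, D.reach a c := by
  obtain ⟨w, rfl⟩ := (h.mem_iff v).1 hv
  exact D.reach_inr _ a

omit hPQ in
theorem leavesBelow_hybrid
    (hL : ∀ A : StrongMod G, A ⋖ M.1 → D.leavesBelow (Sum.inl A) = (A.1 : Set V)) :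
    D.leavesBelow C.hybrid = (B C.hybrid).1 := by
  rw [leavesBelow_eq_reach, h.reach_of_mem C.hybrid_mem, h.ch_hybrid]
  simp only [Set.inter_univ, Set.mem_singleton_iff, Set.iUnion_iUnion_eq_left]
  rw [← leavesBelow_eq_reach, hL _ (h.covBy _ C.hybrid_mem.1 C.hybrid_mem.2)]

/-- `hL` is the induction hypothesis of `leavesBelow_inl`, which is proved through this lemma. -/
theorem leavesBelow_headD
    (hL : ∀ A : StrongMod G, A ⋖ M.1 → D.leavesBelow (Sum.inl A) = (A.1 : Set V))
    (hP : P = p ++ q) :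
    D.leavesBelow (q.headD C.hybrid) = D.sideSet B q ∪ (B C.hybrid).1 := by
  induction q generalizing p with
  | nil => simp [sideSet_nil, h.leavesBelow_hybrid hL]
  | cons w q ih =>
    have hw := hPQ.side_mem (w := w) (by simp [hP])
    rw [List.headD_cons, leavesBelow_eq_reach, h.reach_of_mem hw,
      h.ch_side P Q hPQ p w q hP, Set.inter_univ, Set.biUnion_pair, ← leavesBelow_eq_reach,
      ← leavesBelow_eq_reach, hL _ (h.covBy w hw.1 hw.2), sideSet_cons,
      ih (p := p ++ [w]) (by simp [hP])]
    ext x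
    simp only [Set.mem_union]
    tauto

omit hPQ in
theorem leavesBelow_root
    (hL : ∀ A : StrongMod G, A ⋖ M.1 → D.leavesBelow (Sum.inl A) = (A.1 : Set V)) :
    D.leavesBelow (Sum.inl M.1) = (M.1.1 : Set V) := by
  have hPQ := C.isSides_self
  rw [leavesBelow_eq_reach, D.reach_eq_iUnion, ← h.root_eq, h.ch_root _ _ hPQ, Set.inter_univ,
    Set.biUnion_pair, ← leavesBelow_eq_reach, ← leavesBelow_eq_reach,
    h.leavesBelow_headD hPQ hL (p := []) rfl, h.leavesBelow_headD hPQ.symm hL (p := []) rfl,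
    h.coe_eq hPQ]
  rintro A e
  rw [← Sum.inl.inj e]
  exact card_ne_one_of_prime M

end

end IsCycleAt

variable (D) in
theorem leavesBelow_inl (A : StrongMod G) : D.leavesBelow (Sum.inl A) = (A.1 : Set V) := by
  induction A using WellFoundedLT.induction with
  | ind A ih =>
    by_cases hc : A.1.card = 1
    · rw [leavesBelow_eq_reach, D.reach_inl_of_card hc]
    by_cases hp : mdLabel G A = MDLabel.prime
    · obtain ⟨C, B, hC⟩ := D.exists_isCycleAt ⟨A, hp⟩
      exact hC.leavesBelow_root fun B hB => ih B hB.lt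
    · rw [leavesBelow_eq_reach, D.reach_eq_iUnion (by rintro _ ⟨⟩; exact hc), D.ch_inl hp,
        Set.inter_univ, Set.biUnion_image, StrongMod.iUnion_covBy hc]
      refine Set.iUnion₂_congr fun B hB => ?_
      rw [← leavesBelow_eq_reach, ih B hB.lt]

namespace IsCycleAt

variable {M : PrimeMod G} {C : RootedCycle D.network} {P Q p q : List D.Vert} {w : D.Vert}
variable (h : D.IsCycleAt M C B) (hPQ : C.IsSides P Q)
include h

omit hPQ in
theorem disjoint_mod {v w : D.Vert} (hv : v ∈ C.verts ∧ v ≠ C.root)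
    (hw : w ∈ C.verts ∧ w ≠ C.root) (hvw : v ≠ w) {x : V} (hx : x ∈ (B v).1) : x ∉ (B w).1 :=
  fun hx' => hvw (h.inj v hv.1 hv.2 w hw.1 hw.2
    (StrongMod.eq_of_covBy_of_mem (h.covBy v hv.1 hv.2) (h.covBy w hw.1 hw.2) hx hx'))

include hPQ

omit hPQ in
theorem label_eq_zero_or_one (hw : w ∈ C.verts) :
    D.label w = NLabel.zero ∨ D.label w = NLabel.one := by
  have := h.label_ne_leaf w hw
  cases hl : D.label w <;> simp_all

theorem adj_iff_of_mem_sideSet (hP : P = p ++ w :: q) {a b : V}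
    (ha : a ∈ D.sideSet B q ∪ (B C.hybrid).1) (hb : b ∈ (B w).1) :
    G.Adj a b ↔ D.label w = NLabel.one := by
  rw [G.adj_comm]
  rcases ha with ⟨u, hu, ha⟩ | ha
  · exact h.adj_side P Q hPQ p w q hP u (List.mem_append_left _ hu) b hb a ha
  · exact h.adj_side P Q hPQ p w q hP C.hybrid (by simp) b hb a ha

/-- The set `S` is kept arbitrary so that one statement serves $\omega$ (with the hybrid module) and
$\omega_{\neg\eta}$ (without it). -/
theorem cliqueNum_cons_zero (hP : P = p ++ w :: q) (hw : D.label w = NLabel.zero) {S : Set V}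
    (hS : S ⊆ D.sideSet B q ∪ (B C.hybrid).1) :
    (G.induce (S ∪ (B w).1)).cliqueNum =
      max (G.induce S).cliqueNum (G.induce ((B w).1 : Set V)).cliqueNum := by
  apply cliqueNum_induce_sep
  intro a ha b hb
  rw [h.adj_iff_of_mem_sideSet hPQ hP (hS ha) hb, hw]
  simp

theorem cliqueNum_cons_one (hP : P = p ++ w :: q) (hw : D.label w = NLabel.one) {S : Set V}
    (hS : S ⊆ D.sideSet B q ∪ (B C.hybrid).1) :
    (G.induce (S ∪ (B w).1)).cliqueNum =
      (G.induce S).cliqueNum + (G.induce ((B w).1 : Set V)).cliqueNum :=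
  cliqueNum_induce_join fun _ ha _ hb => (h.adj_iff_of_mem_sideSet hPQ hP (hS ha) hb).2 hw

theorem adj_hybrid_of_mem_oneSet {a b : V} (ha : a ∈ D.oneSet B P) (hb : b ∈ (B C.hybrid).1) :
    G.Adj a b := by
  obtain ⟨w, hw, hl, ha⟩ := ha
  obtain ⟨p, q, rfl⟩ := List.append_of_mem hw
  exact (h.adj_side _ Q hPQ p w q rfl C.hybrid (by simp) a ha b hb).2 hl

theorem mem_oneSet_of_adj_hybrid {a b : V} (ha : a ∈ D.sideSet B P) (hb : b ∈ (B C.hybrid).1)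
    (hab : G.Adj a b) : a ∈ D.oneSet B P := by
  obtain ⟨w, hw, ha⟩ := ha
  obtain ⟨p, q, rfl⟩ := List.append_of_mem hw
  exact ⟨w, hw, (h.adj_side _ Q hPQ p w q rfl C.hybrid (by simp) a ha b hb).1 hab, ha⟩

theorem adj_cross_iff {a b : V} (ha : a ∈ D.sideSet B P) (hb : b ∈ D.sideSet B Q) :
    G.Adj a b ↔ D.label C.root = NLabel.one := by
  obtain ⟨w, hw, ha⟩ := ha
  obtain ⟨u, hu, hb⟩ := hb
  exact h.adj_cross P Q hPQ w hw u hu a ha b hb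

/-- A clique meeting the module of the hybrid-vertex only meets modules at vertices labeled `1`. -/
theorem cliqueNum_side_union_hybrid :
    (G.induce (D.sideSet B P ∪ (B C.hybrid).1)).cliqueNum =
      max (G.induce (D.sideSet B P)).cliqueNum
        ((G.induce (D.oneSet B P)).cliqueNum +
          (G.induce ((B C.hybrid).1 : Set V)).cliqueNum) := by
  rw [← cliqueNum_induce_join fun a ha b hb => h.adj_hybrid_of_mem_oneSet hPQ ha hb]
  apply le_antisymm
  · apply cliqueNum_induce_le_of_forall
    intro K hK hc
    -- If `K` meets the hybrid module in `b`, its side vertices are adjacent to `b` and so lie in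
    -- modules at label 1; if not, `K` lies in the side alone.
    by_cases hb : ∃ b ∈ K, b ∈ (B C.hybrid).1
    · obtain ⟨b, hbK, hb⟩ := hb
      refine (ncard_le_cliqueNum_induce (fun a ha => ?_) hc).trans (le_max_right _ _)
      rcases hK ha with ha' | ha'
      · by_cases hab : a = b
        · exact Or.inr (hab ▸ hb)
        · exact Or.inl (h.mem_oneSet_of_adj_hybrid hPQ ha' hb (hc ha hbK hab))
      · exact Or.inr ha'
    · push Not at hb
      exact (ncard_le_cliqueNum_induce (fun a ha => (hK ha).resolve_right (hb a ha)) hc).trans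
        (le_max_left _ _)
  · exact max_le (cliqueNum_induce_mono Set.subset_union_left)
      (cliqueNum_induce_mono (Set.union_subset_union_left _ (D.oneSet_subset P)))

/-- There are no edges between the two sides, so a clique meeting the modules of `P` avoids those of
`Q`. -/
theorem cliqueNum_root_zero (hr : D.label C.root = NLabel.zero) :
    (G.induce (M.1.1 : Set V)).cliqueNum =
      max (G.induce (D.sideSet B P ∪ (B C.hybrid).1)).cliqueNum
        (G.induce (D.sideSet B Q ∪ (B C.hybrid).1)).cliqueNum := by
  rw [h.coe_eq hPQ]
  apply le_antisymm
  · apply cliqueNum_induce_le_of_forall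
    intro K hK hc
    by_cases ha : ∃ a ∈ K, a ∈ D.sideSet B P
    · obtain ⟨a, haK, ha⟩ := ha
      refine (ncard_le_cliqueNum_induce (fun b hb => ?_) hc).trans (le_max_left _ _)
      rcases hK hb with hb' | hb' | hb'
      · exact hb'
      · by_cases hab : a = b
        · exact Or.inl (hab ▸ ha)
        · have := (h.adj_cross_iff hPQ ha hb').1 (hc haK hb hab)
          rw [hr] at this
          cases this
      · exact Or.inr hb'
    · push Not at ha
      refine (ncard_le_cliqueNum_induce (fun b hb => ?_) hc).trans (le_max_right _ _)
      rcases hK hb with (hb' | hb') | hb'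
      · exact absurd hb' (ha b hb)
      · exact Or.inr hb'
      · exact hb'
  · exact max_le (cliqueNum_induce_mono Set.subset_union_left)
      (cliqueNum_induce_mono Set.subset_union_right)

theorem cliqueNum_sides (hr : D.label C.root = NLabel.one) :
    (G.induce (D.sideSet B P ∪ D.sideSet B Q)).cliqueNum =
      (G.induce (D.sideSet B P)).cliqueNum + (G.induce (D.sideSet B Q)).cliqueNum :=
  cliqueNum_induce_join fun _ ha _ hb => (h.adj_cross_iff hPQ ha hb).2 hr

theorem cliqueNum_ones (hr : D.label C.root = NLabel.one) :
    (G.induce ((D.oneSet B P ∪ D.oneSet B Q) ∪ (B C.hybrid).1)).cliqueNum =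
      (G.induce (D.oneSet B P)).cliqueNum + (G.induce (D.oneSet B Q)).cliqueNum +
        (G.induce ((B C.hybrid).1 : Set V)).cliqueNum := by
  rw [cliqueNum_induce_join, cliqueNum_induce_join]
  · exact fun a ha b hb =>
      (h.adj_cross_iff hPQ (D.oneSet_subset P ha) (D.oneSet_subset Q hb)).2 hr
  · rintro a (ha | ha) b hb
    · exact h.adj_hybrid_of_mem_oneSet hPQ ha hb
    · exact h.adj_hybrid_of_mem_oneSet hPQ.symm ha hb

/-- Cliques are sorted by whether they meet the hybrid module. If they do, only modules at label 1
remain on both sides; if not, the two sides are simply joined. -/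
theorem cliqueNum_root_one (hr : D.label C.root = NLabel.one) :
    (G.induce (M.1.1 : Set V)).cliqueNum =
      max ((G.induce (D.sideSet B P)).cliqueNum + (G.induce (D.sideSet B Q)).cliqueNum)
        ((G.induce (D.oneSet B P)).cliqueNum + (G.induce (D.oneSet B Q)).cliqueNum +
          (G.induce ((B C.hybrid).1 : Set V)).cliqueNum) := by
  rw [← h.cliqueNum_sides hPQ hr, ← h.cliqueNum_ones hPQ hr, h.coe_eq hPQ]
  apply le_antisymm
  · apply cliqueNum_induce_le_of_forall
    intro K hK hc
    by_cases hb : ∃ b ∈ K, b ∈ (B C.hybrid).1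
    · obtain ⟨b, hbK, hb⟩ := hb
      refine (ncard_le_cliqueNum_induce (fun a ha => ?_) hc).trans (le_max_right _ _)
      by_cases hab : a = b
      · exact Or.inr (hab ▸ hb)
      rcases hK ha with (ha' | ha') | (ha' | ha')
      · exact Or.inl (Or.inl (h.mem_oneSet_of_adj_hybrid hPQ ha' hb (hc ha hbK hab)))
      · exact Or.inr ha'
      · exact Or.inl (Or.inr (h.mem_oneSet_of_adj_hybrid hPQ.symm ha' hb (hc ha hbK hab)))
      · exact Or.inr ha'
    · push Not at hb
      refine (ncard_le_cliqueNum_induce (fun a ha => ?_) hc).trans (le_max_left _ _)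
      rcases hK ha with (ha' | ha') | (ha' | ha')
      · exact Or.inl ha'
      · exact absurd ha' (hb a ha)
      · exact Or.inr ha'
      · exact absurd ha' (hb a ha)
  · apply max_le
    · apply cliqueNum_induce_mono
      exact Set.union_subset_union Set.subset_union_left Set.subset_union_left
    · apply cliqueNum_induce_mono
      rintro x ((hx | hx) | hx)
      · exact Or.inl (Or.inl (D.oneSet_subset P hx))
      · exact Or.inr (Or.inl (D.oneSet_subset Q hx))
      · exact Or.inl (Or.inr hx)

/-- The value that the algorithm assigns to the root of a cycle with label `1`. -/
theorem cliqueNum_root_one_eq_max (hr : D.label C.root = NLabel.one) :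
    ((G.induce (M.1.1 : Set V)).cliqueNum : ℤ) =
      max (((G.induce (D.sideSet B P ∪ (B C.hybrid).1)).cliqueNum : ℤ) +
          (G.induce (D.sideSet B Q ∪ (B C.hybrid).1)).cliqueNum -
          (G.induce ((B C.hybrid).1 : Set V)).cliqueNum)
        (((G.induce (D.sideSet B P)).cliqueNum : ℤ) + (G.induce (D.sideSet B Q)).cliqueNum) := by
  rw [h.cliqueNum_root_one hPQ hr, h.cliqueNum_side_union_hybrid hPQ,
    h.cliqueNum_side_union_hybrid hPQ.symm]
  push_cast
  have h1 := cliqueNum_induce_mono (G := G) (D.oneSet_subset (B := B) P)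
  have h2 := cliqueNum_induce_mono (G := G) (D.oneSet_subset (B := B) Q)
  -- If only one of the side maxima uses the hybrid module, the first term is at most the second by
  -- `h1` or `h2`; if neither does, it is the second minus the hybrid value; if both do, it is the
  -- sum over the label-1 parts plus one hybrid value.
  omega

end IsCycleAt

end PvrNetwork

end Gatex

/-! ### Loops and the values computed on one side of a cycle -/

namespace Gatex

section LoopLemmas

variable {α : Type*} {S : Type*} {body : α → S → S → Prop}

theorem Loop.append_iff {l l' : List α} {s s' : S} :
    Loop body (l ++ l') s s' ↔ ∃ a, Loop body l s a ∧ Loop body l' a s' := by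
  induction l generalizing s with
  | nil =>
    constructor
    · exact fun h => ⟨s, Loop.nil s, h⟩
    · rintro ⟨a, h, h'⟩
      cases h
      exact h'
  | cons b l ih =>
    constructor
    · intro h
      cases h with
      | cons hb hl =>
        obtain ⟨a, h1, h2⟩ := ih.1 hl
        exact ⟨a, Loop.cons hb h1, h2⟩
    · rintro ⟨a, h, h'⟩
      cases h with
      | cons hb hl => exact Loop.cons hb (ih.2 ⟨a, hl, h'⟩)

theorem Loop.singleton_iff {a : α} {s s' : S} : Loop body [a] s s' ↔ body a s s' := by
  constructor
  · intro h
    cases h with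
    | cons hb hl =>
      cases hl
      exact hb
  · exact fun h => Loop.cons h (Loop.nil _)

theorem Loop.exists_of_forall {l : List α} (h : ∀ a ∈ l, ∀ s, ∃ s', body a s s') (s : S) :
    ∃ s', Loop body l s s' := by
  induction l generalizing s with
  | nil => exact ⟨s, Loop.nil s⟩
  | cons a l ih =>
    obtain ⟨b, hb⟩ := h a List.mem_cons_self s
    obtain ⟨s', hs'⟩ := ih (fun a ha => h a (List.mem_cons_of_mem _ ha)) b
    exact ⟨s', Loop.cons hb hs'⟩

/-- A loop whose body adds a set of elements adds the union of these sets. -/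
theorem Loop.exists_union {β : Type*} {body : α → Set β → Set β → Prop} {Q : α → Set β → Prop}
    {l : List α} (hl : l.Nodup)
    (h : ∀ a ∈ l, ∀ b b', body a b b' → ∃ T, Q a T ∧ b' = b ∪ T) {b b' : Set β}
    (hloop : Loop body l b b') :
    ∃ f : α → Set β, (∀ a ∈ l, Q a (f a)) ∧ ∀ x, x ∈ b' ↔ x ∈ b ∨ ∃ a ∈ l, x ∈ f a := by
  classical
  induction hloop with
  | nil s => exact ⟨fun _ => ∅, by simp, by simp⟩
  | @cons a l s s' s'' hb _ ih =>
    obtain ⟨T, hT, rfl⟩ := h a List.mem_cons_self _ _ hb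
    obtain ⟨hal, hl⟩ := List.nodup_cons.1 hl
    obtain ⟨f, hf, hs⟩ := ih hl fun a ha => h a (List.mem_cons_of_mem _ ha)
    have hne : ∀ c ∈ l, c ≠ a := fun c hc e => hal (e ▸ hc)
    -- Since `a` does not occur again in `l`, this update keeps the sets recorded for the later
    -- entries.
    refine ⟨Function.update f a T, ?_, fun x => ?_⟩
    · intro c hc
      rcases List.mem_cons.1 hc with rfl | hc
      · simpa using hT
      · rw [Function.update_of_ne (hne c hc)]
        exact hf c hc
    · have : (∃ c ∈ l, x ∈ Function.update f a T c) ↔ ∃ c ∈ l, x ∈ f c := by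
        refine exists_congr fun c => and_congr_right fun hc => ?_
        rw [Function.update_of_ne (hne c hc)]
      simp only [List.mem_cons, exists_eq_or_imp, this, Function.update_self, hs, Set.mem_union]
      tauto

end LoopLemmas

namespace PvrNetwork

variable {V : Type u} [Fintype V] {G : SimpleGraph V} {D : PvrNetwork.{u, v} G}
  {B : D.Vert → StrongMod G}

namespace IsCycleAt

variable {M : PrimeMod G} {C : RootedCycle D.network} {P Q p q : List D.Vert} {w : D.Vert}
variable (h : D.IsCycleAt M C B)
include h

theorem ne_inl {v : D.Vert} (hv : v ∈ C.verts ∧ v ≠ C.root) (A : StrongMod G) :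
    v ≠ Sum.inl A := by
  obtain ⟨w, rfl⟩ := (h.mem_iff v).1 hv
  simp

theorem inl_mod_notMem {v : D.Vert} (hv : v ∈ C.verts ∧ v ≠ C.root) :
    (Sum.inl (B v) : D.Vert) ∉ C.verts := by
  intro hmem
  by_cases hr : (Sum.inl (B v) : D.Vert) = C.root
  · rw [h.root_eq] at hr
    exact (h.covBy v hv.1 hv.2).lt.ne (Sum.inl.inj hr)
  · exact h.ne_inl ⟨hmem, hr⟩ _ rfl

theorem ch_inter_verts (hPQ : C.IsSides P Q) (hP : P = p ++ w :: q) :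
    D.ch w ∩ C.verts = {q.headD C.hybrid} := by
  have hw := hPQ.side_mem (w := w) (by simp [hP])
  have hq := headD_mem hPQ (p := p ++ [w]) (q := q) (by simp [hP])
  rw [h.ch_side P Q hPQ p w q hP]
  ext z
  simp only [Set.mem_inter_iff, Set.mem_insert_iff, Set.mem_singleton_iff]
  constructor
  · rintro ⟨rfl | rfl, hz⟩
    · rfl
    · exact absurd hz (h.inl_mod_notMem hw)
  · rintro rfl
    exact ⟨Or.inl rfl, hq.1⟩

theorem ch_diff_verts (hPQ : C.IsSides P Q) (hP : P = p ++ w :: q) :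
    D.ch w \ C.verts = {Sum.inl (B w)} := by
  have hw := hPQ.side_mem (w := w) (by simp [hP])
  have hq := headD_mem hPQ (p := p ++ [w]) (q := q) (by simp [hP])
  rw [h.ch_side P Q hPQ p w q hP]
  ext z
  simp only [Set.mem_sdiff, Set.mem_insert_iff, Set.mem_singleton_iff]
  constructor
  · rintro ⟨rfl | rfl, hz⟩
    · exact absurd hq.1 hz
    · rfl
  · rintro rfl
    exact ⟨Or.inr rfl, h.inl_mod_notMem hw⟩

theorem exists_initInner (hPQ : C.IsSides P Q) (hw : w ∈ P) (s : D.State) :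
    ∃ s', D.InitInner C w s s' := by
  classical
  obtain ⟨p, q, hP⟩ := List.append_of_mem hw
  by_cases hl : D.label w = NLabel.zero
  · exact ⟨_, _, _, h.ch_inter_verts hPQ hP, h.ch_diff_verts hPQ hP, by rw [if_pos hl]⟩
  · exact ⟨_, _, _, h.ch_inter_verts hPQ hP, h.ch_diff_verts hPQ hP, by rw [if_neg hl]⟩

/-- The values of `ω` and `ω_¬η` computed on a side of the cycle. -/
theorem init_side (hPQ : C.IsSides P Q) (hP : P = p ++ q) {s s' : D.State}
    (hloop : Loop (D.InitInner C) q.reverse s s') :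
    (∀ v ∉ q, s'.omega v = s.omega v ∧ s'.omegaNot v = s.omegaNot v) ∧ s'.active = s.active ∧
    (s.omega C.hybrid = (G.induce ((B C.hybrid).1 : Set V)).cliqueNum →
      s.omegaNot C.hybrid = 0 →
      (∀ w ∈ q, s.omega (Sum.inl (B w)) = (G.induce ((B w).1 : Set V)).cliqueNum) →
      ∀ r r', q = r ++ r' →
        s'.omega (r'.headD C.hybrid) =
          (G.induce (D.sideSet B r' ∪ (B C.hybrid).1)).cliqueNum ∧
        s'.omegaNot (r'.headD C.hybrid) = (G.induce (D.sideSet B r')).cliqueNum) := by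
  classical
  induction q generalizing p s' with
  | nil =>
    rw [List.reverse_nil] at hloop
    cases hloop
    refine ⟨fun _ _ => ⟨rfl, rfl⟩, rfl, fun h1 h2 _ r r' hr => ?_⟩
    obtain ⟨rfl, rfl⟩ := List.append_eq_nil_iff.1 hr.symm
    rw [sideSet_nil, Set.empty_union, cliqueNum_induce_empty, List.headD_nil]
    exact ⟨h1, h2⟩
  | cons w q ih =>
    -- The loop runs bottom-up, so the head `w` of the list is processed last, when its cycle child
    -- already has its value.
    rw [List.reverse_cons, Loop.append_iff] at hloop
    obtain ⟨a, hloop, hw⟩ := hloop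
    rw [Loop.singleton_iff] at hw
    have hP' : P = (p ++ [w]) ++ q := by simp [hP]
    obtain ⟨ih1, ih2, ih3⟩ := ih hP' hloop
    obtain ⟨x, y, hx, hy, hs⟩ := hw
    rw [h.ch_inter_verts hPQ hP, Set.singleton_eq_singleton_iff] at hx
    rw [h.ch_diff_verts hPQ hP, Set.singleton_eq_singleton_iff] at hy
    subst hx hy
    have hwv := hPQ.side_mem (w := w) (by simp [hP])
    have hnd : (w :: q).Nodup := by
      have := hPQ.nodup_left
      rw [hP] at this
      exact (List.nodup_append.1 this).2.1
    have hwq : w ∉ q := (List.nodup_cons.1 hnd).1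
    have hwh : w ≠ C.hybrid := by
      rintro rfl
      exact hPQ.hybrid_notMem (by simp [hP])
    have hframe : (∀ v ≠ w, s'.omega v = a.omega v ∧ s'.omegaNot v = a.omegaNot v) ∧
        s'.active = a.active := by
      split_ifs at hs <;> subst hs
      · exact ⟨fun v hv => ⟨Function.update_of_ne hv _ _, Function.update_of_ne hv _ _⟩, rfl⟩
      · exact ⟨fun v hv => ⟨Function.update_of_ne hv _ _, Function.update_of_ne hv _ _⟩, rfl⟩
    refine ⟨fun v hv => ?_, hframe.2.trans ih2, fun h1 h2 h3 => ?_⟩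
    · obtain ⟨hvw, hvq⟩ := (not_or.1 fun e => hv (List.mem_cons.2 e) : v ≠ w ∧ v ∉ q)
      obtain ⟨e1, e2⟩ := hframe.1 v hvw
      exact ⟨e1.trans (ih1 v hvq).1, e2.trans (ih1 v hvq).2⟩
    have ih3 := ih3 h1 h2 fun w hw => h3 w (List.mem_cons_of_mem _ hw)
    intro r r' hr
    cases r with
    | cons w' r =>
      simp only [List.cons_append, List.cons.injEq] at hr
      have hne : r'.headD C.hybrid ≠ w := by
        cases r' with
        | nil => exact hwh.symm
        | cons b r' =>
          rintro rfl
          exact hwq (by simp [hr.2])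
      rw [(hframe.1 _ hne).1, (hframe.1 _ hne).2]
      exact ih3 r r' hr.2
    | nil =>
      obtain rfl : w :: q = r' := hr
      obtain ⟨i1, i2⟩ := ih3 [] q rfl
      have hB : a.omega (Sum.inl (B w)) = (G.induce ((B w).1 : Set V)).cliqueNum := by
        rw [(ih1 _ _).1, h3 w List.mem_cons_self]
        intro hmem
        exact h.ne_inl (hPQ.side_mem (by simp [hP, hmem])) (B w) rfl
      have hset : D.sideSet B q ∪ ((B w).1 : Set V) ∪ (B C.hybrid).1 =
          (D.sideSet B q ∪ (B C.hybrid).1) ∪ (B w).1 := by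
        rw [Set.union_right_comm]
      rw [List.headD_cons, sideSet_cons, hset]
      rcases h.label_eq_zero_or_one hwv.1 with hl | hl
      · rw [if_pos hl] at hs
        subst hs
        rw [h.cliqueNum_cons_zero hPQ hP hl subset_rfl,
          h.cliqueNum_cons_zero hPQ hP hl Set.subset_union_left]
        simp only [Function.update_self, i1, i2, hB, Nat.cast_max, and_self]
      · rw [if_neg (by rw [hl]; simp)] at hs
        subst hs
        rw [h.cliqueNum_cons_one hPQ hP hl subset_rfl,
          h.cliqueNum_cons_one hPQ hP hl Set.subset_union_left]
        simp only [Function.update_self, i1, i2, hB, Nat.cast_add, and_self]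

end IsCycleAt

end PvrNetwork

end Gatex

/-! ### Active vertices on a cycle and the maximum cliques they determine -/

namespace Gatex

namespace PvrNetwork

variable {V : Type u} [Fintype V] {G : SimpleGraph V} {D : PvrNetwork.{u, v} G}
  {B : D.Vert → StrongMod G}

theorem reach_eq_of_ch_inter_eq {a : Set D.Vert} {v x : D.Vert}
    (hv : ∀ A, v = Sum.inl A → A.1.card ≠ 1) (hx : D.ch v ∩ a = {x}) :
    D.reach a v = D.reach a x := by
  rw [D.reach_eq_iUnion hv, hx, Set.biUnion_singleton]

theorem reach_eq_union {a : Set D.Vert} {v x y : D.Vert}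
    (hv : ∀ A, v = Sum.inl A → A.1.card ≠ 1) (hx : D.ch v ∩ a = {x, y}) :
    D.reach a v = D.reach a x ∪ D.reach a y := by
  rw [D.reach_eq_iUnion hv, hx, Set.biUnion_pair]

/-- The union of the leaves reached from the modules attached to the vertices in `q` with
label `1`. -/
def oneReach (D : PvrNetwork.{u, v} G) (B : D.Vert → StrongMod G) (a : Set D.Vert)
    (q : List D.Vert) : Set V :=
  {x | ∃ w ∈ q, D.label w = NLabel.one ∧ x ∈ D.reach a (Sum.inl (B w))}

theorem oneReach_cons_of_eq {a : Set D.Vert} {w : D.Vert} (hw : D.label w = NLabel.one)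
    (q : List D.Vert) :
    D.oneReach B a (w :: q) = D.oneReach B a q ∪ D.reach a (Sum.inl (B w)) := by
  ext x
  constructor
  · rintro ⟨u, hu, hl, hx⟩
    rcases List.mem_cons.1 hu with rfl | hu
    · exact Or.inr hx
    · exact Or.inl ⟨u, hu, hl, hx⟩
  · rintro (⟨u, hu, hl, hx⟩ | hx)
    · exact ⟨u, List.mem_cons_of_mem _ hu, hl, hx⟩
    · exact ⟨w, List.mem_cons_self, hw, hx⟩

theorem oneReach_cons_of_ne {a : Set D.Vert} {w : D.Vert} (hw : D.label w ≠ NLabel.one)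
    (q : List D.Vert) : D.oneReach B a (w :: q) = D.oneReach B a q := by
  ext x
  simp [oneReach, hw]

namespace IsCycleAt

variable {M : PrimeMod G} {C : RootedCycle D.network} {P Q p q : List D.Vert} {w : D.Vert}
  {a : Set D.Vert} {ω : D.Vert → ℤ}
variable (h : D.IsCycleAt M C B) (hPQ : C.IsSides P Q)
  (hR : ∀ A : StrongMod G, A ⋖ M.1 → IsMaxCliqueIn G (A.1 : Set V) (D.reach a (Sum.inl A)))
include h

theorem root_card {A : StrongMod G} (e : C.root = Sum.inl A) : A.1.card ≠ 1 := by
  rw [h.root_eq] at e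
  rw [← Sum.inl.inj e]
  exact card_ne_one_of_prime M

theorem card_of_mem {v : D.Vert} (hv : v ∈ C.verts) (A : StrongMod G) (e : v = Sum.inl A) :
    A.1.card ≠ 1 := by
  by_cases hr : v = C.root
  · exact h.root_card (hr ▸ e)
  · exact absurd e (h.ne_inl ⟨hv, hr⟩ A)

include hR

theorem isMaxCliqueIn_reach_mod {v : D.Vert} (hv : v ∈ C.verts ∧ v ≠ C.root) :
    IsMaxCliqueIn G ((B v).1 : Set V) (D.reach a (Sum.inl (B v))) :=
  hR _ (h.covBy v hv.1 hv.2)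

theorem isMaxCliqueIn_hybrid (hhyb : Sum.inl (B C.hybrid) ∈ a) :
    IsMaxCliqueIn G ((B C.hybrid).1 : Set V) (D.reach a C.hybrid) := by
  rw [reach_eq_of_ch_inter_eq (h.card_of_mem C.hybrid_mem.1) (x := Sum.inl (B C.hybrid))]
  · exact h.isMaxCliqueIn_reach_mod hR C.hybrid_mem
  · rw [h.ch_hybrid, Set.inter_eq_left]
    simpa using hhyb

include hPQ

/-- The active vertices of a side on which all values are maximized determine a maximum clique. -/
theorem isMaxCliqueIn_side_hybrid
    (hω : ∀ p q, P = p ++ q →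
      ω (q.headD C.hybrid) = (G.induce (D.sideSet B q ∪ (B C.hybrid).1)).cliqueNum)
    (hωB : ∀ w ∈ P, ω (Sum.inl (B w)) = (G.induce ((B w).1 : Set V)).cliqueNum)
    (hhyb : Sum.inl (B C.hybrid) ∈ a)
    (hzero : ∀ w ∈ P, D.label w = NLabel.zero →
      ∃ x ∈ D.ch w, (∀ z ∈ D.ch w, ω z ≤ ω x) ∧ D.ch w ∩ a = {x})
    (hone : ∀ w ∈ P, D.label w = NLabel.one → D.ch w ⊆ a) (hP : P = p ++ q) :
    IsMaxCliqueIn G (D.sideSet B q ∪ (B C.hybrid).1) (D.reach a (q.headD C.hybrid)) := by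
  induction q generalizing p with
  | nil =>
    rw [sideSet_nil, Set.empty_union]
    exact h.isMaxCliqueIn_hybrid hR hhyb
  | cons w q ih =>
    have hP' : P = (p ++ [w]) ++ q := by simp [hP]
    have hwP : w ∈ P := by simp [hP]
    have hw := hPQ.side_mem hwP
    have ih := ih hP'
    have hmod := h.isMaxCliqueIn_reach_mod hR hw
    rw [sideSet_cons, Set.union_right_comm, List.headD_cons]
    have hch := h.ch_side P Q hPQ p w q hP
    rcases h.label_eq_zero_or_one hw.1 with hl | hl
    · obtain ⟨x, hx, hmax, hxa⟩ := hzero w hwP hl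
      rw [reach_eq_of_ch_inter_eq (h.card_of_mem hw.1) hxa]
      have hnum := h.cliqueNum_cons_zero hPQ hP hl
        (S := D.sideSet B q ∪ (B C.hybrid).1) subset_rfl
      have h1 := hmax (q.headD C.hybrid) (by rw [hch]; simp)
      have h2 := hmax (Sum.inl (B w)) (by rw [hch]; simp)
      rw [hch] at hx
      rcases hx with rfl | rfl
      · rw [hωB w hwP, hω _ _ hP'] at h2
        exact ih.mono Set.subset_union_left (by omega)
      · rw [hωB w hwP, hω _ _ hP'] at h1
        exact hmod.mono Set.subset_union_right (by omega)
    · rw [reach_eq_union (h.card_of_mem hw.1) (x := q.headD C.hybrid) (y := Sum.inl (B w))]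
      · exact ih.join hmod fun a ha b hb => (h.adj_iff_of_mem_sideSet hPQ hP ha hb).2 hl
      · rw [Set.inter_eq_left.2 (hone w hwP hl), hch]

theorem isMaxCliqueIn_root_zero
    (hω : ∀ p q, P = p ++ q →
      ω (q.headD C.hybrid) = (G.induce (D.sideSet B q ∪ (B C.hybrid).1)).cliqueNum)
    (hωB : ∀ w ∈ P, ω (Sum.inl (B w)) = (G.induce ((B w).1 : Set V)).cliqueNum)
    (hroot : D.ch C.root ∩ a = {P.headD C.hybrid})
    (hhyb : Sum.inl (B C.hybrid) ∈ a)
    (hzero : ∀ w ∈ P, D.label w = NLabel.zero →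
      ∃ x ∈ D.ch w, (∀ z ∈ D.ch w, ω z ≤ ω x) ∧ D.ch w ∩ a = {x})
    (hone : ∀ w ∈ P, D.label w = NLabel.one → D.ch w ⊆ a)
    (hmax : (G.induce (M.1.1 : Set V)).cliqueNum ≤
      (G.induce (D.sideSet B P ∪ (B C.hybrid).1)).cliqueNum) :
    IsMaxCliqueIn G (M.1.1 : Set V) (D.reach a (Sum.inl M.1)) := by
  rw [← h.root_eq, reach_eq_of_ch_inter_eq (fun _ => h.root_card) hroot]
  refine (h.isMaxCliqueIn_side_hybrid hPQ hR hω hωB hhyb hzero hone (p := []) rfl).mono ?_ hmax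
  rw [h.coe_eq hPQ]
  exact Set.subset_union_left

/-- The active vertices of a side on which all values without the hybrid-vertex are maximized
determine a maximum clique. -/
theorem isMaxCliqueIn_side {ωNot : D.Vert → ℤ}
    (hω : ∀ p q, P = p ++ q → ωNot (q.headD C.hybrid) = (G.induce (D.sideSet B q)).cliqueNum)
    (hωB : ∀ w ∈ P, ω (Sum.inl (B w)) = (G.induce ((B w).1 : Set V)).cliqueNum)
    (hlast : ∀ p w, P = p ++ [w] → D.ch w ∩ a = {Sum.inl (B w)})
    (hzero : ∀ p w q, P = p ++ w :: q → q ≠ [] → D.label w = NLabel.zero →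
      (ω (Sum.inl (B w)) ≤ ωNot (q.headD C.hybrid) ∧ D.ch w ∩ a = {q.headD C.hybrid}) ∨
      (ωNot (q.headD C.hybrid) ≤ ω (Sum.inl (B w)) ∧ D.ch w ∩ a = {Sum.inl (B w)}))
    (hone : ∀ p w q, P = p ++ w :: q → q ≠ [] → D.label w = NLabel.one → D.ch w ⊆ a)
    (hP : P = p ++ q) (hq : q ≠ []) :
    IsMaxCliqueIn G (D.sideSet B q) (D.reach a (q.headD C.hybrid)) := by
  induction q generalizing p with
  | nil => exact absurd rfl hq
  | cons w q ih =>
    have hP' : P = (p ++ [w]) ++ q := by simp [hP]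
    have hwP : w ∈ P := by simp [hP]
    have hw := hPQ.side_mem hwP
    have hmod := h.isMaxCliqueIn_reach_mod hR hw
    rw [sideSet_cons, List.headD_cons]
    -- The last vertex of the side is a parent of the hybrid-vertex. There only the attached module
    -- is active, whatever the label is.
    by_cases hqn : q = []
    · subst hqn
      rw [sideSet_nil, Set.empty_union,
        reach_eq_of_ch_inter_eq (h.card_of_mem hw.1) (hlast p w hP)]
      exact hmod
    have ih := ih hP' hqn
    have hch := h.ch_side P Q hPQ p w q hP
    rcases h.label_eq_zero_or_one hw.1 with hl | hl
    · have hnum := h.cliqueNum_cons_zero hPQ hP hl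
        (S := D.sideSet B q) Set.subset_union_left
      have hz := hzero p w q hP hqn hl
      rw [hωB w hwP, hω _ _ hP'] at hz
      rcases hz with ⟨hle, hx⟩ | ⟨hle, hx⟩
      · rw [reach_eq_of_ch_inter_eq (h.card_of_mem hw.1) hx]
        exact ih.mono Set.subset_union_left (by omega)
      · rw [reach_eq_of_ch_inter_eq (h.card_of_mem hw.1) hx]
        exact hmod.mono Set.subset_union_right (by omega)
    · rw [reach_eq_union (h.card_of_mem hw.1) (x := q.headD C.hybrid) (y := Sum.inl (B w))]
      · exact ih.join hmod fun a ha b hb =>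
          (h.adj_iff_of_mem_sideSet hPQ hP (Or.inl ha) hb).2 hl
      · rw [Set.inter_eq_left.2 (hone p w q hP hqn hl), hch]

theorem isMaxCliqueIn_oneReach (hq : ∀ w ∈ q, w ∈ P) (hqP : ∃ p, P = p ++ q) :
    IsMaxCliqueIn G (D.oneSet B q) (D.oneReach B a q) := by
  induction q with
  | nil => simpa [oneSet, oneReach] using isMaxCliqueIn_empty
  | cons w q ih =>
    obtain ⟨p, hP⟩ := hqP
    have hw := hPQ.side_mem (hq w List.mem_cons_self)
    have ih := ih (fun w hw => hq w (List.mem_cons_of_mem _ hw)) ⟨p ++ [w], by simp [hP]⟩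
    by_cases hl : D.label w = NLabel.one
    · rw [D.oneSet_cons_of_eq hl, oneReach_cons_of_eq hl]
      exact ih.join (h.isMaxCliqueIn_reach_mod hR hw) fun a ha b hb =>
        (h.adj_iff_of_mem_sideSet hPQ hP (Or.inl (D.oneSet_subset q ha)) hb).2 hl
    · rwa [D.oneSet_cons_of_ne hl, oneReach_cons_of_ne hl]

-- The situation for $\alpha>\beta$: every cycle vertex is active, but an attached module only at
-- label 1, so a vertex labeled 0 merely passes on to its cycle child.
omit hR in
theorem reach_headD_eq_oneReach (hverts : ∀ v ∈ C.verts, v ≠ C.root → v ∈ a)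
    (hmod : ∀ w ∈ P, Sum.inl (B w) ∈ a ↔ D.label w = NLabel.one) (hP : P = p ++ q) :
    D.reach a (q.headD C.hybrid) = D.oneReach B a q ∪ D.reach a C.hybrid := by
  induction q generalizing p with
  | nil => simp [oneReach]
  | cons w q ih =>
    have hP' : P = (p ++ [w]) ++ q := by simp [hP]
    have hwP : w ∈ P := by simp [hP]
    have hw := hPQ.side_mem hwP
    have hch := h.ch_side P Q hPQ p w q hP
    have hq := headD_mem hPQ hP'
    have hqa := hverts _ hq.1 hq.2
    rw [List.headD_cons]
    by_cases hl : D.label w = NLabel.one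
    · rw [reach_eq_union (h.card_of_mem hw.1) (x := q.headD C.hybrid) (y := Sum.inl (B w)),
        ih hP', oneReach_cons_of_eq hl, Set.union_right_comm]
      rw [hch, Set.inter_eq_left]
      rintro z (rfl | rfl)
      · exact hqa
      · exact (hmod w hwP).2 hl
    · rw [reach_eq_of_ch_inter_eq (h.card_of_mem hw.1) (x := q.headD C.hybrid), ih hP',
        oneReach_cons_of_ne hl]
      rw [hch]
      ext z
      simp only [Set.mem_inter_iff, Set.mem_insert_iff, Set.mem_singleton_iff]
      constructor
      · rintro ⟨rfl | rfl, hz⟩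
        · rfl
        · exact absurd ((hmod w hwP).1 hz) hl
      · rintro rfl
        exact ⟨Or.inl rfl, hqa⟩

/-- The reached set is the join of the label-1 parts of both sides with the hybrid module; by `hmax`
nothing larger exists. This settles $\alpha>\beta$, and `isMaxCliqueIn_root_sides` settles
$\alpha\le\beta$. -/
theorem isMaxCliqueIn_root_ones (hr : D.label C.root = NLabel.one)
    (hverts : ∀ v ∈ C.verts, v ≠ C.root → v ∈ a) (hhyb : Sum.inl (B C.hybrid) ∈ a)
    (hmodP : ∀ w ∈ P, Sum.inl (B w) ∈ a ↔ D.label w = NLabel.one)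
    (hmodQ : ∀ w ∈ Q, Sum.inl (B w) ∈ a ↔ D.label w = NLabel.one)
    (hmax : (G.induce (M.1.1 : Set V)).cliqueNum ≤
      (G.induce (D.oneSet B P)).cliqueNum + (G.induce (D.oneSet B Q)).cliqueNum +
        (G.induce ((B C.hybrid).1 : Set V)).cliqueNum) :
    IsMaxCliqueIn G (M.1.1 : Set V) (D.reach a (Sum.inl M.1)) := by
  have hreach : D.reach a (Sum.inl M.1) =
      (D.oneReach B a P ∪ D.oneReach B a Q) ∪ D.reach a C.hybrid := by
    rw [← h.root_eq, reach_eq_union (fun _ => h.root_card) (x := P.headD C.hybrid)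
      (y := Q.headD C.hybrid), h.reach_headD_eq_oneReach hPQ hverts hmodP (p := []) rfl,
      h.reach_headD_eq_oneReach hPQ.symm hverts hmodQ (p := []) rfl, ← Set.union_union_distrib_right]
    rw [h.ch_root P Q hPQ, Set.inter_eq_left]
    rintro z (rfl | rfl)
    · have := headD_mem hPQ (p := []) rfl
      exact hverts _ this.1 this.2
    · have := headD_mem hPQ.symm (p := []) rfl
      exact hverts _ this.1 this.2
  rw [← h.cliqueNum_ones hPQ hr] at hmax
  rw [hreach]
  refine IsMaxCliqueIn.mono (S := (D.oneSet B P ∪ D.oneSet B Q) ∪ (B C.hybrid).1) ?_ ?_ hmax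
  · apply IsMaxCliqueIn.join
    · exact (h.isMaxCliqueIn_oneReach hPQ hR (fun _ => id) ⟨[], rfl⟩).join
        (h.isMaxCliqueIn_oneReach hPQ.symm hR (fun _ => id) ⟨[], rfl⟩) fun a ha b hb =>
        (h.adj_cross_iff hPQ (D.oneSet_subset P ha) (D.oneSet_subset Q hb)).2 hr
    · exact h.isMaxCliqueIn_hybrid hR hhyb
    · rintro a (ha | ha) b hb
      · exact h.adj_hybrid_of_mem_oneSet hPQ ha hb
      · exact h.adj_hybrid_of_mem_oneSet hPQ.symm ha hb
  · rw [h.coe_eq hPQ]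
    rintro x ((hx | hx) | hx)
    · exact Or.inl (Or.inl (D.oneSet_subset P hx))
    · exact Or.inr (Or.inl (D.oneSet_subset Q hx))
    · exact Or.inl (Or.inr hx)

omit hR in
theorem isMaxCliqueIn_root_sides (hr : D.label C.root = NLabel.one) (hroot : D.ch C.root ⊆ a)
    (hsP : IsMaxCliqueIn G (D.sideSet B P) (D.reach a (P.headD C.hybrid)))
    (hsQ : IsMaxCliqueIn G (D.sideSet B Q) (D.reach a (Q.headD C.hybrid)))
    (hmax : (G.induce (M.1.1 : Set V)).cliqueNum ≤
      (G.induce (D.sideSet B P)).cliqueNum + (G.induce (D.sideSet B Q)).cliqueNum) :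
    IsMaxCliqueIn G (M.1.1 : Set V) (D.reach a (Sum.inl M.1)) := by
  rw [← h.root_eq, reach_eq_union (fun _ => h.root_card) (x := P.headD C.hybrid)
    (y := Q.headD C.hybrid)]
  · rw [← h.cliqueNum_sides hPQ hr] at hmax
    refine (hsP.join hsQ fun a ha b hb => (h.adj_cross_iff hPQ ha hb).2 hr).mono ?_ hmax
    rw [h.coe_eq hPQ]
    exact Set.union_subset_union Set.subset_union_left Set.subset_union_left
  · rw [Set.inter_eq_left.2 hroot, h.ch_root P Q hPQ]

end IsCycleAt

end PvrNetwork

end Gatex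

/-! ### Zones of influence of a visit and the values on a whole cycle -/

namespace Gatex

namespace PvrNetwork

variable {V : Type u} [Fintype V] {G : SimpleGraph V} {D : PvrNetwork.{u, v} G}
  {B : D.Vert → StrongMod G}

/-- The module during whose visit the values `ω(v)` and `ω_¬η(v)` are computed. -/
def zone (D : PvrNetwork.{u, v} G) : D.Vert → StrongMod G
  | Sum.inl A => A
  | Sum.inr p => p.1.1

/-- The vertices that may be activated during the visit of `M`. -/
def actZone (D : PvrNetwork.{u, v} G) (M : StrongMod G) : Set D.Vert :=
  {v | (∃ A : StrongMod G, A ⋖ M ∧ v = Sum.inl A) ∨ ∃ p, v = Sum.inr p ∧ p.1.1 = M}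

namespace IsCycleAt

variable {M : PrimeMod G} {C : RootedCycle D.network} {P Q p q : List D.Vert} {u w z : D.Vert}
variable (h : D.IsCycleAt M C B)
include h

theorem zone_eq_iff : D.zone w = M.1 ↔ w ∈ C.verts := by
  by_cases hr : w = C.root
  · rw [hr, h.root_eq]
    simp only [zone, true_iff]
    rw [← h.root_eq, C.isSides_self.mem_verts]
    exact Or.inl rfl
  · have := h.mem_iff w
    simp only [ne_eq, hr, not_false_eq_true, and_true] at this
    rw [this]
    constructor
    · intro hz
      cases w with
      | inl A =>
        obtain rfl : A = M.1 := hz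
        exact absurd h.root_eq.symm hr
      | inr p =>
        obtain ⟨N, w⟩ := p
        obtain rfl : N = M := Subtype.ext hz
        exact ⟨w, rfl⟩
    · rintro ⟨w, rfl⟩
      rfl

theorem mem_actZone (hw : w ∈ C.verts ∧ w ≠ C.root) : w ∈ D.actZone M.1 := by
  obtain ⟨w, rfl⟩ := (h.mem_iff w).1 hw
  exact Or.inr ⟨_, rfl, rfl⟩

theorem inl_mod_mem_actZone (hw : w ∈ C.verts ∧ w ≠ C.root) :
    Sum.inl (B w) ∈ D.actZone M.1 :=
  Or.inl ⟨_, h.covBy w hw.1 hw.2, rfl⟩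

theorem headD_mem_side (hPQ : C.IsSides P Q) : P.headD C.hybrid ∈ P := by
  cases P with
  | nil => exact absurd rfl (h.side_ne_nil _ _ hPQ)
  | cons a l => simp

theorem mem_ch_cases (hw : w ∈ C.verts) (hz : z ∈ D.ch w) :
    (z ∈ C.verts ∧ z ≠ C.root) ∨ (w ≠ C.root ∧ z = Sum.inl (B w)) := by
  have hside : ∀ P Q, C.IsSides P Q → w ∈ P →
      (z ∈ C.verts ∧ z ≠ C.root) ∨ (w ≠ C.root ∧ z = Sum.inl (B w)) := by
    intro P Q hPQ hwP
    obtain ⟨p, q, hP⟩ := List.append_of_mem hwP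
    rw [h.ch_side P Q hPQ p w q hP] at hz
    rcases hz with rfl | rfl
    · exact Or.inl (headD_mem hPQ (p := p ++ [w]) (by simp [hP]))
    · exact Or.inr ⟨(hPQ.side_mem hwP).2, rfl⟩
  have hPQ := C.isSides_self
  rcases hPQ.mem_verts.1 hw with rfl | rfl | e | e
  · rw [h.ch_root _ _ hPQ] at hz
    rcases hz with rfl | rfl
    · exact Or.inl (headD_mem hPQ (p := []) rfl)
    · exact Or.inl (headD_mem hPQ.symm (p := []) rfl)
  · rw [h.ch_hybrid] at hz
    exact Or.inr ⟨C.hybrid_mem.2, hz⟩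
  · exact hside _ _ hPQ e
  · exact hside _ _ hPQ.symm e

theorem ch_subset_actZone (hw : w ∈ C.verts) : D.ch w ⊆ D.actZone M.1 := by
  intro z hz
  rcases h.mem_ch_cases hw hz with h' | ⟨hr, rfl⟩
  · exact h.mem_actZone h'
  · exact h.inl_mod_mem_actZone ⟨hw, hr⟩

/-- Away from the hybrid-vertex parents are unique, so an active child reveals which vertex
activated it. -/
theorem eq_of_mem_ch (hu : u ∈ C.verts) (hw : w ∈ C.verts) (hzu : z ∈ D.ch u)
    (hzw : z ∈ D.ch w) (hz : z ≠ C.hybrid) : u = w := by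
  rcases h.mem_ch_cases hu hzu with ⟨hzv, hzr⟩ | ⟨hur, rfl⟩
  · exact h.parents_subsingleton z hzv hz hzr hzu hzw
  · rcases h.mem_ch_cases hw hzw with ⟨hzv, hzr⟩ | ⟨hwr, e⟩
    · exact absurd hzv (h.inl_mod_notMem ⟨hu, hur⟩)
    · exact h.inj u hu hur w hw hwr (Sum.inl.inj e)

theorem hybrid_mem_ch_iff (hPQ : C.IsSides P Q) (hw : w ∈ P) :
    C.hybrid ∈ D.ch w ↔ ∃ p, P = p ++ [w] := by
  refine (h.adj_hybrid_iff P Q hPQ w).trans (or_iff_left ?_)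
  rintro ⟨p, hp⟩
  exact hPQ.disjoint hw (by simp [hp])

theorem eq_of_hybrid_mem_ch (hPQ : C.IsSides P Q) (hu : u ∈ P) (hw : w ∈ P)
    (hu' : C.hybrid ∈ D.ch u) (hw' : C.hybrid ∈ D.ch w) : u = w := by
  obtain ⟨p, hp⟩ := (h.hybrid_mem_ch_iff hPQ hu).1 hu'
  obtain ⟨q, hq⟩ := (h.hybrid_mem_ch_iff hPQ hw).1 hw'
  simpa using congrArg List.getLast? (hp.symm.trans hq)

theorem hybrid_notMem_ch_root : C.hybrid ∉ D.ch C.root := by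
  intro hmem
  have hPQ := C.isSides_self
  rcases (h.adj_hybrid_iff _ _ hPQ _).1 hmem with ⟨p, hp⟩ | ⟨p, hp⟩
  · exact hPQ.root_notMem (by simp [hp])
  · exact hPQ.symm.root_notMem (by simp [hp])

theorem hybrid_notMem_ch_hybrid : C.hybrid ∉ D.ch C.hybrid := by
  intro hmem
  have hPQ := C.isSides_self
  rcases (h.adj_hybrid_iff _ _ hPQ _).1 hmem with ⟨p, hp⟩ | ⟨p, hp⟩
  · exact hPQ.hybrid_notMem (by simp [hp])
  · exact hPQ.symm.hybrid_notMem (by simp [hp])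

/-- The hybrid-vertex only depends on the module. -/
theorem hybrid_unique {C' : RootedCycle D.network} {B' : D.Vert → StrongMod G}
    (h' : D.IsCycleAt M C' B') : C'.hybrid = C.hybrid := by
  by_contra hne
  have hPQ := C'.isSides_self
  obtain ⟨p, c, hp⟩ := (List.eq_nil_or_concat _).resolve_left (h'.side_ne_nil _ _ hPQ)
  obtain ⟨q, d, hq⟩ := (List.eq_nil_or_concat _).resolve_left (h'.side_ne_nil _ _ hPQ.symm)
  rw [List.concat_eq_append] at hp hq
  have h1 := (h'.adj_hybrid_iff _ _ hPQ c).2 (Or.inl ⟨p, hp⟩)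
  have h2 := (h'.adj_hybrid_iff _ _ hPQ d).2 (Or.inr ⟨q, hq⟩)
  have hm := (h.mem_iff _).2 ((h'.mem_iff _).1 C'.hybrid_mem)
  -- In `C'` this vertex has a parent on each side; in `C` it would be a cycle vertex with a single
  -- parent.
  have e := h.parents_subsingleton _ hm.1 hne hm.2 h1 h2
  exact hPQ.disjoint (w := c) (by simp [hp]) (by simp [hq, e])

omit h in
theorem exists_headD (hw : w ∈ C.verts ∧ w ≠ C.root) :
    ∃ P Q p q, C.IsSides P Q ∧ P = p ++ q ∧ w = q.headD C.hybrid := by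
  have hside : ∀ P Q, C.IsSides P Q → w ∈ P →
      ∃ P Q p q, C.IsSides P Q ∧ P = p ++ q ∧ w = q.headD C.hybrid := by
    intro P Q hPQ hwP
    obtain ⟨p, q, hP⟩ := List.append_of_mem hwP
    exact ⟨P, Q, p, w :: q, hPQ, hP, rfl⟩
  have hPQ := C.isSides_self
  rcases hPQ.mem_verts.1 hw.1 with e | rfl | e | e
  · exact absurd e hw.2
  · exact ⟨_, _, C.inner₁, [], hPQ, by simp, rfl⟩
  · exact hside _ _ hPQ e
  · exact hside _ _ hPQ.symm e

theorem leavesBelow_eq (hPQ : C.IsSides P Q) (hP : P = p ++ q) :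
    D.leavesBelow (q.headD C.hybrid) = D.sideSet B q ∪ (B C.hybrid).1 :=
  h.leavesBelow_headD hPQ (fun A _ => D.leavesBelow_inl A) hP

theorem leavesBelow_diff_eq (hPQ : C.IsSides P Q) (hP : P = p ++ q) :
    D.leavesBelow (q.headD C.hybrid) \ D.leavesBelow C.hybrid = D.sideSet B q := by
  rw [h.leavesBelow_eq hPQ hP, h.leavesBelow_hybrid fun A _ => D.leavesBelow_inl A,
    Set.union_sdiff_right]
  refine sdiff_eq_left.2 (Set.disjoint_left.2 ?_)
  rintro x ⟨w, hw, hx⟩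
  have hwP : w ∈ P := by simp [hP, hw]
  exact h.disjoint_mod (hPQ.side_mem hwP) C.hybrid_mem
    (fun e => hPQ.hybrid_notMem (e ▸ hwP)) hx

/-- The values of `ω` and `ω_¬η` computed on the cycle. -/
theorem init_cycle [DecidableEq D.Vert] {s s₂ : D.State} {c : D.Vert} (hc : D.ch C.hybrid = {c})
    (hloop : Loop (D.InitInner C) (C.inner₁.reverse ++ C.inner₂.reverse)
      { s with
        omega := Function.update s.omega C.hybrid (s.omega c)
        omegaNot := Function.update s.omegaNot C.hybrid 0 } s₂) :
    (∀ v, ¬ (v ∈ C.verts ∧ v ≠ C.root) →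
      s₂.omega v = s.omega v ∧ s₂.omegaNot v = s.omegaNot v) ∧
    s₂.active = s.active ∧
    ((∀ A : StrongMod G, A ⋖ M.1 →
        s.omega (Sum.inl A) = (G.induce (A.1 : Set V)).cliqueNum) →
      ∀ P Q, C.IsSides P Q → ∀ p q, P = p ++ q →
        s₂.omega (q.headD C.hybrid) =
          (G.induce (D.sideSet B q ∪ (B C.hybrid).1)).cliqueNum ∧
        s₂.omegaNot (q.headD C.hybrid) = (G.induce (D.sideSet B q)).cliqueNum) := by
  rw [Loop.append_iff] at hloop
  obtain ⟨a, h1, h2⟩ := hloop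
  have hPQ := C.isSides_self
  obtain ⟨f1, f2, f3⟩ := h.init_side hPQ (p := []) rfl h1
  obtain ⟨g1, g2, g3⟩ := h.init_side hPQ.symm (p := []) rfl h2
  simp only at f1 f2 f3
  rw [h.ch_hybrid, Set.singleton_eq_singleton_iff] at hc
  subst hc
  have hupd : ∀ v, v ≠ C.hybrid → v ∉ C.inner₁ →
      a.omega v = s.omega v ∧ a.omegaNot v = s.omegaNot v := by
    intro v hv hv1
    rw [(f1 v hv1).1, (f1 v hv1).2, Function.update_of_ne hv, Function.update_of_ne hv]
    exact ⟨rfl, rfl⟩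
  refine ⟨fun v hv => ?_, g2.trans f2, fun hω => ?_⟩
  · have hv1 : v ∉ C.inner₁ := fun e => hv (hPQ.side_mem e)
    have hv2 : v ∉ C.inner₂ := fun e => hv (hPQ.symm.side_mem e)
    have hvh : v ≠ C.hybrid := fun e => hv (e ▸ C.hybrid_mem)
    rw [(g1 v hv2).1, (g1 v hv2).2]
    exact hupd v hvh hv1
  · have hmod : ∀ w, w ∈ C.verts ∧ w ≠ C.root →
        s.omega (Sum.inl (B w)) = (G.induce ((B w).1 : Set V)).cliqueNum := fun w hw =>
      hω _ (h.covBy w hw.1 hw.2)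
    have hne : ∀ w, w ∈ C.verts ∧ w ≠ C.root → Sum.inl (B w) ≠ C.hybrid := fun w _ =>
      (h.ne_inl C.hybrid_mem _).symm
    have F := f3 (by rw [Function.update_self, hmod _ C.hybrid_mem])
      (by rw [Function.update_self]) fun w hw => by
        have hw := hPQ.side_mem hw
        rw [Function.update_of_ne (hne w hw), hmod w hw]
    have hhyb := F C.inner₁ [] (by simp)
    -- The first loop leaves the values at the hybrid-vertex unchanged, so the second side starts
    -- from the same data.
    have K := g3 (by
        have := hhyb.1
        rwa [sideSet_nil, Set.empty_union, List.headD_nil] at this)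
      (by
        have := hhyb.2
        rwa [sideSet_nil, cliqueNum_induce_empty, List.headD_nil] at this) fun w hw => by
        have hw := hPQ.symm.side_mem hw
        rw [(hupd _ (hne w hw) fun e => h.ne_inl (hPQ.side_mem e) _ rfl).1, hmod w hw]
    rintro P Q (⟨rfl, rfl⟩ | ⟨rfl, rfl⟩) p q hP
    -- The second loop writes on the second side only, so the values on the first side survive it.
    · have hnot : q.headD C.hybrid ∉ C.inner₂ := by
        cases q with
        | nil => exact hPQ.symm.hybrid_notMem
        | cons b q => exact hPQ.disjoint (by simp [hP])
      rw [(g1 _ hnot).1, (g1 _ hnot).2]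
      exact F p q hP
    · exact K p q hP

end IsCycleAt

end PvrNetwork

end Gatex

/-! ### The sets of vertices activated on a cycle -/

namespace Gatex

namespace PvrNetwork

variable {V : Type u} [Fintype V] {G : SimpleGraph V} {D : PvrNetwork.{u, v} G}
  {B : D.Vert → StrongMod G}

namespace IsCycleAt

variable {M : PrimeMod G} {C : RootedCycle D.network} {P Q p q : List D.Vert} {u w z : D.Vert}
  {ω ωNot : D.Vert → ℤ} {a b b' : Set D.Vert} {α β : ℤ}
variable (h : D.IsCycleAt M C B)
include h

/-- If every visited vertex of the cycle only activates children of its own, then its active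
children are those that it has activated itself. -/
theorem ch_inter_eq {U : Set D.Vert} {F : D.Vert → Set D.Vert} {R : Set D.Vert}
    (hU : ∀ u ∈ U, u ∈ C.verts ∧ u ≠ C.root) (hF : ∀ u ∈ U, F u ⊆ D.ch u)
    (hhyb : ∀ u ∈ U, ∀ w ∈ U, C.hybrid ∈ F u → C.hybrid ∈ D.ch w → u = w)
    (hR : R ⊆ D.ch C.root)
    (ha : ∀ x ∈ D.actZone M.1, x ∈ a ↔ x ∈ R ∨ ∃ u ∈ U, x ∈ F u) :
    (∀ w ∈ U, D.ch w ∩ a = F w) ∧ D.ch C.root ∩ a = R := by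
  have hrv : C.root ∈ C.verts := C.isSides_self.mem_verts.2 (Or.inl rfl)
  constructor
  · intro w hw
    ext z
    constructor
    · rintro ⟨hz, hza⟩
      rcases (ha z (h.ch_subset_actZone (hU w hw).1 hz)).1 hza with hzR | ⟨u, hu, hzu⟩
      · have hne : z ≠ C.hybrid := fun e => h.hybrid_notMem_ch_root (e ▸ hR hzR)
        exact absurd (h.eq_of_mem_ch (hU w hw).1 hrv hz (hR hzR) hne) (hU w hw).2
      -- The hybrid-vertex has two parents, so here `hhyb` is needed to identify the activating
      -- vertex.
      · by_cases hne : z = C.hybrid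
        · subst hne
          exact hhyb u hu w hw hzu hz ▸ hzu
        · exact h.eq_of_mem_ch (hU u hu).1 (hU w hw).1 (hF u hu hzu) hz hne ▸ hzu
    · intro hz
      have hz' := hF w hw hz
      exact ⟨hz', (ha z (h.ch_subset_actZone (hU w hw).1 hz')).2 (Or.inr ⟨w, hw, hz⟩)⟩
  · ext z
    constructor
    · rintro ⟨hz, hza⟩
      rcases (ha z (h.ch_subset_actZone hrv hz)).1 hza with hzR | ⟨u, hu, hzu⟩
      · exact hzR
      · have hne : z ≠ C.hybrid := fun e => h.hybrid_notMem_ch_root (e ▸ hz)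
        exact absurd (h.eq_of_mem_ch (hU u hu).1 hrv (hF u hu hzu) hz hne) (hU u hu).2
    · intro hz
      exact ⟨hR hz, (ha z (h.ch_subset_actZone hrv (hR hz))).2 (Or.inl hz)⟩

-- `F u` is the set of children that the processing of `u` activates; recording it per vertex makes
-- `ch_inter_eq` applicable.
omit h in
theorem activate_zero (hPQ : C.IsSides P Q)
    (hact : D.Activate C [P] ω ωNot α β NLabel.zero b b') :
    ∃ F : D.Vert → Set D.Vert, (∀ u, u ∈ P ∨ u = C.hybrid → F u ⊆ D.ch u ∧
        (D.label u = NLabel.zero → ∃ x ∈ D.ch u, (∀ z ∈ D.ch u, ω z ≤ ω x) ∧ F u = {x}) ∧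
        (D.label u = NLabel.one → F u = D.ch u)) ∧
      ∀ x, x ∈ b' ↔ x ∈ b ∨ ∃ u, (u ∈ P ∨ u = C.hybrid) ∧ x ∈ F u := by
  classical
  rw [Activate, if_pos rfl] at hact
  have hnd : ([P].flatMap fun P => (P ++ [C.hybrid]).reverse).Nodup := by
    have := (List.nodup_cons.1 hPQ.nodup_path).2
    simpa using List.nodup_reverse.2 this
  obtain ⟨F, hF, hb'⟩ := Loop.exists_union (Q := fun u T => T ⊆ D.ch u ∧
    (D.label u = NLabel.zero → ∃ x ∈ D.ch u, (∀ z ∈ D.ch u, ω z ≤ ω x) ∧ T = {x}) ∧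
    (D.label u = NLabel.one → T = D.ch u)) hnd (by
      intro u _ b b' hbody
      split_ifs at hbody with hl
      · obtain ⟨x, hx, hmax, rfl⟩ := hbody
        exact ⟨{x}, ⟨by simpa using hx, fun _ => ⟨x, hx, hmax, rfl⟩,
          fun e => by rw [hl] at e; cases e⟩, rfl⟩
      · exact ⟨D.ch u, ⟨subset_rfl, fun e => absurd e hl, fun _ => rfl⟩, hbody⟩) hact
  have hmem : ∀ u, u ∈ ([P].flatMap fun P => (P ++ [C.hybrid]).reverse) ↔
      u ∈ P ∨ u = C.hybrid := by
    intro u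
    simp [or_comm]
  simp only [hmem] at hF hb'
  exact ⟨F, hF, hb'⟩

theorem activate_one_le (hαβ : α ≤ β)
    (hact : D.Activate C [C.inner₁, C.inner₂] ω ωNot α β NLabel.one b b') :
    ∃ F : D.Vert → Set D.Vert,
      (∀ P Q, C.IsSides P Q → ∀ p w q, P = p ++ w :: q → F w ⊆ D.ch w ∧
        (q = [] → F w = {Sum.inl (B w)}) ∧
        (q ≠ [] → D.label w = NLabel.zero →
          (ω (Sum.inl (B w)) ≤ ωNot (q.headD C.hybrid) ∧ F w = {q.headD C.hybrid}) ∨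
          (ωNot (q.headD C.hybrid) ≤ ω (Sum.inl (B w)) ∧ F w = {Sum.inl (B w)})) ∧
        (q ≠ [] → D.label w = NLabel.one → F w = D.ch w)) ∧
      ∀ x, x ∈ b' ↔ x ∈ b ∨ x ∈ D.ch C.root ∨
        ∃ u, (u ∈ C.inner₁ ∨ u ∈ C.inner₂) ∧ x ∈ F u := by
  classical
  rw [Activate, if_neg (by simp), if_pos hαβ] at hact
  obtain ⟨w₁, w₂, -, hpar, hact⟩ := hact
  have hPQ := C.isSides_self
  have hnd : ([C.inner₁, C.inner₂].flatMap List.reverse).Nodup := by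
    simp only [List.flatMap_cons, List.flatMap_nil, List.append_nil, List.nodup_append,
      List.nodup_reverse, List.mem_reverse]
    refine ⟨hPQ.nodup_left, hPQ.symm.nodup_left, ?_⟩
    rintro x hx y hy rfl
    exact hPQ.disjoint hx hy
  obtain ⟨f, hf, hb'⟩ := Loop.exists_union (Q := fun w T => ∀ P Q, C.IsSides P Q →
    ∀ p q, P = p ++ w :: q → T ⊆ D.ch w ∧
      (D.label w = NLabel.zero →
          (ω (Sum.inl (B w)) ≤ ωNot (q.headD C.hybrid) ∧ T = {q.headD C.hybrid}) ∨
          (ωNot (q.headD C.hybrid) ≤ ω (Sum.inl (B w)) ∧ T = {Sum.inl (B w)})) ∧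
        (D.label w = NLabel.one → T = D.ch w)) (hnd.filter _) (by
      intro w hw b b' hbody
      obtain ⟨x, y, hx, hy, hbody⟩ := hbody
      have hxy : ∀ P Q, C.IsSides P Q → ∀ p q, P = p ++ w :: q → x = q.headD C.hybrid ∧
          y = Sum.inl (B w) ∧ D.ch w = {x, y} := by
        intro P Q hPQ p q hP
        have e1 := hx.symm.trans (h.ch_inter_verts hPQ hP)
        have e2 := hy.symm.trans (h.ch_diff_verts hPQ hP)
        rw [Set.singleton_eq_singleton_iff] at e1 e2
        exact ⟨e1, e2, by rw [e1, e2, h.ch_side P Q hPQ p w q hP]⟩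
      split_ifs at hbody with hl
      · rcases hbody with ⟨hle, rfl⟩ | ⟨hle, rfl⟩
        · refine ⟨{x}, fun P Q hPQ p q hP => ?_, rfl⟩
          obtain ⟨e1, e2, e3⟩ := hxy P Q hPQ p q hP
          exact ⟨by rw [e3]; simp, fun _ => Or.inl ⟨by rwa [← e1, ← e2], by rw [e1]⟩,
            fun e => by rw [hl] at e; cases e⟩
        · refine ⟨{y}, fun P Q hPQ p q hP => ?_, rfl⟩
          obtain ⟨e1, e2, e3⟩ := hxy P Q hPQ p q hP
          exact ⟨by rw [e3]; simp, fun _ => Or.inr ⟨by rwa [← e1, ← e2], by rw [e2]⟩,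
            fun e => by rw [hl] at e; cases e⟩
      · refine ⟨{x, y}, fun P Q hPQ p q hP => ?_, hbody⟩
        obtain ⟨e1, e2, e3⟩ := hxy P Q hPQ p q hP
        exact ⟨by rw [e3], fun e => absurd e hl, fun _ => e3.symm⟩) hact
  -- `w₁` and `w₂` are the parents of the hybrid-vertex, that is, the last vertices of the sides;
  -- they are handled before the loop and filtered out of it.
  have hadj : ∀ u, D.network.Adj u C.hybrid ↔ u = w₁ ∨ u = w₂ := fun u => Set.ext_iff.1 hpar u
  have hmem : ∀ u, u ∈ (([C.inner₁, C.inner₂].flatMap List.reverse).filter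
      fun w => w ≠ w₁ ∧ w ≠ w₂) ↔
      (u ∈ C.inner₁ ∨ u ∈ C.inner₂) ∧ ¬ D.network.Adj u C.hybrid := by
    intro u
    rw [hadj]
    simp only [List.mem_filter, List.mem_flatMap, List.mem_cons, List.not_mem_nil, or_false,
      exists_eq_or_imp, exists_eq_left, List.mem_reverse, decide_eq_true_eq, ne_eq, not_or]
  simp only [hmem] at hf hb'
  have hnadj : ∀ P Q, C.IsSides P Q → ∀ p w q, P = p ++ w :: q →
      (D.network.Adj w C.hybrid ↔ q = []) := by
    intro P Q hPQ p w q hP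
    refine (h.hybrid_mem_ch_iff hPQ (by simp [hP])).trans ⟨?_, ?_⟩
    · rintro ⟨p', hp'⟩
      exact (eq_of_nodup_append_cons hPQ.nodup_left hP hp').2
    · rintro rfl
      exact ⟨p, hP⟩
  -- The sets activated before the loop are recorded as contributions of the two parents of the
  -- hybrid-vertex.
  refine ⟨fun u => if D.network.Adj u C.hybrid then D.ch u \ {C.hybrid} else f u, ?_, ?_⟩
  · intro P Q hPQ p w q hP
    have hwv := hPQ.side_mem (w := w) (by simp [hP])
    have hwi : w ∈ C.inner₁ ∨ w ∈ C.inner₂ := by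
      have hwP : w ∈ P := by simp [hP]
      rcases hPQ with ⟨rfl, -⟩ | ⟨rfl, -⟩
      · exact Or.inl hwP
      · exact Or.inr hwP
    by_cases hq : q = []
    · have hw := (hnadj P Q hPQ p w q hP).2 hq
      simp only [if_pos hw, ne_eq, hq, not_true_eq_false, false_implies, and_true, true_implies]
      refine ⟨Set.sdiff_subset, ?_⟩
      have hch := h.ch_side P Q hPQ p w q hP
      rw [hq, List.headD_nil] at hch
      rw [hch, Set.insert_sdiff_of_mem _ (Set.mem_singleton _), sdiff_eq_left,
        Set.disjoint_singleton]
      exact (h.ne_inl C.hybrid_mem _).symm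
    · have hw : ¬ D.network.Adj w C.hybrid := fun e => hq ((hnadj P Q hPQ p w q hP).1 e)
      obtain ⟨h1, h2, h3⟩ := hf w ⟨hwi, hw⟩ P Q hPQ p q hP
      simp only [if_neg hw]
      exact ⟨h1, fun e => absurd e hq, fun _ => h2, fun _ => h3⟩
  · intro x
    rw [hb']
    have hw₁ := (hadj w₁).2 (Or.inl rfl)
    have hw₂ := (hadj w₂).2 (Or.inr rfl)
    have hin : ∀ u, D.network.Adj u C.hybrid → u ∈ C.inner₁ ∨ u ∈ C.inner₂ := by
      intro u hu
      rcases (h.adj_hybrid_iff _ _ hPQ u).1 hu with ⟨p, hp⟩ | ⟨p, hp⟩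
      · exact Or.inl (by simp [hp])
      · exact Or.inr (by simp [hp])
    simp only [Set.mem_union]
    constructor
    · rintro ((((hx | hx) | hx) | hx) | ⟨u, ⟨hu, hu'⟩, hx⟩)
      · exact Or.inl hx
      · exact Or.inr (Or.inl hx)
      · exact Or.inr (Or.inr ⟨w₁, hin _ hw₁, by rwa [if_pos hw₁]⟩)
      · exact Or.inr (Or.inr ⟨w₂, hin _ hw₂, by rwa [if_pos hw₂]⟩)
      · exact Or.inr (Or.inr ⟨u, hu, by rwa [if_neg hu']⟩)
    · rintro (hx | hx | ⟨u, hu, hx⟩)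
      · exact Or.inl (Or.inl (Or.inl (Or.inl hx)))
      · exact Or.inl (Or.inl (Or.inl (Or.inr hx)))
      · split_ifs at hx with hu'
        · rcases (hadj u).1 hu' with rfl | rfl
          · exact Or.inl (Or.inl (Or.inr hx))
          · exact Or.inl (Or.inr hx)
        · exact Or.inr ⟨u, ⟨hu, hu'⟩, hx⟩

theorem activate_one_gt (hαβ : ¬ α ≤ β)
    (hact : D.Activate C [C.inner₁, C.inner₂] ω ωNot α β NLabel.one b b') (x : D.Vert) :
    x ∈ b' ↔ x ∈ b ∨ (x ∈ C.verts ∧ x ≠ C.root) ∨ x = Sum.inl (B C.hybrid) ∨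
      ∃ u, (u ∈ C.inner₁ ∨ u ∈ C.inner₂) ∧ D.label u = NLabel.one ∧ x = Sum.inl (B u) := by
  classical
  rw [Activate, if_neg (by simp), if_neg hαβ] at hact
  have hPQ := C.isSides_self
  have hnd : ([C.inner₁, C.inner₂].flatMap List.reverse).Nodup := by
    simp only [List.flatMap_cons, List.flatMap_nil, List.append_nil, List.nodup_append,
      List.nodup_reverse, List.mem_reverse]
    refine ⟨hPQ.nodup_left, hPQ.symm.nodup_left, ?_⟩
    rintro x hx y hy rfl
    exact hPQ.disjoint hx hy
  obtain ⟨f, hf, hb'⟩ := Loop.exists_union (Q := fun w T =>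
    T = {w} ∪ (if D.label w = NLabel.one then D.ch w \ C.verts else ∅)) hnd (by
      intro w _ b b' hbody
      exact ⟨_, rfl, by rw [hbody, Set.union_assoc]⟩) hact
  have hmem : ∀ u, u ∈ [C.inner₁, C.inner₂].flatMap List.reverse ↔
      u ∈ C.inner₁ ∨ u ∈ C.inner₂ := by
    intro u
    simp
  simp only [hmem] at hf hb'
  have hfx : ∀ u, (u ∈ C.inner₁ ∨ u ∈ C.inner₂) →
      (x ∈ f u ↔ x = u ∨ (D.label u = NLabel.one ∧ x = Sum.inl (B u))) := by
    intro u hu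
    rw [hf u hu]
    have hdiff : D.ch u \ C.verts = {Sum.inl (B u)} := by
      rcases hu with hu | hu
      · obtain ⟨p, q, hp⟩ := List.append_of_mem hu
        exact h.ch_diff_verts hPQ hp
      · obtain ⟨p, q, hp⟩ := List.append_of_mem hu
        exact h.ch_diff_verts hPQ.symm hp
    rw [hdiff]
    split_ifs with hl <;> simp [hl, or_comm]
  rw [hb']
  have hverts : (x ∈ C.verts ∧ x ≠ C.root) ↔ x = C.hybrid ∨ x ∈ C.inner₁ ∨ x ∈ C.inner₂ := by
    constructor
    · rintro ⟨hx, hxr⟩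
      exact (hPQ.mem_verts.1 hx).resolve_left hxr
    · rintro (rfl | hx | hx)
      · exact C.hybrid_mem
      · exact hPQ.side_mem hx
      · exact hPQ.symm.side_mem hx
  have hroot : x ∈ D.ch C.root → x ∈ C.verts ∧ x ≠ C.root := fun hx =>
    (h.mem_ch_cases (hPQ.mem_verts.2 (Or.inl rfl)) hx).resolve_right fun e => e.1 rfl
  rw [h.ch_hybrid]
  simp only [Set.mem_union, Set.mem_singleton_iff]
  constructor
  · rintro ((((hx | hx) | hx) | hx) | ⟨u, hu, hx⟩)
    · exact Or.inl hx
    · exact Or.inr (Or.inl (hroot hx))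
    · exact Or.inr (Or.inl (hverts.2 (Or.inl hx)))
    · exact Or.inr (Or.inr (Or.inl hx))
    · rcases (hfx u hu).1 hx with rfl | hx
      · exact Or.inr (Or.inl (hverts.2 (Or.inr hu)))
      · exact Or.inr (Or.inr (Or.inr ⟨u, hu, hx⟩))
  · rintro (hx | hx | hx | ⟨u, hu, hx⟩)
    · exact Or.inl (Or.inl (Or.inl (Or.inl hx)))
    · rcases hverts.1 hx with hx | hx
      · exact Or.inl (Or.inl (Or.inr hx))
      · exact Or.inr ⟨x, hx, (hfx x hx).2 (Or.inl rfl)⟩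
    · exact Or.inl (Or.inr hx)
    · exact Or.inr ⟨u, hu, (hfx u hu).2 (Or.inr hx)⟩

end IsCycleAt

end PvrNetwork

end Gatex

/-! ### Correctness of the visit of a prime module -/

namespace Gatex

namespace PvrNetwork

variable {V : Type u} [Fintype V] {G : SimpleGraph V} {D : PvrNetwork.{u, v} G}
  {B : D.Vert → StrongMod G}

namespace IsCycleAt

variable {M : PrimeMod G} {C : RootedCycle D.network} {P Q : List D.Vert}
  {ω ωNot : D.Vert → ℤ} {a b b' : Set D.Vert} {α β : ℤ}
-- `b` is the active set before the visit and contains nothing of the zone of `M`; `b'` is the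
-- active set after it. `a` stands for the final active set, of which only its agreement with `b'`
-- on that zone and the result for the children of `M` are known.
variable (h : D.IsCycleAt M C B)
  (ha : ∀ v ∈ D.actZone M.1, v ∈ a ↔ v ∈ b')
  (hb : ∀ v ∈ D.actZone M.1, v ∉ b)
  (hR : ∀ A : StrongMod G, A ⋖ M.1 → IsMaxCliqueIn G (A.1 : Set V) (D.reach a (Sum.inl A)))
  (hω : ∀ P Q, C.IsSides P Q → ∀ p q, P = p ++ q →
        ω (q.headD C.hybrid) = (G.induce (D.sideSet B q ∪ (B C.hybrid).1)).cliqueNum ∧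
        ωNot (q.headD C.hybrid) = (G.induce (D.sideSet B q)).cliqueNum)
  (hωB : ∀ w, w ∈ C.verts ∧ w ≠ C.root →
    ω (Sum.inl (B w)) = (G.induce ((B w).1 : Set V)).cliqueNum)
include h

theorem activate_zero_frame (hPQ : C.IsSides P Q)
    (hact : D.Activate C [P] ω ωNot α β NLabel.zero (b ∪ {P.headD C.hybrid}) b') {v : D.Vert}
    (hv : v ∉ D.actZone M.1) : v ∈ b' ↔ v ∈ b := by
  obtain ⟨F, hF, hb'⟩ := activate_zero hPQ hact
  rw [hb']
  constructor
  · rintro ((hx | hx) | ⟨u, hu, hx⟩)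
    · exact hx
    · rw [Set.mem_singleton_iff.1 hx] at hv
      exact absurd (h.mem_actZone (headD_mem hPQ (p := []) rfl)) hv
    · have huv : u ∈ C.verts := by
        rcases hu with hu | rfl
        · exact (hPQ.side_mem hu).1
        · exact C.hybrid_mem.1
      exact absurd (h.ch_subset_actZone huv ((hF u hu).1 hx)) hv
  · exact fun hx => Or.inl (Or.inl hx)

theorem activate_one_frame
    (hact : D.Activate C [C.inner₁, C.inner₂] ω ωNot α β NLabel.one b b') {v : D.Vert}
    (hv : v ∉ D.actZone M.1) : v ∈ b' ↔ v ∈ b := by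
  have hPQ := C.isSides_self
  by_cases hαβ : α ≤ β
  · obtain ⟨F, hF, hb'⟩ := h.activate_one_le hαβ hact
    rw [hb']
    constructor
    · rintro (hx | hx | ⟨u, hu, hx⟩)
      · exact hx
      · exact absurd (h.ch_subset_actZone (hPQ.mem_verts.2 (Or.inl rfl)) hx) hv
      · rcases hu with hu | hu
        · obtain ⟨p, q, hP⟩ := List.append_of_mem hu
          exact absurd (h.ch_subset_actZone (hPQ.side_mem hu).1 ((hF _ _ hPQ _ _ _ hP).1 hx)) hv
        · obtain ⟨p, q, hP⟩ := List.append_of_mem hu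
          exact absurd (h.ch_subset_actZone (hPQ.symm.side_mem hu).1
            ((hF _ _ hPQ.symm _ _ _ hP).1 hx)) hv
    · exact Or.inl
  · rw [h.activate_one_gt hαβ hact]
    constructor
    · rintro (hx | hx | rfl | ⟨u, hu, -, rfl⟩)
      · exact hx
      · exact absurd (h.mem_actZone hx) hv
      · exact absurd (h.inl_mod_mem_actZone C.hybrid_mem) hv
      · rcases hu with hu | hu
        · exact absurd (h.inl_mod_mem_actZone (hPQ.side_mem hu)) hv
        · exact absurd (h.inl_mod_mem_actZone (hPQ.symm.side_mem hu)) hv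
    · exact Or.inl

include ha hb hR hω hωB

theorem isMaxCliqueIn_of_activate_zero (hPQ : C.IsSides P Q)
    (hact : D.Activate C [P] ω ωNot α β NLabel.zero (b ∪ {P.headD C.hybrid}) b')
    (hmax : (G.induce (M.1.1 : Set V)).cliqueNum ≤
      (G.induce (D.sideSet B P ∪ (B C.hybrid).1)).cliqueNum) :
    IsMaxCliqueIn G (M.1.1 : Set V) (D.reach a (Sum.inl M.1)) := by
  obtain ⟨F, hF, hb'⟩ := activate_zero hPQ hact
  let U : Set D.Vert := {u | u ∈ P ∨ u = C.hybrid}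
  have hU : ∀ u ∈ U, u ∈ C.verts ∧ u ≠ C.root := by
    rintro u (hu | rfl)
    · exact hPQ.side_mem hu
    · exact C.hybrid_mem
  have hUP : ∀ u ∈ U, C.hybrid ∈ D.ch u → u ∈ P := by
    rintro u (hu | rfl) hmem
    · exact hu
    · exact absurd hmem h.hybrid_notMem_ch_hybrid
  obtain ⟨hch, hroot⟩ := h.ch_inter_eq (a := a) (U := U) (F := F) (R := {P.headD C.hybrid}) hU
    (fun u hu => (hF u hu).1)
    (fun u hu w hw h1 h2 => h.eq_of_hybrid_mem_ch hPQ (hUP u hu ((hF u hu).1 h1)) (hUP w hw h2)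
      ((hF u hu).1 h1) h2)
    (by rw [h.ch_root P Q hPQ]; simp)
    (fun x hx => by
      rw [ha x hx, hb' x, Set.mem_union, or_iff_right (hb x hx)]
      exact Iff.rfl)
  refine h.isMaxCliqueIn_root_zero hPQ hR (fun p q hP => (hω P Q hPQ p q hP).1)
    (fun w hw => hωB w (hPQ.side_mem hw)) hroot ?_ ?_ ?_ hmax
  · have hhyb := hch C.hybrid (Or.inr rfl)
    -- The hybrid-vertex has a single child, so this child is activated for either label.
    have hFh : F C.hybrid = D.ch C.hybrid := by
      obtain ⟨-, h0, h1⟩ := hF C.hybrid (Or.inr rfl)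
      rcases h.label_eq_zero_or_one C.hybrid_mem.1 with hl | hl
      · obtain ⟨x, hx, -, hFx⟩ := h0 hl
        rw [h.ch_hybrid] at hx ⊢
        rw [hFx, Set.mem_singleton_iff.1 hx]
      · exact h1 hl
    rw [hFh, Set.inter_eq_left, h.ch_hybrid] at hhyb
    exact hhyb rfl
  · intro w hw hl
    rw [hch w (Or.inl hw)]
    exact (hF w (Or.inl hw)).2.1 hl
  · intro w hw hl
    have := hch w (Or.inl hw)
    rw [(hF w (Or.inl hw)).2.2 hl] at this
    exact Set.inter_eq_left.1 this

theorem isMaxCliqueIn_of_activate_one (hr : D.label C.root = NLabel.one) (hPQ : C.IsSides P Q)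
    (hact : D.Activate C [C.inner₁, C.inner₂] ω ωNot α β NLabel.one b b')
    (hα : α = ω (P.headD C.hybrid) + ω (Q.headD C.hybrid) - ω C.hybrid)
    (hβ : β = ωNot (P.headD C.hybrid) + ωNot (Q.headD C.hybrid)) :
    IsMaxCliqueIn G (M.1.1 : Set V) (D.reach a (Sum.inl M.1)) := by
  have hP := hω P Q hPQ [] P rfl
  have hQ := hω Q P hPQ.symm [] Q rfl
  have hH := (hω P Q hPQ P [] (by simp)).1
  rw [sideSet_nil, Set.empty_union, List.headD_nil] at hH
  have hnum := h.cliqueNum_root_one hPQ hr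
  have hnumP := h.cliqueNum_side_union_hybrid hPQ
  have hnumQ := h.cliqueNum_side_union_hybrid hPQ.symm
  have hle1 := cliqueNum_induce_mono (G := G) (D.oneSet_subset (B := B) P)
  have hle2 := cliqueNum_induce_mono (G := G) (D.oneSet_subset (B := B) Q)
  rw [hP.1, hQ.1, hH] at hα
  rw [hP.2, hQ.2] at hβ
  have hmem : ∀ u, u ∈ C.inner₁ ∨ u ∈ C.inner₂ ↔ u ∈ P ∨ u ∈ Q := by
    intro u
    rcases hPQ with ⟨rfl, rfl⟩ | ⟨rfl, rfl⟩
    · rfl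
    · exact or_comm
  by_cases hαβ : α ≤ β
  · obtain ⟨F, hF, hb'⟩ := h.activate_one_le hαβ hact
    let U : Set D.Vert := {u | u ∈ P ∨ u ∈ Q}
    have hU : ∀ u ∈ U, ∃ P Q p q, C.IsSides P Q ∧ P = p ++ u :: q := by
      rintro u (hu | hu)
      · obtain ⟨p, q, e⟩ := List.append_of_mem hu
        exact ⟨_, _, p, q, hPQ, e⟩
      · obtain ⟨p, q, e⟩ := List.append_of_mem hu
        exact ⟨_, _, p, q, hPQ.symm, e⟩
    -- Only the last vertex of a side has the hybrid-vertex as a child, and that one activates its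
    -- attached module alone.
    have hhyb : ∀ u ∈ U, C.hybrid ∉ F u := by
      intro u hu hmem
      obtain ⟨P, Q, p, q, hPQ, e⟩ := hU u hu
      obtain ⟨h1, h2, -⟩ := hF P Q hPQ p u q e
      obtain ⟨p', hp'⟩ := (h.hybrid_mem_ch_iff hPQ (by simp [e])).1 (h1 hmem)
      rw [h2 (eq_of_nodup_append_cons hPQ.nodup_left e hp').2] at hmem
      exact h.ne_inl C.hybrid_mem _ hmem
    obtain ⟨hch, hroot⟩ := h.ch_inter_eq (a := a) (U := U) (F := F) (R := D.ch C.root)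
      (by
        rintro u (hu | hu)
        · exact hPQ.side_mem hu
        · exact hPQ.symm.side_mem hu)
      (fun u hu => by
        obtain ⟨P, Q, p, q, hPQ, e⟩ := hU u hu
        exact (hF P Q hPQ p u q e).1)
      (fun u hu w _ h1 => absurd h1 (hhyb u hu)) subset_rfl
      (fun x hx => by
        rw [ha x hx, hb' x, or_iff_right (hb x hx)]
        simp only [hmem]
        exact Iff.rfl)
    have hside : ∀ P Q, C.IsSides P Q → (∀ u ∈ P, u ∈ U) →
        IsMaxCliqueIn G (D.sideSet B P) (D.reach a (P.headD C.hybrid)) := by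
      intro P Q hPQ hPU
      refine h.isMaxCliqueIn_side hPQ hR (fun p q hP => (hω P Q hPQ p q hP).2)
        (fun w hw => hωB w (hPQ.side_mem hw)) ?_ ?_ ?_ (p := []) rfl (h.side_ne_nil P Q hPQ)
      · intro p w e
        rw [hch w (hPU w (by simp [e]))]
        exact (hF P Q hPQ p w [] e).2.1 rfl
      · intro p w q e hq hl
        rw [hch w (hPU w (by simp [e]))]
        exact (hF P Q hPQ p w q e).2.2.1 hq hl
      · intro p w q e hq hl
        have := hch w (hPU w (by simp [e]))
        rw [(hF P Q hPQ p w q e).2.2.2 hq hl] at this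
        exact Set.inter_eq_left.1 this
    refine h.isMaxCliqueIn_root_sides hPQ hr (Set.inter_eq_left.1 hroot)
      (hside P Q hPQ fun _ => Or.inl) (hside Q P hPQ.symm fun _ => Or.inr) ?_
    -- The label-1 parts with the hybrid module contribute at most `α`, hence at most `β`, so the
    -- two sides alone attain the maximum.
    omega
  · have hb' : ∀ x ∈ D.actZone M.1, x ∈ a ↔ (x ∈ C.verts ∧ x ≠ C.root) ∨
        x = Sum.inl (B C.hybrid) ∨
        ∃ u, (u ∈ P ∨ u ∈ Q) ∧ D.label u = NLabel.one ∧ x = Sum.inl (B u) := by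
      intro x hx
      rw [ha x hx, h.activate_one_gt hαβ hact, or_iff_right (hb x hx)]
      simp only [hmem]
    have hmod : ∀ w, w ∈ P ∨ w ∈ Q → (Sum.inl (B w) ∈ a ↔ D.label w = NLabel.one) := by
      intro w hw
      have hwv : (w ∈ C.verts ∧ w ≠ C.root) ∧ w ≠ C.hybrid := by
        rcases hw with hw | hw
        · exact ⟨hPQ.side_mem hw, fun e => hPQ.hybrid_notMem (e ▸ hw)⟩
        · exact ⟨hPQ.symm.side_mem hw, fun e => hPQ.symm.hybrid_notMem (e ▸ hw)⟩
      rw [hb' _ (h.inl_mod_mem_actZone hwv.1)]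
      constructor
      · rintro (e | e | ⟨u, hu, hl, e⟩)
        · exact absurd e.1 (h.inl_mod_notMem hwv.1)
        · exact absurd (h.inj w hwv.1.1 hwv.1.2 _ C.hybrid_mem.1 C.hybrid_mem.2 (Sum.inl.inj e))
            hwv.2
        · have huv : u ∈ C.verts ∧ u ≠ C.root := by
            rcases hu with hu | hu
            · exact hPQ.side_mem hu
            · exact hPQ.symm.side_mem hu
          rwa [h.inj w hwv.1.1 hwv.1.2 u huv.1 huv.2 (Sum.inl.inj e)]
      · exact fun hl => Or.inr (Or.inr ⟨w, hw, hl, rfl⟩)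
    refine h.isMaxCliqueIn_root_ones hPQ hR hr ?_ ?_ (fun w hw => hmod w (Or.inl hw))
      (fun w hw => hmod w (Or.inr hw)) ?_
    · exact fun v hv hvr => (hb' v (h.mem_actZone ⟨hv, hvr⟩)).2 (Or.inl ⟨hv, hvr⟩)
    · exact (hb' _ (h.inl_mod_mem_actZone C.hybrid_mem)).2 (Or.inr (Or.inl rfl))
    -- `α > β` forces both side maxima to use the hybrid module, so `α` is the total of the label-1
    -- parts and the hybrid module, and it exceeds the total of the two sides.
    · omega

end IsCycleAt

/-- The effect of the visit of `M`. -/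
structure IsVisit (D : PvrNetwork.{u, v} G) (M : StrongMod G) (s s' : D.State) : Prop where
  omega_frame : ∀ v, D.zone v ≠ M → s'.omega v = s.omega v
  omegaNot_frame : ∀ v, D.zone v ≠ M → s'.omegaNot v = s.omegaNot v
  active_frame : ∀ v ∉ D.actZone M, v ∈ s'.active ↔ v ∈ s.active
  omega_eq : (∀ A : StrongMod G, A ⋖ M →
      s.omega (Sum.inl A) = (G.induce (A.1 : Set V)).cliqueNum) →
    ∀ v, D.zone v = M → s'.omega v = (G.induce (D.leavesBelow v)).cliqueNum
  omegaNot_eq : (∀ A : StrongMod G, A ⋖ M →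
      s.omega (Sum.inl A) = (G.induce (A.1 : Set V)).cliqueNum) →
    ∀ (hp : mdLabel G M = MDLabel.prime) C B, D.IsCycleAt ⟨M, hp⟩ C B →
    ∀ v ∈ C.verts, v ≠ C.root →
      s'.omegaNot v = (G.induce (D.leavesBelow v \ D.leavesBelow C.hybrid)).cliqueNum
  -- The clique is stated for every set `a` that agrees with `s'.active` on the zone, because later
  -- visits activate further vertices outside it.
  isMaxCliqueIn : (∀ A : StrongMod G, A ⋖ M →
      s.omega (Sum.inl A) = (G.induce (A.1 : Set V)).cliqueNum) →
    (∀ v ∈ D.actZone M, v ∉ s.active) →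
    ∀ a : Set D.Vert, (∀ v ∈ D.actZone M, v ∈ a ↔ v ∈ s'.active) →
    (∀ A : StrongMod G, A ⋖ M → IsMaxCliqueIn G (A.1 : Set V) (D.reach a (Sum.inl A))) →
    IsMaxCliqueIn G (M.1 : Set V) (D.reach a (Sum.inl M))

theorem isVisit_of_visitPrime {M : StrongMod G} (hp : mdLabel G M = MDLabel.prime)
    {s s' : D.State} (hv : D.VisitPrime M s s') : D.IsVisit M s s' := by
  classical
  obtain ⟨C, hCr, c, s₁, s₂, hc, rfl, hloop, x, y, hxy, hch, hif⟩ := hv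
  -- The visit may use any rooted cycle starting at `M`; the classification of rooted cycles shows
  -- that it is the expected one.
  obtain ⟨⟨M', hp'⟩, B, h⟩ := D.exists_isCycleAt_of_rootedCycle C
  obtain rfl : M' = M := Sum.inl.inj (h.root_eq.symm.trans hCr)
  obtain ⟨i1, i2, i3⟩ := h.init_cycle hc hloop
  obtain ⟨P, Q, hPQ, rfl, rfl⟩ : ∃ P Q, C.IsSides P Q ∧ x = P.headD C.hybrid ∧
      y = Q.headD C.hybrid := by
    rw [h.ch_root _ _ C.isSides_self, Set.pair_eq_pair_iff] at hch
    rcases hch with ⟨e1, e2⟩ | ⟨e1, e2⟩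
    · exact ⟨_, _, C.isSides_self, e1.symm, e2.symm⟩
    · exact ⟨_, _, C.isSides_self.symm, e2.symm, e1.symm⟩
  have hrv : C.root ∈ C.verts := hPQ.mem_verts.2 (Or.inl rfl)
  -- Everything but the activation depends only on the value given to the root.
  have main : ∀ (n : ℤ) (b : Set D.Vert),
      s' = { s₂ with omega := Function.update s₂.omega C.root n, active := b } →
      (∀ v ∉ D.actZone M', v ∈ b ↔ v ∈ s₂.active) →
      ((∀ A : StrongMod G, A ⋖ M' →
        s.omega (Sum.inl A) = (G.induce (A.1 : Set V)).cliqueNum) →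
        n = (G.induce (M'.1 : Set V)).cliqueNum) →
      ((∀ A : StrongMod G, A ⋖ M' →
        s.omega (Sum.inl A) = (G.induce (A.1 : Set V)).cliqueNum) →
        (∀ v ∈ D.actZone M', v ∉ s₂.active) →
        ∀ a : Set D.Vert, (∀ v ∈ D.actZone M', v ∈ a ↔ v ∈ b) →
        (∀ A : StrongMod G, A ⋖ M' → IsMaxCliqueIn G (A.1 : Set V) (D.reach a (Sum.inl A))) →
        IsMaxCliqueIn G (M'.1 : Set V) (D.reach a (Sum.inl M'))) → D.IsVisit M' s s' := by
    intro n b hs' hframe hn hmax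
    subst hs'
    have hzone : ∀ v, D.zone v ≠ M' → v ∉ C.verts := fun v hv e => hv (h.zone_eq_iff.2 e)
    refine ⟨fun v hv => ?_, fun v hv => ?_, fun v hv => ?_, fun hω v hv => ?_,
      fun hω hp C' B' h' v hv hvr => ?_, fun hω hs a ha hR => ?_⟩
    · have hv' := hzone v hv
      have hne : v ≠ C.root := fun e => hv' (e ▸ hrv)
      simp only [Function.update_of_ne hne]
      exact (i1 v fun e => hv' e.1).1
    · exact (i1 v fun e => hzone v hv e.1).2
    · rw [← i2]
      exact hframe v hv
    · have hv' := h.zone_eq_iff.1 hv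
      by_cases hvr : v = C.root
      · subst hvr
        simp only [Function.update_self]
        rw [hn hω, h.root_eq, D.leavesBelow_inl]
      · obtain ⟨P, Q, p, q, hPQ, hP, rfl⟩ := IsCycleAt.exists_headD ⟨hv', hvr⟩
        simp only [Function.update_of_ne hvr]
        rw [(i3 hω P Q hPQ p q hP).1, h.leavesBelow_eq hPQ hP]
    · obtain ⟨P, Q, p, q, hPQ, hP, rfl⟩ := IsCycleAt.exists_headD
        ((h.mem_iff v).2 ((h'.mem_iff v).1 ⟨hv, hvr⟩))
      rw [h.hybrid_unique h', h.leavesBelow_diff_eq hPQ hP]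
      exact (i3 hω P Q hPQ p q hP).2
    · rw [← i2] at hs
      exact hmax hω hs a ha hR
  have hBs₂ : (∀ A : StrongMod G, A ⋖ M' →
      s.omega (Sum.inl A) = (G.induce (A.1 : Set V)).cliqueNum) →
      ∀ w, w ∈ C.verts ∧ w ≠ C.root →
        s₂.omega (Sum.inl (B w)) = (G.induce ((B w).1 : Set V)).cliqueNum := by
    intro hω w hw
    rw [(i1 _ fun e => h.inl_mod_notMem hw e.1).1]
    exact hω _ (h.covBy w hw.1 hw.2)
  split_ifs at hif with hl
  · obtain ⟨w, P', b, hw, hwmax, hP', hwP', hact, hs'⟩ := hif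
    obtain ⟨R, S, hRS, hwR⟩ : ∃ R S, C.IsSides R S ∧ w = R.headD C.hybrid := by
      rcases hw with rfl | rfl
      · exact ⟨P, Q, hPQ, rfl⟩
      · exact ⟨Q, P, hPQ.symm, rfl⟩
    have hwR' : w ∈ R := hwR ▸ h.headD_mem_side hRS
    -- Sides are non-empty, so the chosen child `w` of the root is an internal vertex and lies on
    -- one side only.
    have hP'R : P' = R := by
      have hne : w ≠ C.hybrid := fun e => hRS.hybrid_notMem (e ▸ hwR')
      have hwP : w ∈ P' := by
        rcases List.mem_append.1 hwP' with e | e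
        · exact e
        · exact absurd (List.mem_singleton.1 e) hne
      by_contra hcon
      have : P' = S := by
        rcases hRS with ⟨rfl, rfl⟩ | ⟨rfl, rfl⟩ <;> tauto
      exact hRS.disjoint hwR' (this ▸ hwP)
    subst hP'R
    rw [hwR] at hact
    refine main _ b hs' (fun v hv => h.activate_zero_frame hRS hact hv) (fun hω => ?_)
      fun hω hs a ha hR => ?_
    · rw [h.cliqueNum_root_zero hPQ hl, (i3 hω P Q hPQ [] P rfl).1,
        (i3 hω Q P hPQ.symm [] Q rfl).1, Nat.cast_max]
    · refine h.isMaxCliqueIn_of_activate_zero ha hs hR (i3 hω) (hBs₂ hω) hRS hact ?_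
      rw [hwR, (i3 hω P Q hPQ [] P rfl).1, (i3 hω Q P hPQ.symm [] Q rfl).1,
        (i3 hω _ _ hRS [] P' rfl).1] at hwmax
      rw [h.cliqueNum_root_zero hPQ hl]
      omega
  · obtain ⟨α, β, b, hα, hβ, hact, hs'⟩ := hif
    have hl1 := (h.label_eq_zero_or_one hrv).resolve_left hl
    refine main _ b hs' (fun v hv => h.activate_one_frame hact hv) (fun hω => ?_)
      fun hω hs a ha hR => ?_
    · have hH := (i3 hω P Q hPQ P [] (by simp)).1
      rw [sideSet_nil, Set.empty_union, List.headD_nil] at hH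
      rw [h.cliqueNum_root_one_eq_max hPQ hl1, hα, hβ, (i3 hω P Q hPQ [] P rfl).1,
        (i3 hω Q P hPQ.symm [] Q rfl).1, (i3 hω P Q hPQ [] P rfl).2,
        (i3 hω Q P hPQ.symm [] Q rfl).2, hH]
    · exact h.isMaxCliqueIn_of_activate_one ha hs hR (i3 hω) (hBs₂ hω) hl1 hPQ hact hα hβ

end PvrNetwork

end Gatex

/-! ### Correctness of the remaining visits and of the final state -/

namespace Gatex

namespace PvrNetwork

variable {V : Type u} [Fintype V] {G : SimpleGraph V} {D : PvrNetwork.{u, v} G}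

theorem eq_inl_of_zone_eq {M : StrongMod G} (hM : mdLabel G M ≠ MDLabel.prime) {v : D.Vert}
    (hv : D.zone v = M) : v = Sum.inl M := by
  cases v with
  | inl A => exact congrArg Sum.inl hv
  | inr p =>
    obtain rfl : p.1.1 = M := hv
    exact absurd p.1.2 hM

/-- Distinct children of `M` are non-adjacent, so a clique lies within one child. -/
theorem cliqueNum_eq_of_mdLabel_zero {M B : StrongMod G} (hl : mdLabel G M = MDLabel.zero)
    (hB : B ⋖ M) (hmax : ∀ A : StrongMod G, A ⋖ M →
      (G.induce (A.1 : Set V)).cliqueNum ≤ (G.induce (B.1 : Set V)).cliqueNum) :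
    (G.induce (M.1 : Set V)).cliqueNum = (G.induce (B.1 : Set V)).cliqueNum := by
  apply le_antisymm _ (cliqueNum_induce_mono hB.le)
  apply cliqueNum_induce_le_of_forall
  intro K hK hc
  rcases K.eq_empty_or_nonempty with rfl | ⟨x, hx⟩
  · simp
  obtain ⟨A, hA, hxA⟩ := StrongMod.exists_covBy_mem (card_ne_one_of_covBy hB) (hK hx)
  refine (ncard_le_cliqueNum_induce (fun y hy => ?_) hc).trans (hmax A hA)
  obtain ⟨A', hA', hyA'⟩ := StrongMod.exists_covBy_mem (card_ne_one_of_covBy hB) (hK hy)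
  by_contra hyA
  have hAA' : A ≠ A' := fun e => hyA (e ▸ hyA')
  refine not_adj_of_not_connected (not_connected_of_mdLabel_zero hl) hA hA' hAA' hxA hyA' ?_
  exact hc hx hy fun e => hyA (e ▸ hxA)

theorem isVisit_of_zero {M : StrongMod G} (hl : mdLabel G M = MDLabel.zero) {s s' : D.State}
    (hv : D.VisitVertex M s s') : D.IsVisit M s s' := by
  classical
  simp only [VisitVertex, hl] at hv
  obtain ⟨B, hB, hmax, rfl⟩ := hv
  have hnp : mdLabel G M ≠ MDLabel.prime := by
    rw [hl]
    simp
  have hnum : (∀ A : StrongMod G, A ⋖ M →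
      s.omega (Sum.inl A) = (G.induce (A.1 : Set V)).cliqueNum) →
      (G.induce (M.1 : Set V)).cliqueNum = (G.induce (B.1 : Set V)).cliqueNum := by
    intro hω
    refine cliqueNum_eq_of_mdLabel_zero hl hB fun A hA => ?_
    have := hmax A hA
    rw [hω A hA, hω B hB] at this
    exact_mod_cast this
  refine ⟨fun v hv => ?_, fun _ _ => rfl, fun v hv => ?_, fun hω v hv => ?_,
    fun _ hp => absurd hp hnp, fun hω hs a ha hR => ?_⟩
  · exact Function.update_of_ne (fun e => hv (by rw [e]; rfl)) _ _
  · have hne : v ≠ Sum.inl B := fun e => hv (Or.inl ⟨B, hB, e⟩)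
    simp [hne]
  · obtain rfl := eq_inl_of_zone_eq hnp hv
    simp only [Function.update_self]
    rw [D.leavesBelow_inl, hnum hω, hω B hB]
  · have hch : D.ch (Sum.inl M) ∩ a = {Sum.inl B} := by
      rw [D.ch_inl hnp]
      ext z
      constructor
      · rintro ⟨⟨A, hA, rfl⟩, hza⟩
        have hz : (Sum.inl A : D.Vert) ∈ D.actZone M := Or.inl ⟨A, hA, rfl⟩
        exact ((ha _ hz).1 hza).resolve_left (hs _ hz)
      · rintro rfl
        exact ⟨⟨B, hB, rfl⟩, (ha _ (Or.inl ⟨B, hB, rfl⟩)).2 (Or.inr rfl)⟩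
    rw [reach_eq_of_ch_inter_eq (by rintro _ ⟨⟩; exact card_ne_one_of_covBy hB) hch]
    exact (hR B hB).mono hB.le (hnum hω).le

theorem isVisit_of_one {M : StrongMod G} (hl : mdLabel G M = MDLabel.one) {s s' : D.State}
    (hv : D.VisitVertex M s s') : D.IsVisit M s s' := by
  classical
  simp only [VisitVertex, hl] at hv
  subst hv
  have hnp : mdLabel G M ≠ MDLabel.prime := by
    rw [hl]
    simp
  have hc : M.1.card ≠ 1 := fun e => by
    rw [mdLabel_eq_leaf_iff.2 e] at hl
    cases hl
  have hU : (M.1 : Set V) =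
      ⋃ B ∈ ({B : StrongMod G | B ⋖ M} : Finset (StrongMod G)), (B.1 : Set V) := by
    rw [StrongMod.iUnion_covBy hc]
    simp
  have hadj : ∀ A ∈ ({B : StrongMod G | B ⋖ M} : Finset (StrongMod G)),
      ∀ B ∈ ({B : StrongMod G | B ⋖ M} : Finset (StrongMod G)), A ≠ B →
      ∀ a ∈ (A.1 : Set V), ∀ b ∈ (B.1 : Set V), G.Adj a b := by
    intro A hA B hB hAB a ha b hb
    exact adj_of_not_connected_compl (not_connected_of_mdLabel_one hl) (by simpa using hA)
      (by simpa using hB) hAB ha hb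
  refine ⟨fun v hv => ?_, fun _ _ => rfl, fun v hv => ?_, fun hω v hv => ?_,
    fun _ hp => absurd hp hnp, fun hω hs a ha hR => ?_⟩
  · exact Function.update_of_ne (fun e => hv (by rw [e]; rfl)) _ _
  · exact ⟨fun e => e.resolve_right fun h => hv (Or.inl h), Or.inl⟩
  · obtain rfl := eq_inl_of_zone_eq hnp hv
    simp only [Function.update_self]
    rw [D.leavesBelow_inl, hU, cliqueNum_biUnion_join _ _ hadj, Nat.cast_sum]
    refine Finset.sum_congr (by ext; simp) fun B hB => ?_
    exact hω B (by simpa using hB)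
  · have hch : D.ch (Sum.inl M) ∩ a = Sum.inl '' {B : StrongMod G | B ⋖ M} := by
      rw [D.ch_inl hnp, Set.inter_eq_left]
      rintro _ ⟨B, hB, rfl⟩
      exact (ha _ (Or.inl ⟨B, hB, rfl⟩)).2 (Or.inr ⟨B, hB, rfl⟩)
    have hreach : D.reach a (Sum.inl M) =
        ⋃ B ∈ ({B : StrongMod G | B ⋖ M} : Finset (StrongMod G)), D.reach a (Sum.inl B) := by
      rw [D.reach_eq_iUnion (by rintro _ ⟨⟩; exact hc), hch, Set.biUnion_image]
      simp
    rw [hU, hreach]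
    exact isMaxCliqueIn_biUnion_join _ _ _ (fun B hB => hR B (by simpa using hB)) hadj

theorem isVisit_of_visitVertex {M : StrongMod G} {s s' : D.State} (hv : D.VisitVertex M s s') :
    D.IsVisit M s s' := by
  cases hl : mdLabel G M with
  | zero => exact isVisit_of_zero hl hv
  | one => exact isVisit_of_one hl hv
  | leaf =>
    simp only [VisitVertex, hl] at hv
  | prime =>
    simp only [VisitVertex, hl] at hv
    exact isVisit_of_visitPrime hl hv

/-- Uniqueness of tree parents makes activation zones disjoint, so no other visit interferes with
what the visit of `M` activates. -/
theorem eq_of_mem_actZone {M M' : StrongMod G} {v : D.Vert} (h : v ∈ D.actZone M)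
    (h' : v ∈ D.actZone M') : M = M' := by
  rcases h with ⟨A, hA, rfl⟩ | ⟨p, rfl, hp⟩ <;> rcases h' with ⟨A', hA', e⟩ | ⟨p', e, hp'⟩
  · cases e
    exact StrongMod.eq_of_covBy hA hA'
  · cases e
  · cases e
  · cases e
    exact hp.symm.trans hp'

theorem loop_frame {l : List (StrongMod G)} {s s' : D.State} (h : Loop D.VisitVertex l s s') :
    (∀ v, D.zone v ∉ l → s'.omega v = s.omega v ∧ s'.omegaNot v = s.omegaNot v) ∧
    ∀ v, (∀ M ∈ l, v ∉ D.actZone M) → (v ∈ s'.active ↔ v ∈ s.active) := by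
  induction h with
  | nil s => exact ⟨fun _ _ => ⟨rfl, rfl⟩, fun _ _ => Iff.rfl⟩
  | @cons M l s a s' hM _ ih =>
    have hv := isVisit_of_visitVertex hM
    refine ⟨fun v hz => ?_, fun v hz => ?_⟩
    · simp only [List.mem_cons, not_or] at hz
      rw [(ih.1 v hz.2).1, (ih.1 v hz.2).2]
      exact ⟨hv.omega_frame v hz.1, hv.omegaNot_frame v hz.1⟩
    · rw [ih.2 v fun N hN => hz N (List.mem_cons_of_mem _ hN)]
      exact hv.active_frame v (hz M List.mem_cons_self)

/-- In the final state, every visited module looks as after its visit. -/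
theorem exists_isVisit_of_isResult {s : D.State} (hs : D.IsResult s) {M : StrongMod G}
    (hM : mdLabel G M ≠ MDLabel.leaf) :
    ∃ a b : D.State, D.IsVisit M a b ∧
      (∀ A : StrongMod G, A ⋖ M → a.omega (Sum.inl A) = s.omega (Sum.inl A)) ∧
      (∀ v, D.zone v = M → s.omega v = b.omega v ∧ s.omegaNot v = b.omegaNot v) ∧
      ∀ v ∈ D.actZone M, v ∉ a.active ∧ (v ∈ s.active ↔ v ∈ b.active) := by
  obtain ⟨l, s₀, hnd, hmem, hord, -, hact, hloop⟩ := hs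
  obtain ⟨l₁, l₂, rfl⟩ := List.append_of_mem ((hmem M).2 hM)
  rw [Loop.append_iff] at hloop
  obtain ⟨a, h₁, h₂⟩ := hloop
  cases h₂ with
  | @cons _ _ _ b _ hMab h₂ =>
    have hv := isVisit_of_visitVertex hMab
    obtain ⟨f₁, g₁⟩ := loop_frame h₁
    obtain ⟨f₂, g₂⟩ := loop_frame h₂
    have hMl₂ : M ∉ l₂ := (List.nodup_cons.1 (List.nodup_append.1 hnd).2.1).1
    have hMl₁ : M ∉ l₁ := fun e => (List.nodup_append.1 hnd).2.2 M e M (by simp) rfl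
    refine ⟨a, b, hv, fun A hA => ?_, fun v hz => ?_, fun v hz => ⟨?_, ?_⟩⟩
    -- Children precede their parent in the visiting order, so the value of `A` read by the visit of
    -- `M` is already the final one.
    · have hAl₂ : A ∉ l₂ := fun e =>
        (List.pairwise_cons.1 (List.pairwise_append.1 hord).2.1).1 A e hA.lt
      rw [(f₂ (Sum.inl A) hAl₂).1, hv.omega_frame (Sum.inl A) hA.lt.ne]
    · exact f₂ v (by rwa [hz])
    · rw [g₁ v fun N hN hz' => hMl₁ (eq_of_mem_actZone hz hz' ▸ hN), hact]
      exact Set.notMem_empty v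
    · exact g₂ v fun N hN hz' => hMl₂ (eq_of_mem_actZone hz hz' ▸ hN)

theorem omega_inl_of_isResult {s : D.State} (hs : D.IsResult s) (A : StrongMod G) :
    s.omega (Sum.inl A) = (G.induce (A.1 : Set V)).cliqueNum := by
  induction A using WellFoundedLT.induction with
  | ind A ih =>
    by_cases hl : mdLabel G A = MDLabel.leaf
    -- One-element modules are never visited, so the initial value 1 survives.
    · obtain ⟨x, hx⟩ := Finset.card_eq_one.1 (mdLabel_eq_leaf_iff.1 hl)
      obtain ⟨l, s₀, -, hmem, -, hleaf, -, hloop⟩ := hs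
      have hAx : (Sum.inl A : D.Vert) = D.leafVert x := congrArg Sum.inl (Subtype.ext hx)
      rw [((loop_frame hloop).1 (Sum.inl A) fun e => (hmem A).1 e hl).1, hAx, hleaf, hx,
        Finset.coe_singleton, cliqueNum_induce_singleton]
      rfl
    · obtain ⟨a, b, hv, ha, hb, -⟩ := exists_isVisit_of_isResult hs hl
      rw [(hb (Sum.inl A) rfl).1, hv.omega_eq (fun B hB => by rw [ha B hB, ih B hB.lt])
        (Sum.inl A) rfl, D.leavesBelow_inl]

theorem omega_of_isResult {s : D.State} (hs : D.IsResult s) (v : D.Vert) :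
    s.omega v = (G.induce (D.leavesBelow v)).cliqueNum := by
  by_cases hl : mdLabel G (D.zone v) = MDLabel.leaf
  · rw [eq_inl_of_zone_eq (by rw [hl]; simp) (rfl : D.zone v = D.zone v), D.leavesBelow_inl]
    exact omega_inl_of_isResult hs _
  · obtain ⟨a, b, hv, ha, hb, -⟩ := exists_isVisit_of_isResult hs hl
    rw [(hb v rfl).1]
    exact hv.omega_eq (fun B hB => by rw [ha B hB, omega_inl_of_isResult hs]) v rfl

theorem omegaNot_of_isResult {s : D.State} (hs : D.IsResult s) (C : RootedCycle D.network)
    {w : D.Vert} (hw : w ∈ C.verts) (hwr : w ≠ C.root) :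
    s.omegaNot w = (G.induce (D.leavesBelow w \ D.leavesBelow C.hybrid)).cliqueNum := by
  obtain ⟨⟨M, hp⟩, B, h⟩ := D.exists_isCycleAt_of_rootedCycle C
  obtain ⟨a, b, hv, ha, hb, -⟩ := exists_isVisit_of_isResult hs (M := M) (by rw [hp]; simp)
  rw [(hb w (h.zone_eq_iff.2 hw)).2]
  exact hv.omegaNot_eq (fun B hB => by rw [ha B hB, omega_inl_of_isResult hs]) hp C B h w hw hwr

theorem isMaxCliqueIn_of_isResult {s : D.State} (hs : D.IsResult s) (A : StrongMod G) :
    IsMaxCliqueIn G (A.1 : Set V) (D.reach s.active (Sum.inl A)) := by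
  induction A using WellFoundedLT.induction with
  | ind A ih =>
    by_cases hl : mdLabel G A = MDLabel.leaf
    · have hc := mdLabel_eq_leaf_iff.1 hl
      obtain ⟨x, hx⟩ := Finset.card_eq_one.1 hc
      rw [D.reach_inl_of_card hc, hx, Finset.coe_singleton]
      exact isMaxCliqueIn_singleton x
    · obtain ⟨a, b, hv, ha, -, hact⟩ := exists_isVisit_of_isResult hs hl
      exact hv.isMaxCliqueIn (fun B hB => by rw [ha B hB, omega_inl_of_isResult hs])
        (fun v hz => (hact v hz).1) s.active (fun v hz => (hact v hz).2)
        fun B hB => ih B hB.lt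

theorem isMaximumClique_of_isResult [Nonempty V] {s : D.State} (hs : D.IsResult s) :
    G.IsMaximumClique (D.Omega s) := by
  have h := isMaxCliqueIn_of_isResult hs ⟨Finset.univ, isStrongModule_univ G⟩
  have hcoe : (D.Omega s : Set V) =
      D.reach s.active (Sum.inl ⟨Finset.univ, isStrongModule_univ G⟩) := by
    ext x
    simp only [Finset.mem_coe, Omega, Finset.mem_filter]
    exact ⟨fun e => e.2, fun e => ⟨Finset.mem_univ _, e⟩⟩
  rw [← hcoe] at h
  refine ⟨h.2.1, fun t ht => ?_⟩
  rw [← Set.ncard_coe_finset (D.Omega s), h.2.2, ← Set.ncard_coe_finset t]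
  exact ncard_le_cliqueNum_induce (by simp) ht

end PvrNetwork

end Gatex

/-! ### Executability of the algorithm -/

namespace Gatex

namespace PvrNetwork

variable {V : Type u} [Fintype V] {G : SimpleGraph V} {D : PvrNetwork.{u, v} G}
  {B : D.Vert → StrongMod G}

namespace IsCycleAt

variable {M : PrimeMod G} {C : RootedCycle D.network} {P Q : List D.Vert} {w : D.Vert}
variable (h : D.IsCycleAt M C B)
include h

theorem exists_max_ch (hw : w ∈ C.verts ∧ w ≠ C.root) (ω : D.Vert → ℤ) :
    ∃ x ∈ D.ch w, ∀ z ∈ D.ch w, ω z ≤ ω x := by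
  have hside : ∀ P Q, C.IsSides P Q → w ∈ P → (D.ch w).Finite ∧ (D.ch w).Nonempty := by
    intro P Q hPQ hwP
    obtain ⟨p, q, e⟩ := List.append_of_mem hwP
    rw [h.ch_side P Q hPQ p w q e]
    exact ⟨Set.toFinite _, Set.insert_nonempty _ _⟩
  have hch : (D.ch w).Finite ∧ (D.ch w).Nonempty := by
    have hPQ := C.isSides_self
    rcases hPQ.mem_verts.1 hw.1 with e | rfl | e | e
    · exact absurd e hw.2
    · rw [h.ch_hybrid]
      exact ⟨Set.toFinite _, Set.singleton_nonempty _⟩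
    · exact hside _ _ hPQ e
    · exact hside _ _ hPQ.symm e
  exact Set.exists_max_image _ ω hch.1 hch.2

theorem exists_activate_zero (hPQ : C.IsSides P Q) (ω ωNot : D.Vert → ℤ) (α β : ℤ)
    (b : Set D.Vert) : ∃ b', D.Activate C [P] ω ωNot α β NLabel.zero b b' := by
  classical
  simp only [Activate, if_true]
  apply Loop.exists_of_forall
  intro w hw s
  have hw' : w ∈ C.verts ∧ w ≠ C.root := by
    have : w = C.hybrid ∨ w ∈ P := by simpa using hw
    rcases this with rfl | hw
    · exact C.hybrid_mem
    · exact hPQ.side_mem hw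
  by_cases hl : D.label w = NLabel.zero
  · obtain ⟨x, hx, hmax⟩ := h.exists_max_ch hw' ω
    exact ⟨s ∪ {x}, by rw [if_pos hl]; exact ⟨x, hx, hmax, rfl⟩⟩
  · exact ⟨s ∪ D.ch w, by rw [if_neg hl]⟩

theorem exists_activate_one (ω ωNot : D.Vert → ℤ) (α β : ℤ) (b : Set D.Vert) :
    ∃ b', D.Activate C [C.inner₁, C.inner₂] ω ωNot α β NLabel.one b b' := by
  classical
  have hPQ := C.isSides_self
  by_cases hαβ : α ≤ β
  · obtain ⟨p₁, w₁, hw₁⟩ := (List.eq_nil_or_concat _).resolve_left (h.side_ne_nil _ _ hPQ)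
    obtain ⟨p₂, w₂, hw₂⟩ := (List.eq_nil_or_concat _).resolve_left (h.side_ne_nil _ _ hPQ.symm)
    rw [List.concat_eq_append] at hw₁ hw₂
    have hne : w₁ ≠ w₂ := fun e => hPQ.disjoint (w := w₁) (by simp [hw₁]) (by simp [hw₂, e])
    -- Both sides are non-empty, so the parents of the hybrid-vertex are the last internal vertices
    -- of the sides.
    have hpar : parents D.network C.hybrid = {w₁, w₂} := by
      ext z
      refine (h.adj_hybrid_iff _ _ hPQ z).trans ?_
      have key : ∀ (L p : List D.Vert) (w : D.Vert), L = p ++ [w] →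
          ((∃ p, L = p ++ [z]) ↔ z = w) := by
        rintro _ p w rfl
        constructor
        · rintro ⟨p', e⟩
          simpa using (congrArg List.getLast? e).symm
        · rintro rfl
          exact ⟨p, rfl⟩
      rw [key _ _ _ hw₁, key _ _ _ hw₂]
      rfl
    obtain ⟨b', hb'⟩ := Loop.exists_of_forall (l := ([C.inner₁, C.inner₂].flatMap
        List.reverse).filter fun w => w ≠ w₁ ∧ w ≠ w₂)
      (body := fun w (b b' : Set D.Vert) =>
          ∃ x y, D.ch w ∩ C.verts = {x} ∧ D.ch w \ C.verts = {y} ∧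
            if D.label w = NLabel.zero then
              (ω y ≤ ωNot x ∧ b' = b ∪ {x}) ∨ (ωNot x ≤ ω y ∧ b' = b ∪ {y})
            else b' = b ∪ {x, y})
      (by
        intro w hw s
        have hw' : w ∈ C.inner₁ ∨ w ∈ C.inner₂ := by simpa using List.mem_of_mem_filter hw
        obtain ⟨P, Q, p, q, hPQ, e⟩ : ∃ P Q p q, C.IsSides P Q ∧ P = p ++ w :: q := by
          rcases hw' with hw | hw
          · obtain ⟨p, q, e⟩ := List.append_of_mem hw
            exact ⟨_, _, p, q, hPQ, e⟩
          · obtain ⟨p, q, e⟩ := List.append_of_mem hw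
            exact ⟨_, _, p, q, hPQ.symm, e⟩
        have hx := h.ch_inter_verts hPQ e
        have hy := h.ch_diff_verts hPQ e
        by_cases hl : D.label w = NLabel.zero
        · rcases le_total (ω (Sum.inl (B w))) (ωNot (q.headD C.hybrid)) with hle | hle
          · exact ⟨_, _, _, hx, hy, by rw [if_pos hl]; exact Or.inl ⟨hle, rfl⟩⟩
          · exact ⟨_, _, _, hx, hy, by rw [if_pos hl]; exact Or.inr ⟨hle, rfl⟩⟩
        · exact ⟨_, _, _, hx, hy, by rw [if_neg hl]⟩)
      (b ∪ D.ch C.root ∪ (D.ch w₁ \ {C.hybrid}) ∪ (D.ch w₂ \ {C.hybrid}))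
    refine ⟨b', ?_⟩
    rw [Activate, if_neg (by simp), if_pos hαβ]
    refine ⟨w₁, w₂, hne, hpar, ?_⟩
    convert hb'
  · obtain ⟨b', hb'⟩ := Loop.exists_of_forall (l := [C.inner₁, C.inner₂].flatMap List.reverse)
      (body := fun w (b b' : Set D.Vert) =>
        b' = b ∪ {w} ∪ (if D.label w = NLabel.one then D.ch w \ C.verts else ∅))
      (fun w _ s => ⟨_, rfl⟩) (b ∪ D.ch C.root ∪ {C.hybrid} ∪ D.ch C.hybrid)
    refine ⟨b', ?_⟩
    rw [Activate, if_neg (by simp), if_neg hαβ]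
    convert hb'

end IsCycleAt

theorem exists_visitPrime (M : PrimeMod G) (s : D.State) : ∃ s', D.VisitPrime M.1 s s' := by
  classical
  obtain ⟨C, B, h⟩ := D.exists_isCycleAt M
  have hPQ := C.isSides_self
  obtain ⟨s₂, hs₂⟩ := Loop.exists_of_forall (body := D.InitInner C)
    (l := C.inner₁.reverse ++ C.inner₂.reverse)
    (fun w hw s => by
      rcases List.mem_append.1 hw with hw | hw
      · exact h.exists_initInner hPQ (List.mem_reverse.1 hw) s
      · exact h.exists_initInner hPQ.symm (List.mem_reverse.1 hw) s)
    { s with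
      omega := Function.update s.omega C.hybrid (s.omega (Sum.inl (B C.hybrid)))
      omegaNot := Function.update s.omegaNot C.hybrid 0 }
  have hne : C.inner₁.headD C.hybrid ≠ C.inner₂.headD C.hybrid := fun e =>
    hPQ.disjoint (h.headD_mem_side hPQ) (e ▸ h.headD_mem_side hPQ.symm)
  have key : ∃ s', if D.label C.root = NLabel.zero then
      ∃ w P a, (w = C.inner₁.headD C.hybrid ∨ w = C.inner₂.headD C.hybrid) ∧
          s₂.omega w = max (s₂.omega (C.inner₁.headD C.hybrid))
            (s₂.omega (C.inner₂.headD C.hybrid)) ∧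
          (P = C.inner₁ ∨ P = C.inner₂) ∧ w ∈ P ++ [C.hybrid] ∧
          D.Activate C [P] s₂.omega s₂.omegaNot 0 0 NLabel.zero (s₂.active ∪ {w}) a ∧
          s' = { s₂ with
            omega := Function.update s₂.omega C.root (max (s₂.omega (C.inner₁.headD C.hybrid))
              (s₂.omega (C.inner₂.headD C.hybrid)))
            active := a }
      else
        ∃ α β a, α = s₂.omega (C.inner₁.headD C.hybrid) +
            s₂.omega (C.inner₂.headD C.hybrid) - s₂.omega C.hybrid ∧
          β = s₂.omegaNot (C.inner₁.headD C.hybrid) + s₂.omegaNot (C.inner₂.headD C.hybrid) ∧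
          D.Activate C [C.inner₁, C.inner₂] s₂.omega s₂.omegaNot α β NLabel.one s₂.active a ∧
          s' = { s₂ with
            omega := Function.update s₂.omega C.root (max α β)
            active := a } := by
    split_ifs with hl
    · rcases le_total (s₂.omega (C.inner₂.headD C.hybrid))
        (s₂.omega (C.inner₁.headD C.hybrid)) with hle | hle
      · obtain ⟨b, hb⟩ := h.exists_activate_zero hPQ s₂.omega s₂.omegaNot 0 0
          (s₂.active ∪ {C.inner₁.headD C.hybrid})
        exact ⟨_, _, _, b, Or.inl rfl, (max_eq_left hle).symm, Or.inl rfl,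
          List.mem_append_left _ (h.headD_mem_side hPQ), hb, rfl⟩
      · obtain ⟨b, hb⟩ := h.exists_activate_zero hPQ.symm s₂.omega s₂.omegaNot 0 0
          (s₂.active ∪ {C.inner₂.headD C.hybrid})
        exact ⟨_, _, _, b, Or.inr rfl, (max_eq_right hle).symm, Or.inr rfl,
          List.mem_append_left _ (h.headD_mem_side hPQ.symm), hb, rfl⟩
    · obtain ⟨b, hb⟩ := h.exists_activate_one s₂.omega s₂.omegaNot _ _ s₂.active
      exact ⟨_, _, _, b, rfl, rfl, hb, rfl⟩
  obtain ⟨s', hs'⟩ := key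
  refine ⟨s', C, h.root_eq, _, _, s₂, h.ch_hybrid, rfl, ?_, _, _, hne, h.ch_root _ _ hPQ, ?_⟩
  · convert hs₂
  · convert hs'

theorem exists_visitVertex {M : StrongMod G} (hM : mdLabel G M ≠ MDLabel.leaf) (s : D.State) :
    ∃ s', D.VisitVertex M s s' := by
  classical
  cases hl : mdLabel G M with
  | leaf => exact absurd hl hM
  | one =>
    simp only [VisitVertex, hl]
    exact ⟨_, rfl⟩
  | prime =>
    simp only [VisitVertex, hl]
    exact exists_visitPrime ⟨M, hl⟩ s
  | zero =>
    simp only [VisitVertex, hl]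
    obtain ⟨x, hx⟩ := M.nonempty
    obtain ⟨B₀, hB₀, -⟩ := StrongMod.exists_covBy_mem (fun e => hM (mdLabel_eq_leaf_iff.2 e)) hx
    obtain ⟨B, hB, hmax⟩ := Set.exists_max_image {B : StrongMod G | B ⋖ M}
      (fun B => s.omega (Sum.inl B)) (Set.toFinite _) ⟨B₀, hB₀⟩
    exact ⟨_, B, hB, hmax, rfl⟩

/-- The algorithm can be executed. -/
theorem exists_isResult (D : PvrNetwork.{u, v} G) : ∃ s : D.State, D.IsResult s := by
  classical
  let l₀ : List (StrongMod G) :=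
    ({M | mdLabel G M ≠ MDLabel.leaf} : Finset (StrongMod G)).toList
  -- Sorting by cardinality puts every module after its proper submodules.
  let le : StrongMod G → StrongMod G → Bool := fun A B => decide (A.1.card ≤ B.1.card)
  let l := l₀.mergeSort le
  have hperm : l.Perm l₀ := List.mergeSort_perm l₀ le
  have hmem : ∀ M, M ∈ l ↔ mdLabel G M ≠ MDLabel.leaf := by
    intro M
    rw [hperm.mem_iff]
    simp [l₀]
  have hsort : l.Pairwise fun A B => le A B = true := by
    apply List.pairwise_mergeSort
    · intro A B C hAB hBC
      simp only [le, decide_eq_true_eq] at hAB hBC ⊢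
      omega
    · intro A B
      simp only [le, Bool.or_eq_true, decide_eq_true_eq]
      omega
  obtain ⟨s, hs⟩ := Loop.exists_of_forall (body := D.VisitVertex) (l := l)
    (fun M hM s => exists_visitVertex ((hmem M).1 hM) s) ⟨fun _ => 1, fun _ => 0, ∅⟩
  refine ⟨s, l, _, hperm.nodup_iff.2 (Finset.nodup_toList _), hmem, hsort.imp ?_, fun _ => rfl,
    rfl, hs⟩
  intro A B hAB hBA
  simp only [le, decide_eq_true_eq] at hAB
  have : B.1.card < A.1.card := Finset.card_lt_card hBA
  omega

end PvrNetwork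

end Gatex

theorem mainTheorem8 {V : Type u} [Fintype V] [Nonempty V] (G : SimpleGraph V)
    (hG : Gatex.IsGaTEx G) (D : Gatex.PvrNetwork.{u, v} G) :
    (∃ s : D.State, D.IsResult s) ∧
    ∀ s : D.State, D.IsResult s →
      s.omega D.root = (G.cliqueNum : ℤ) ∧
      (∀ w : D.Vert, s.omega w = ((G.induce (D.leavesBelow w)).cliqueNum : ℤ)) ∧
      (∀ (C : Gatex.RootedCycle D.network), ∀ w ∈ C.verts, w ≠ C.root →
        s.omegaNot w =
          ((G.induce (D.leavesBelow w \ D.leavesBelow C.hybrid)).cliqueNum : ℤ)) ∧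
      G.IsMaximumClique (D.Omega s) := by
  refine ⟨D.exists_isResult, fun s hs => ⟨?_, Gatex.PvrNetwork.omega_of_isResult hs,
    fun C w hw hwr => Gatex.PvrNetwork.omegaNot_of_isResult hs C hw hwr,
    Gatex.PvrNetwork.isMaximumClique_of_isResult hs⟩⟩
  have h := Gatex.PvrNetwork.omega_inl_of_isResult hs ⟨Finset.univ, Gatex.isStrongModule_univ G⟩
  rw [Finset.coe_univ, Gatex.cliqueNum_induce_univ] at h
  exact h
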